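/- **Definitions.** All state sets and alphabets are finite. A *(deterministic) two-way transducer* $\mathcal T=(Q,A,B,\delta,\gamma,q_0,F)$ has a partial transition function $\delta$ from $Q\times(A\uplus\{\vdash,\dashv\})$ to $Q\times\{-1,0,+1\}$ that never moves left on $\vdash$ nor right on $\dashv$, a production function $\gamma:Q\times(A\uplus\{\vdash,\dashv\})\to B^*$, an initial state $q_0\in Q$ and a set $F\subseteq Q$ of final states. On input $u\in A^*$ it runs over the tape $\vdash u\dashv$, starting in $q_0$ on $\vdash$; in state $p$ on the symbol $s$ with $\delta(p,s)=(q,d)$ it outputs $\gamma(p,s)$, goes to state $q$ and moves its head by $d$. The run accepts when it is for the first time on $\dashv$ in a final state, and $\mathcal T(u)$ is then the output produced so far; if this never happens, $\mathcal T(u)$ is undefined. A *(deterministic) sequential transducer* $(Q,A,B,\delta,\gamma,q_0,F)$ is the one-way analogue: $\delta$ is a partial function from $Q\times(A\uplus\{\vdash,\dashv\})$ to $Q$, the machine reads $\vdash u\dashv$ once from left to right, outputs $\gamma(p,s)$ when it reads $s$ in state $p$, and accepts if it is in a final state at the end. (Machines without endmarkers are the special case where the endmarkers change no state and produce nothing.)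 For a two-way transducer, $w\in A^*$ (without endmarkers) and $x,y\in\{\ell,r\}$, the *behavior* $\mathrm{bh}_{xy}(w)$ is the set of pairs $(p,q)$ of states such that some run inside $w$ starts in state $p$ at the first ($x=\ell$) or last ($x=r$) position of $w$ and leaves $w$ on the left ($y=\ell$) or right ($y=r$) end in state $q$; $\mathrm{bh}_{xy}(\varepsilon)$ is the identity if $x\ne y$ and is empty if $x=y$. Its *transition monoid* is the quotient of $A^*$ by the congruence that identifies two words when their four behaviors agree. For a sequential transducer the behavior of $w$ is the set of pairs $(p,q)$ such that there is a run over $w$ from $p$ to $q$, and the transition monoid is the quotient of $A^*$ by equality of behaviors. A transducer is *aperiodic* if its transition monoid $M$ is, i.e. if there is an $n$ such that $x^n=x^{n+1}$ for all $x\in M$. **Theorem (composition).** Let $\mathcal A$ be an aperiodic deterministic sequential transducer and $\mathcal B$ an aperiodic deterministic two-way transducer whose input alphabet is the output alphabet of $\mathcal A$. Then one can effectively construct an aperiodic deterministic two-way transducer $\mathcal C$ that realizes the partial function $\mathcal B\circ\mathcal A$ (so $\mathcal C(u)=\mathcal B(\mathcal A(u))$, and $\mathcal C(u)$ is defined if and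 only if $\mathcal A(u)$ and $\mathcal B(\mathcal A(u))$ are): there is a computable function which, for all such $\mathcal A$ and $\mathcal B$ (over any finite alphabets, with states and letters numbered), maps the transition and production tables, initial states and final states of $\mathcal A$ and $\mathcal B$ to those of such a $\mathcal C$. -/

import Mathlib

/-- The symbols on the tape of a machine with input alphabet `A`: the letters of `A` and the two
endmarkers `⊢` and `⊣`. -/
inductive TapeSymbol (A : Type*) where
  | leftEnd : TapeSymbol A
  | letter : A → TapeSymbol A
  | rightEnd : TapeSymbol A

/-- The tape content `⊢ u ⊣` for the input word `u`. -/
def markedWord {A : Type*} (u : List A) : List (TapeSymbol A) :=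
  TapeSymbol.leftEnd :: (u.map TapeSymbol.letter ++ [TapeSymbol.rightEnd])

/-- A monoid is aperiodic if `x ^ n = x ^ (n + 1)` holds for all its elements, for some `n`. -/
def Monoid.IsAperiodic (M : Type*) [Monoid M] : Prop :=
  ∃ n : ℕ, ∀ x : M, x ^ n = x ^ (n + 1)

/-! ### Two-way automata and transducers -/

/-- The moves `-1`, `0`, `+1` of a reading head. -/
inductive HeadMove where
  | left : HeadMove
  | stay : HeadMove
  | right : HeadMove

/-- The position reached from `m`. (A left move is never made from position `0`.) -/
def HeadMove.apply : HeadMove → ℕ → ℕ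
  | left, m => m - 1
  | stay, m => m
  | right, m => m + 1

/-- A deterministic two-way automaton with state set `Q` and input alphabet `A`. The value `none`
of the transition function means that there is no transition. -/
structure TwoWayAutomaton (Q A : Type*) where
  δ : Q → TapeSymbol A → Option (Q × HeadMove)
  δ_leftEnd : ∀ p q, δ p TapeSymbol.leftEnd ≠ some (q, HeadMove.left)
  δ_rightEnd : ∀ p q, δ p TapeSymbol.rightEnd ≠ some (q, HeadMove.right)
  start : Q
  accept : Finset Q

/-- A deterministic two-way transducer: a two-way automaton with a production function `γ`. -/
structure TwoWayTransducer (Q A B : Type*) extends TwoWayAutomaton Q A where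
  γ : Q → TapeSymbol A → List B

/-- The two ends of a word. -/
inductive WordEnd where
  | left : WordEnd
  | right : WordEnd

/-- The cells of an unmarked word `w`: its letters are at the positions `1, …, |w|`. -/
def factorCell {A : Type*} (w : List A) : ℕ → Option (TapeSymbol A)
  | 0 => none
  | m + 1 => (w[m]?).map TapeSymbol.letter

/-- The position at which a run over `w` starts that enters `w` at the given end: the first or the
last position of `w`. -/
def entryPos {A : Type*} (w : List A) : WordEnd → ℕ
  | WordEnd.left => 1
  | WordEnd.right => w.length

/-- The position of a run that has left `w` at the given end. -/
def exitPos {A : Type*} (w : List A) : WordEnd → ℕ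
  | WordEnd.left => 0
  | WordEnd.right => w.length + 1

namespace TwoWayAutomaton

variable {Q A : Type*} (M : TwoWayAutomaton Q A)

/-- One transition between configurations (state, position) inside the unmarked word `w`. -/
def FactorStep (w : List A) (c d : Q × ℕ) : Prop :=
  ∃ s e, factorCell w c.2 = some s ∧ M.δ c.1 s = some (d.1, e) ∧ d.2 = e.apply c.2

/-- There is a run over the unmarked word `w` from `c` to `d`. All positions but the last one are
between `1` and `|w|`, because there are no transitions elsewhere. -/
def FactorRun (w : List A) : Q × ℕ → Q × ℕ → Prop :=
  Relation.ReflTransGen (M.FactorStep w)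

/-- The behavior of `w` from the end `x` to the end `y`: the set of pairs `(p, q)` such that some
run over `w` starts in state `p` at the end `x` and leaves `w` in state `q` at the end `y`. (The
empty word has the identity as its left-to-right and right-to-left behaviors, and its two other
behaviors are empty.) -/
def behavior (w : List A) (x y : WordEnd) : Set (Q × Q) :=
  {pq | M.FactorRun w (pq.1, entryPos w x) (pq.2, exitPos w y)}

/-! The behaviors of a product `w ++ z` are determined by those of `w` and of `z`. -/

/-- The places at which a run over `w ++ z` enters `w`, enters `z`, or leaves `w ++ z`. -/
inductive Port where
  | fst : WordEnd → Port
  | snd : WordEnd → Port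
  | out : WordEnd → Port

/-- Where a run is that has just left `w`. -/
def Port.afterFst : WordEnd → Port
  | WordEnd.left => Port.out WordEnd.left
  | WordEnd.right => Port.snd WordEnd.left

/-- Where a run is that has just left `z`. -/
def Port.afterSnd : WordEnd → Port
  | WordEnd.left => Port.fst WordEnd.right
  | WordEnd.right => Port.out WordEnd.right

/-- The place at which a run over `w ++ z` starts. -/
def Port.start : WordEnd → Port
  | WordEnd.left => Port.fst WordEnd.left
  | WordEnd.right => Port.snd WordEnd.right

/-- A traversal of one of the two words, for given behaviors `E` of `w` and `F` of `z`. -/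
inductive Traversal (E F : WordEnd → WordEnd → Set (Q × Q)) : Port × Q → Port × Q → Prop
  | fst (x y : WordEnd) (p q : Q) (h : (p, q) ∈ E x y) :
      Traversal E F (Port.fst x, p) (Port.afterFst y, q)
  | snd (x y : WordEnd) (p q : Q) (h : (p, q) ∈ F x y) :
      Traversal E F (Port.snd x, p) (Port.afterSnd y, q)

/-- The position in `w ++ z` of a place. -/
def portPos (w z : List A) : Port → ℕ
  | Port.fst x => entryPos w x
  | Port.snd x => w.length + entryPos z x
  | Port.out y => exitPos (w ++ z) y

theorem factorCell_append_left {w : List A} (z : List A) {m : ℕ} (hm : m ≤ w.length) :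
    factorCell (w ++ z) m = factorCell w m := by
  cases m with
  | zero => rfl
  | succ m => simp only [factorCell]; rw [List.getElem?_append_left (by omega)]

theorem factorCell_append_right (w z : List A) {m : ℕ} (hm : 0 < m) :
    factorCell (w ++ z) (w.length + m) = factorCell z m := by
  cases m with
  | zero => omega
  | succ m =>
    rw [← Nat.add_assoc]
    simp only [factorCell]
    rw [List.getElem?_append_right (by omega)]
    simp

theorem factorCell_some {w : List A} {m : ℕ} {s : TapeSymbol A} (h : factorCell w m = some s) :
    0 < m ∧ m ≤ w.length := by
  cases m with
  | zero => simp [factorCell] at h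
  | succ m =>
    refine ⟨by omega, ?_⟩
    by_contra hlt
    rw [factorCell, List.getElem?_eq_none (by omega)] at h
    simp at h

theorem FactorRun.append_left {w : List A} (z : List A) {c d : Q × ℕ} (h : M.FactorRun w c d) :
    M.FactorRun (w ++ z) c d := by
  refine Relation.ReflTransGen.mono ?_ c d h
  rintro c d ⟨s, e, h1, h2, h3⟩
  exact ⟨s, e, by rw [factorCell_append_left z (factorCell_some h1).2, h1], h2, h3⟩

theorem FactorRun.append_right (w : List A) {z : List A} {c d : Q × ℕ} (h : M.FactorRun z c d) :
    M.FactorRun (w ++ z) (c.1, w.length + c.2) (d.1, w.length + d.2) := by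
  refine Relation.ReflTransGen.lift (fun c : Q × ℕ => (c.1, w.length + c.2)) ?_ c d h
  rintro c d ⟨s, e, h1, h2, h3⟩
  have h0 := factorCell_some h1
  refine ⟨s, e, by rw [factorCell_append_right w z h0.1, h1], h2, ?_⟩
  cases e <;> simp only [HeadMove.apply] at h3 ⊢ <;> omega

theorem FactorRun.of_traversal (w z : List A) {a b : Port × Q}
    (h : Relation.ReflTransGen (Traversal (M.behavior w) (M.behavior z)) a b) :
    M.FactorRun (w ++ z) (a.2, portPos w z a.1) (b.2, portPos w z b.1) := by
  induction h with
  | refl => exact Relation.ReflTransGen.refl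
  | tail _ hstep ih =>
    refine Relation.ReflTransGen.trans ih ?_
    cases hstep with
    | fst x y p q h =>
      have h' := FactorRun.append_left M z h
      cases y <;> exact h'
    | snd x y p q h =>
      have h' := FactorRun.append_right M w h
      cases y
      · exact h'
      · have e : portPos w z (Port.afterSnd WordEnd.right) = w.length + (z.length + 1) := by
          simp [portPos, Port.afterSnd, exitPos, Nat.add_assoc]
        simp only [e]
        exact h'

theorem FactorRun.to_traversal (w z : List A) {c : Q × ℕ} {q : Q} {y : WordEnd}
    (h : M.FactorRun (w ++ z) c (q, exitPos (w ++ z) y)) :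
    (c.2 ≤ w.length → ∃ s p, M.FactorRun w c (p, exitPos w s) ∧
      Relation.ReflTransGen (Traversal (M.behavior w) (M.behavior z))
        (Port.afterFst s, p) (Port.out y, q)) ∧
    (∀ m, c.2 = w.length + m → 0 < m → ∃ s p, M.FactorRun z (c.1, m) (p, exitPos z s) ∧
      Relation.ReflTransGen (Traversal (M.behavior w) (M.behavior z))
        (Port.afterSnd s, p) (Port.out y, q)) := by
  induction h using Relation.ReflTransGen.head_induction_on with
  | refl =>
    cases y with
    | left =>
      exact ⟨fun _ => ⟨WordEnd.left, q, Relation.ReflTransGen.refl, Relation.ReflTransGen.refl⟩,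
        fun m h1 h2 => by simp only [exitPos] at h1; omega⟩
    | right =>
      refine ⟨fun h1 => by simp only [exitPos, List.length_append] at h1; omega, fun m h1 h2 => ?_⟩
      obtain rfl : m = z.length + 1 := by simp [exitPos] at h1; omega
      exact ⟨WordEnd.right, q, Relation.ReflTransGen.refl, Relation.ReflTransGen.refl⟩
  | @head c d hcd _ ih =>
    obtain ⟨s, e, h1, h2, h3⟩ := hcd
    obtain ⟨p, m⟩ := c
    obtain ⟨p', m'⟩ := d
    simp only at h1 h2 h3 ih ⊢
    have h0 := factorCell_some h1
    constructor
    · intro hm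
      have hs : M.FactorStep w (p, m) (p', m') :=
        ⟨s, e, by rw [← h1, factorCell_append_left z hm], h2, h3⟩
      by_cases hm' : m' ≤ w.length
      · obtain ⟨t, r, hr, ht⟩ := ih.1 hm'
        exact ⟨t, r, Relation.ReflTransGen.head hs hr, ht⟩
      · obtain rfl : m' = w.length + 1 := by
          cases e <;> simp only [HeadMove.apply] at h3 <;> omega
        obtain ⟨t, r, hr, ht⟩ := ih.2 1 rfl Nat.one_pos
        exact ⟨WordEnd.right, p', Relation.ReflTransGen.single hs,
          Relation.ReflTransGen.head (Traversal.snd WordEnd.left t p' r hr) ht⟩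
    · intro k hk hk0
      subst hk
      rw [factorCell_append_right w z hk0] at h1
      by_cases hm' : m' ≤ w.length
      · obtain rfl : m' = w.length := by
          cases e <;> simp only [HeadMove.apply] at h3 <;> omega
        have hs : M.FactorStep z (p, k) (p', 0) := by
          refine ⟨s, e, h1, h2, ?_⟩
          cases e <;> simp only [HeadMove.apply] at h3 ⊢ <;> omega
        obtain ⟨t, r, hr, ht⟩ := ih.1 le_rfl
        exact ⟨WordEnd.left, p', Relation.ReflTransGen.single hs,
          Relation.ReflTransGen.head (Traversal.fst WordEnd.right t p' r hr) ht⟩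
      · have hs : M.FactorStep z (p, k) (p', m' - w.length) := by
          refine ⟨s, e, h1, h2, ?_⟩
          cases e <;> simp only [HeadMove.apply] at h3 ⊢ <;> omega
        obtain ⟨t, r, hr, ht⟩ := ih.2 (m' - w.length) (by omega) (by omega)
        exact ⟨t, r, Relation.ReflTransGen.head hs hr, ht⟩

theorem behavior_append (w z : List A) (x y : WordEnd) :
    M.behavior (w ++ z) x y =
      {pq | Relation.ReflTransGen (Traversal (M.behavior w) (M.behavior z))
        (Port.start x, pq.1) (Port.out y, pq.2)} := by
  ext ⟨p, q⟩
  constructor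
  · intro h
    have H := FactorRun.to_traversal M w z h
    cases x with
    | left =>
      by_cases hw : 1 ≤ w.length
      · obtain ⟨t, r, hr, ht⟩ := H.1 hw
        exact Relation.ReflTransGen.head (Traversal.fst WordEnd.left t p r hr) ht
      · have hw0 : w.length = 0 := by omega
        obtain ⟨t, r, hr, ht⟩ := H.2 1 (by simp [entryPos, hw0]) Nat.one_pos
        refine Relation.ReflTransGen.head
          (Traversal.fst WordEnd.left WordEnd.right p p ?_)
          (Relation.ReflTransGen.head (Traversal.snd WordEnd.left t p r hr) ht)
        simp only [behavior, Set.mem_ofPred_eq, entryPos, exitPos, hw0]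
        exact Relation.ReflTransGen.refl
    | right =>
      by_cases hz : 1 ≤ z.length
      · obtain ⟨t, r, hr, ht⟩ := H.2 z.length (by simp [entryPos]) hz
        exact Relation.ReflTransGen.head (Traversal.snd WordEnd.right t p r hr) ht
      · have hz0 : z.length = 0 := by omega
        obtain ⟨t, r, hr, ht⟩ := H.1 (by simp [entryPos, hz0])
        have hr' : (p, r) ∈ M.behavior w WordEnd.right t := by
          simpa [behavior, entryPos, hz0] using hr
        refine Relation.ReflTransGen.head
          (Traversal.snd WordEnd.right WordEnd.left p p ?_)
          (Relation.ReflTransGen.head (Traversal.fst WordEnd.right t p r hr') ht)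
        simp only [behavior, Set.mem_ofPred_eq, entryPos, exitPos, hz0]
        exact Relation.ReflTransGen.refl
  · intro h
    have h' := FactorRun.of_traversal M w z h
    cases x with
    | left => exact h'
    | right => simpa [behavior, Port.start, portPos, entryPos] using h'

/-- The congruence of the transition monoid: two words are equivalent if each of the four
behaviors is the same for both. -/
def transitionCon : Con (FreeMonoid A) where
  r w z := ∀ x y, M.behavior (FreeMonoid.toList w) x y = M.behavior (FreeMonoid.toList z) x y
  iseqv := ⟨fun _ _ _ => rfl, fun h x y => (h x y).symm, fun h k x y => (h x y).trans (k x y)⟩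
  mul' := by
    intro a b c d h k x y
    have h' := funext fun x => funext fun y => h x y
    have k' := funext fun x => funext fun y => k x y
    rw [FreeMonoid.toList_mul, FreeMonoid.toList_mul, behavior_append, behavior_append, h', k']

/-- The transition monoid of a two-way automaton. -/
abbrev TransitionMonoid : Type _ := M.transitionCon.Quotient

end TwoWayAutomaton

namespace TwoWayTransducer

variable {Q A B : Type*} (T : TwoWayTransducer Q A B)

/-- A two-way transducer is aperiodic if the transition monoid of its input automaton is. -/
def IsAperiodic : Prop := Monoid.IsAperiodic T.toTwoWayAutomaton.TransitionMonoid

/-- `(p, m)` is an accepting configuration on the tape `⊢ u ⊣`: the head is on `⊣` and the state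
is final. -/
def Accepting (u : List A) (p : Q) (m : ℕ) : Prop := m = u.length + 1 ∧ p ∈ T.accept

/-- `T.Produces u p m v`: the run over `⊢ u ⊣` from state `p` at position `m` reaches an accepting
configuration, and `v` is the output produced until the first accepting configuration is reached.
The positions are `0` for `⊢`, then `1, …, |u|` for the letters of `u`, and `|u| + 1` for `⊣`. -/
inductive Produces (u : List A) : Q → ℕ → List B → Prop
  | halt (p : Q) (m : ℕ) (h : T.Accepting u p m) : Produces u p m []
  | step (p q : Q) (m : ℕ) (s : TapeSymbol A) (d : HeadMove) (v : List B)
      (h : ¬ T.Accepting u p m) (hs : (markedWord u)[m]? = some s) (hd : T.δ p s = some (q, d))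
      (hv : Produces u q (d.apply m) v) : Produces u p m (T.γ p s ++ v)

theorem Produces.unique {u : List A} {p : Q} {m : ℕ} {v v' : List B} (h : T.Produces u p m v)
    (h' : T.Produces u p m v') : v = v' := by
  induction h generalizing v' with
  | halt p m h =>
    cases h' with
    | halt => rfl
    | step => contradiction
  | step p q m s d v h hs hd _ ih =>
    cases h' with
    | halt => contradiction
    | step _ q' _ s' d' v1 _ hs' hd' hv' =>
      obtain rfl : s = s' := Option.some.inj (hs.symm.trans hs')
      have e := Option.some.inj (hd.symm.trans hd')
      obtain ⟨rfl, rfl⟩ := Prod.mk.inj e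
      rw [ih hv']

/-- The partial function realized by a two-way transducer. -/
noncomputable def fn : List A →. List B := fun u =>
  ⟨∃ v, T.Produces u T.start 0 v, fun h => h.choose⟩

theorem mem_fn {u : List A} {v : List B} : v ∈ T.fn u ↔ T.Produces u T.start 0 v :=
  ⟨fun ⟨h, e⟩ => e ▸ h.choose_spec, fun h => ⟨⟨v, h⟩, Produces.unique T (Exists.choose_spec _) h⟩⟩

end TwoWayTransducer

/-! ### Sequential transducers -/

/-- A sequential transducer, that is, a deterministic one-way transducer. It reads the marked word
`⊢ u ⊣` once from left to right. The value `none` of `δ` means that there is no transition. (A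
machine without endmarkers is the special case where the endmarkers change no state and produce
nothing.) -/
structure SequentialTransducer (Q A B : Type*) where
  δ : Q → TapeSymbol A → Option Q
  γ : Q → TapeSymbol A → List B
  start : Q
  accept : Finset Q

namespace SequentialTransducer

variable {Q A B : Type*} (T : SequentialTransducer Q A B)

/-- `T.Run p x q v`: the run reading `x` from state `p` ends in state `q` and produces `v`. -/
inductive Run : Q → List (TapeSymbol A) → Q → List B → Prop
  | nil (p : Q) : Run p [] p []
  | cons (p q r : Q) (s : TapeSymbol A) (x : List (TapeSymbol A)) (v : List B)
      (hd : T.δ p s = some q) (h : Run q x r v) : Run p (s :: x) r (T.γ p s ++ v)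

/-- The behavior of `w`: the set of pairs `(p, q)` such that some run over `w` leads from `p`
to `q`. -/
def behavior (w : List A) : Set (Q × Q) :=
  {pq | ∃ v, T.Run pq.1 (w.map TapeSymbol.letter) pq.2 v}

theorem Run.append_iff {x y : List (TapeSymbol A)} {p r : Q} :
    (∃ v, T.Run p (x ++ y) r v) ↔ ∃ q, (∃ v, T.Run p x q v) ∧ ∃ v, T.Run q y r v := by
  induction x generalizing p with
  | nil =>
    constructor
    · rintro ⟨v, h⟩
      exact ⟨p, ⟨[], Run.nil p⟩, v, h⟩
    · rintro ⟨q, ⟨v, h⟩, k⟩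
      cases h
      exact k
  | cons s x ih =>
    constructor
    · rintro ⟨v, h⟩
      cases h with
      | cons _ q _ _ _ v hd h =>
        obtain ⟨q', ⟨v1, h1⟩, h2⟩ := ih.1 ⟨v, h⟩
        exact ⟨q', ⟨_, Run.cons p q q' s x v1 hd h1⟩, h2⟩
    · rintro ⟨q', ⟨v, h⟩, k⟩
      cases h with
      | cons _ q _ _ _ v hd h =>
        obtain ⟨v1, h1⟩ := ih.2 ⟨q', ⟨v, h⟩, k⟩
        exact ⟨_, Run.cons p q r s (x ++ y) v1 hd h1⟩

theorem behavior_append (w z : List A) :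
    T.behavior (w ++ z) = {pr | ∃ q, (pr.1, q) ∈ T.behavior w ∧ (q, pr.2) ∈ T.behavior z} := by
  ext ⟨p, r⟩
  simp only [behavior, List.map_append, Set.mem_ofPred_eq]
  exact Run.append_iff T

theorem Run.unique {x : List (TapeSymbol A)} {p q q' : Q} {v v' : List B} (h : T.Run p x q v)
    (h' : T.Run p x q' v') : q = q' ∧ v = v' := by
  induction h generalizing q' v' with
  | nil p => cases h'; exact ⟨rfl, rfl⟩
  | cons p q r s x v hd _ ih =>
    cases h' with
    | cons _ q1 _ _ _ v1 hd1 h1 =>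
      obtain rfl : q = q1 := Option.some.inj (hd.symm.trans hd1)
      obtain ⟨rfl, rfl⟩ := ih h1
      exact ⟨rfl, rfl⟩

/-- The congruence of the transition monoid: two words are equivalent if they have the same
behavior. -/
def transitionCon : Con (FreeMonoid A) where
  r w z := T.behavior (FreeMonoid.toList w) = T.behavior (FreeMonoid.toList z)
  iseqv := ⟨fun _ => rfl, fun h => h.symm, fun h k => h.trans k⟩
  mul' := by
    intro a b c d h k
    rw [FreeMonoid.toList_mul, FreeMonoid.toList_mul, behavior_append, behavior_append, h, k]

/-- The transition monoid of the input automaton of a sequential transducer. -/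
abbrev TransitionMonoid : Type _ := T.transitionCon.Quotient

/-- A sequential transducer is aperiodic if the transition monoid of its input automaton is. -/
def IsAperiodic : Prop := Monoid.IsAperiodic T.TransitionMonoid

/-- `v` is the output of an accepting run over `⊢ u ⊣`, which leads from the initial state to a
final one. -/
def Produces (u : List A) (v : List B) : Prop :=
  ∃ q ∈ T.accept, T.Run T.start (markedWord u) q v

/-- The partial function realized by a sequential transducer. -/
noncomputable def fn : List A →. List B := fun u =>
  ⟨∃ v, T.Produces u v, fun h => h.choose⟩

theorem mem_fn {u : List A} {v : List B} : v ∈ T.fn u ↔ T.Produces u v := by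
  constructor
  · rintro ⟨h, rfl⟩
    exact h.choose_spec
  · intro h
    refine ⟨⟨v, h⟩, ?_⟩
    obtain ⟨q, _, hq⟩ := h
    obtain ⟨q', _, hq'⟩ := Exists.choose_spec (p := fun v => T.Produces u v) ⟨v, q, ‹_›, hq⟩
    exact (Run.unique T hq' hq).2

end SequentialTransducer

/-! ### Transducers as finite data

States and letters are numbered. A transducer is written down as the numbers of its states, input
letters and output letters, its table, its initial state and the list of its final states. The
table has one row for each state and in it one entry for each of the symbols
`⊢, 0, 1, …, k - 1, ⊣`, which holds the transition, if there is one, and the production. -/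

/-- The moves `-1`, `0`, `+1` are written as `0`, `1`, `2`. -/
def HeadMove.code : HeadMove → ℕ
  | left => 0
  | stay => 1
  | right => 2

/-- Descriptions of two-way transducers: an entry of the table is the new state and the move, if
there is a transition, and the production. -/
abbrev TwoWayCode : Type :=
  (ℕ × ℕ × ℕ) × List (List (Option (ℕ × ℕ) × List ℕ)) × ℕ × List ℕ

/-- Descriptions of sequential transducers: an entry of the table is the new state, if there is a
transition, and the production. -/
abbrev SequentialCode : Type :=
  (ℕ × ℕ × ℕ) × List (List (Option ℕ × List ℕ)) × ℕ × List ℕ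

/-- The description of a two-way transducer. -/
def TwoWayTransducer.code {n k l : ℕ} (T : TwoWayTransducer (Fin n) (Fin k) (Fin l)) :
    TwoWayCode :=
  ((n, k, l),
    (List.finRange n).map (fun p => (markedWord (List.finRange k)).map (fun s =>
      ((T.δ p s).map (fun t => (t.1.val, t.2.code)), (T.γ p s).map Fin.val))),
    T.start.val,
    ((List.finRange n).filter (fun p => p ∈ T.accept)).map Fin.val)

/-- The description of a sequential transducer. -/
def SequentialTransducer.code {n k l : ℕ} (T : SequentialTransducer (Fin n) (Fin k) (Fin l)) :
    SequentialCode :=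
  ((n, k, l),
    (List.finRange n).map (fun p => (markedWord (List.finRange k)).map (fun s =>
      ((T.δ p s).map Fin.val, (T.γ p s).map Fin.val))),
    T.start.val,
    ((List.finRange n).filter (fun p => p ∈ T.accept)).map Fin.val)

/-!
The composition of a sequential transducer `𝒜` and a two-way transducer `ℬ` is realized by the
classical simulation of Hopcroft and Ullman, and the point is that this simulation preserves
aperiodicity.

The composite machine (`CompData.machine`) keeps its head on a letter of the input, together with
the state `p` of `𝒜` in front of this letter and the offset of the simulated head of `ℬ` in the
block that `𝒜` produces on this letter in state `p`. If the simulated head leaves the block on the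
right, then `𝒜` is run by one step. If it leaves it on the left, then the state of `𝒜` one position
earlier has to be recovered. If several states lead to `p` on the preceding letter, then the machine
moves further to the left and keeps a function from the states at the present position to these
candidates. When only one candidate is left, or `⊢` is reached and the initial state of `𝒜` decides,
it takes two states that merge exactly at the place where the search began, the first of which leads
to the right candidate, and runs them to the right until they merge. Before all this, `𝒜` is
completed by a sink, so that its transition function is total. The relation
`CompData.Track` links the configurations of the composite machine with those of `ℬ`, and
`CompData.produces_iff` says that the right function is computed.

Aperiodicity rests on a criterion for finite automata (`TwoWayAutomaton.isAperiodic_of_crossing`):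
for large `n`, the runs over `w ^ n` and over `w ^ (n + 1)` that start in the same state and cross
the word have to leave it in the same state. For runs that return to the side where they came from
there is nothing to show, because the set of these runs increases with `n`, and the set of the
crossing runs decreases as soon as the crossing states agree.

* From left to right (`CompData.crossing_left_right`), the states of `𝒜` after a few factors `w` are
  fixed by `w`, because `𝒜` is aperiodic. A pair of different such states never merges, so that a
  search passes through unchanged. A simulation of `ℬ` is a run of `ℬ` over an output of the form
  `v t ^ k`, and `ℬ` is aperiodic.
* From right to left (`CompData.crossing_right_left`), let `p` be the state of `𝒜` at the place
  where the run enters. The set of the states in front of `w ^ n` that lead to `p` does not depend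
  on `n`, and these states agree after some bounded prefix of `w ^ n`. Let `Z` be the shortest
  prefix after which they agree. To the right of `Z` all searches find the state that is determined
  by the common state after `Z`, so that the machine simulates `ℬ` on an output of the form `v t ^ k
  t`. No search can succeed within `Z`, since there the candidates still differ. Hence the state in
  which the run leaves the word depends only on `Z` and on the state of `ℬ` at the left end of `v`.

The construction is finally carried out on descriptions (`CompCode.build`), where states are coded
by numbers and lists. It consists of bounded operations on lists and is primitive recursive; that it
describes the composite machine with numbered states is `CompCode.code_composite`.
-/

/-! ### Runs of two-way automata over tapes and factors -/

namespace TwoWayAutomaton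

variable {Q A : Type*} (M : TwoWayAutomaton Q A)

/-- The cells of a tape carrying the symbols `t`, at the positions `1, …, |t|`. -/
def tapeCell (t : List (TapeSymbol A)) : ℕ → Option (TapeSymbol A)
  | 0 => none
  | m + 1 => t[m]?

/-- One transition between configurations on the tape `t`. Unlike `FactorStep`, this allows
endmarkers on the tape. -/
def TapeStep (t : List (TapeSymbol A)) (c d : Q × ℕ) : Prop :=
  ∃ s e, tapeCell t c.2 = some s ∧ M.δ c.1 s = some (d.1, e) ∧ d.2 = e.apply c.2

theorem factorCell_eq (w : List A) (m : ℕ) :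
    factorCell w m = tapeCell (w.map TapeSymbol.letter) m := by
  cases m <;> simp [factorCell, tapeCell]

theorem factorStep_eq (w : List A) :
    M.FactorStep w = M.TapeStep (w.map TapeSymbol.letter) := by
  funext c d
  simp only [FactorStep, TapeStep, factorCell_eq]

theorem tapeCell_append_cons (X Y : List (TapeSymbol A)) (x : TapeSymbol A) :
    tapeCell (X ++ x :: Y) (X.length + 1) = some x := by
  simp [tapeCell]

theorem tapeCell_append_block (X Y Z : List (TapeSymbol A)) {n : ℕ} {b : TapeSymbol A}
    (h : Y[n]? = some b) : tapeCell (X ++ (Y ++ Z)) (X.length + (n + 1)) = some b := by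
  have hlt : n < Y.length := by
    by_contra hge
    rw [List.getElem?_eq_none (by omega)] at h
    cases h
  change (X ++ (Y ++ Z))[X.length + n]? = some b
  rw [List.getElem?_append_right (by omega), List.getElem?_append_left (by omega)]
  simpa using h

theorem TapeStep.det {t : List (TapeSymbol A)} {c d d' : Q × ℕ} (h : M.TapeStep t c d)
    (h' : M.TapeStep t c d') : d = d' := by
  obtain ⟨s, e, h1, h2, h3⟩ := h
  obtain ⟨s', e', h1', h2', h3'⟩ := h'
  obtain rfl : s = s' := Option.some.inj (h1.symm.trans h1')
  have := Option.some.inj (h2.symm.trans h2')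
  obtain ⟨hd, rfl⟩ := Prod.mk.inj this
  exact Prod.ext hd (h3.trans h3'.symm)

theorem FactorStep.det {w : List A} {c d d' : Q × ℕ} (h : M.FactorStep w c d)
    (h' : M.FactorStep w c d') : d = d' := by
  rw [factorStep_eq] at h h'
  exact TapeStep.det M h h'

theorem FactorStep.pos {w : List A} {c d : Q × ℕ} (h : M.FactorStep w c d) :
    0 < c.2 ∧ c.2 ≤ w.length := by
  obtain ⟨s, e, h1, -⟩ := h
  exact factorCell_some h1

theorem not_factorStep_exit {w : List A} {p : Q} {y : WordEnd} {d : Q × ℕ} :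
    ¬ M.FactorStep w (p, exitPos w y) d := by
  intro h
  have := FactorStep.pos M h
  cases y <;> simp [exitPos] at this

theorem FactorRun.exit_eq {w : List A} {p : Q} {y : WordEnd} {d : Q × ℕ}
    (h : M.FactorRun w (p, exitPos w y) d) : d = (p, exitPos w y) := by
  rcases Relation.ReflTransGen.cases_head h with h | ⟨c, h, -⟩
  · exact h.symm
  · exact absurd h (not_factorStep_exit M)

/-- The runs of a deterministic automaton from a given configuration form a chain, and a run does
not continue after it has left the factor. -/
theorem FactorRun.to_exit {w : List A} {c d : Q × ℕ} {p : Q} {y : WordEnd}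
    (h : M.FactorRun w c d) (h' : M.FactorRun w c (p, exitPos w y)) :
    M.FactorRun w d (p, exitPos w y) := by
  induction h using Relation.ReflTransGen.head_induction_on with
  | refl => exact h'
  | head hs _ ih =>
    rcases Relation.ReflTransGen.cases_head h' with rfl | ⟨e, he, h''⟩
    · exact absurd hs (not_factorStep_exit M)
    · obtain rfl := FactorStep.det M hs he
      exact ih h''

theorem FactorRun.exit_unique {w : List A} {c : Q × ℕ} {p p' : Q} {y : WordEnd}
    (h : M.FactorRun w c (p, exitPos w y)) (h' : M.FactorRun w c (p', exitPos w y)) :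
    p = p' :=
  (Prod.mk.inj (FactorRun.exit_eq M (FactorRun.to_exit M h h'))).1.symm

/-- Replacing a factor by one with the same behavior does not change how a run that starts to the
right of the factor (or at its last position) leaves the word. -/
theorem FactorRun.congr_prefix {z z' : List A} (hz : M.behavior z = M.behavior z') (r : List A)
    {q q' : Q} {i : ℕ} {y : WordEnd}
    (h : M.FactorRun (z ++ r) (q, z.length + i) (q', exitPos (z ++ r) y)) :
    M.FactorRun (z' ++ r) (q, z'.length + i) (q', exitPos (z' ++ r) y) := by
  obtain ⟨h1, h2⟩ := FactorRun.to_traversal M z r h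
  rcases Nat.eq_zero_or_pos i with rfl | hi
  · obtain ⟨s, p, hp, ht⟩ := h1 le_rfl
    have hp' : (q, p) ∈ M.behavior z WordEnd.right s := hp
    have ht' := Relation.ReflTransGen.head (Traversal.fst WordEnd.right s q p hp') ht
    rw [hz] at ht'
    exact FactorRun.of_traversal M z' r ht'
  · obtain ⟨s, p, hp, ht⟩ := h2 i rfl hi
    rw [hz] at ht
    have h3 := FactorRun.append_right M z' hp
    have h4 := FactorRun.of_traversal M z' r ht
    refine Relation.ReflTransGen.trans h3 (Eq.mp ?_ h4)
    cases s <;> simp [portPos, Port.afterSnd, entryPos, exitPos, Nat.add_assoc] <;> rfl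

/-- Replacing a factor by one with the same behavior does not change how a run that starts to the
left of the factor (or at its first position) leaves the word. -/
theorem FactorRun.congr_suffix {z z' : List A} (hz : M.behavior z = M.behavior z') (r : List A)
    {q q' : Q} {i : ℕ} {y : WordEnd} (hi : i ≤ r.length + 1)
    (h : M.FactorRun (r ++ z) (q, i) (q', exitPos (r ++ z) y)) :
    M.FactorRun (r ++ z') (q, i) (q', exitPos (r ++ z') y) := by
  obtain ⟨h1, h2⟩ := FactorRun.to_traversal M r z h
  rcases Nat.lt_or_ge r.length i with hlt | hle
  · obtain rfl : i = r.length + 1 := by omega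
    obtain ⟨s, p, hp, ht⟩ := h2 1 rfl Nat.one_pos
    have hp' : (q, p) ∈ M.behavior z WordEnd.left s := hp
    have ht' := Relation.ReflTransGen.head (Traversal.snd WordEnd.left s q p hp') ht
    rw [hz] at ht'
    exact FactorRun.of_traversal M r z' ht'
  · obtain ⟨s, p, hp, ht⟩ := h1 hle
    rw [hz] at ht
    have h3 := FactorRun.append_left M z' hp
    have h4 := FactorRun.of_traversal M r z' ht
    refine Relation.ReflTransGen.trans h3 (Eq.mp ?_ h4)
    cases s <;> simp [portPos, Port.afterFst, entryPos, exitPos] <;> rfl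

/-- A run over `x ++ z` that starts in `x` and leaves on the right first leaves `x` on the right. -/
theorem FactorRun.split_right {x z : List A} {c : Q × ℕ} {q : Q} (hc : c.2 ≤ x.length)
    (h : M.FactorRun (x ++ z) c (q, exitPos (x ++ z) WordEnd.right)) :
    ∃ p, M.FactorRun x c (p, exitPos x WordEnd.right) ∧
      M.FactorRun (x ++ z) (p, x.length + 1) (q, exitPos (x ++ z) WordEnd.right) := by
  obtain ⟨s, p, hp, ht⟩ := (FactorRun.to_traversal M x z h).1 hc
  cases s with
  | right => exact ⟨p, hp, FactorRun.of_traversal M x z ht⟩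
  | left =>
    exfalso
    rcases Relation.ReflTransGen.cases_head ht with h0 | ⟨_, h0, -⟩
    · simp [Port.afterFst] at h0
    · cases h0

/-- A run over `z ++ x` that starts in `x` and leaves on the left first leaves `x` on the left. -/
theorem FactorRun.split_left {x z : List A} {p : Q} {m : ℕ} {q : Q} (hm : 0 < m)
    (h : M.FactorRun (z ++ x) (p, z.length + m) (q, exitPos (z ++ x) WordEnd.left)) :
    ∃ p', M.FactorRun x (p, m) (p', exitPos x WordEnd.left) := by
  obtain ⟨s, p', hp, ht⟩ := (FactorRun.to_traversal M z x h).2 m rfl hm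
  cases s with
  | left => exact ⟨p', hp⟩
  | right =>
    exfalso
    rcases Relation.ReflTransGen.cases_head ht with h0 | ⟨_, h0, -⟩
    · simp [Port.afterSnd] at h0
    · cases h0

/-! ### A criterion for aperiodicity -/

/-- The power `w ^ n` of a word. -/
def wordPow (w : List A) (n : ℕ) : List A := (List.replicate n w).flatten

theorem wordPow_succ (w : List A) (n : ℕ) : wordPow w (n + 1) = w ++ wordPow w n := by
  simp [wordPow, List.replicate_succ]

theorem wordPow_add (w : List A) (m n : ℕ) : wordPow w (m + n) = wordPow w m ++ wordPow w n := by
  rw [wordPow, List.replicate_add, List.flatten_append]; rfl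

theorem wordPow_succ' (w : List A) (n : ℕ) : wordPow w (n + 1) = wordPow w n ++ w := by
  rw [wordPow_add]; simp [wordPow]

theorem toList_pow (w : FreeMonoid A) (n : ℕ) :
    FreeMonoid.toList (w ^ n) = wordPow (FreeMonoid.toList w) n := by
  induction n with
  | zero => rfl
  | succ n ih => rw [pow_succ, FreeMonoid.toList_mul, ih, wordPow_succ']

theorem _root_.Monoid.IsAperiodic.of_finite {N : Type*} [Monoid N] [Finite N]
    (h : ∀ x : N, ∃ n, x ^ n = x ^ (n + 1)) : Monoid.IsAperiodic N := by
  choose f hf using h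
  have := Fintype.ofFinite N
  refine ⟨Finset.univ.sup f, fun x => ?_⟩
  obtain ⟨k, hk⟩ := Nat.exists_eq_add_of_le (Finset.le_sup (f := f) (Finset.mem_univ x))
  rw [hk, pow_add, add_right_comm, pow_add, ← hf]

theorem finite_transitionMonoid [Finite Q] : Finite M.TransitionMonoid := by
  let f : M.TransitionMonoid → (WordEnd → WordEnd → Set (Q × Q)) :=
    Quotient.lift (fun w : FreeMonoid A => M.behavior (FreeMonoid.toList w))
      (fun a b h => funext fun x => funext fun y => h x y)
  have : Finite WordEnd := by
    refine Finite.of_injective (fun x : WordEnd => (match x with | .left => true | .right => false))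
      ?_
    intro x y h
    cases x <;> cases y <;> simp_all
  refine Finite.of_injective f ?_
  intro a b h
  induction a using Quotient.inductionOn
  induction b using Quotient.inductionOn
  exact Quotient.sound fun x y => congrFun (congrFun h x) y

/-- A two-way automaton with finitely many states is aperiodic if, for every word `w` and all large
`n`, a run entering at one end and leaving at the other end reaches the same state for `w ^ n`
and for `w ^ (n + 1)`, provided that both runs exist. Indeed, the sets of runs that return to their
side increase with `n`, and the sets of runs that cross decrease, by the assumption. -/
theorem isAperiodic_of_crossing [Finite Q]
    (h : ∀ w : List A, w ≠ [] → ∃ N, ∀ n ≥ N, ∀ p q q',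
      ((p, q) ∈ M.behavior (wordPow w n) WordEnd.left WordEnd.right →
        (p, q') ∈ M.behavior (wordPow w (n + 1)) WordEnd.left WordEnd.right → q = q') ∧
      ((p, q) ∈ M.behavior (wordPow w n) WordEnd.right WordEnd.left →
        (p, q') ∈ M.behavior (wordPow w (n + 1)) WordEnd.right WordEnd.left → q = q')) :
    Monoid.IsAperiodic M.TransitionMonoid := by
  have := M.finite_transitionMonoid
  refine Monoid.IsAperiodic.of_finite fun a => ?_
  induction a using Con.induction_on with
  | H w =>
  suffices hs : ∃ n, ∀ x y, M.behavior (wordPow (FreeMonoid.toList w) n) x y =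
      M.behavior (wordPow (FreeMonoid.toList w) (n + 1)) x y by
    obtain ⟨n, hn⟩ := hs
    refine ⟨n, ?_⟩
    rw [← Con.coe_mk', ← map_pow, ← map_pow]
    refine (Con.eq _).2 fun x y => ?_
    rw [toList_pow, toList_pow]
    exact hn x y
  generalize FreeMonoid.toList w = w
  by_cases hw : w = []
  · subst hw
    exact ⟨0, fun x y => by simp [wordPow]⟩
  have hpos : 0 < w.length := List.length_pos_iff.2 hw
  obtain ⟨N, hN⟩ := h w hw
  have key : ∀ x y, ∃ n0, ∀ n ≥ n0, M.behavior (wordPow w (n + N + 1)) x y =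
      M.behavior (wordPow w (n0 + N + 1)) x y := by
    have mono : ∀ f : ℕ → Set (Q × Q), (∀ n, f n ⊆ f (n + 1)) → ∃ n0, ∀ n ≥ n0, f n = f n0 := by
      intro f hf
      obtain ⟨n0, hn0⟩ := WellFoundedGT.monotone_chain_condition
        (⟨f, monotone_nat_of_le_succ hf⟩ : ℕ →o Set (Q × Q))
      exact ⟨n0, fun n hn => (hn0 n hn).symm⟩
    have anti : ∀ f : ℕ → Set (Q × Q), (∀ n, f (n + 1) ⊆ f n) → ∃ n0, ∀ n ≥ n0, f n = f n0 := by
      intro f hf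
      obtain ⟨n0, hn0⟩ := mono (fun n => (f n)ᶜ) (fun n => Set.compl_subset_compl.2 (hf n))
      exact ⟨n0, fun n hn => compl_injective (hn0 n hn)⟩
    intro x y
    cases x with
    | left =>
      cases y with
      | left =>
        refine mono (fun n => M.behavior (wordPow w (n + N + 1)) WordEnd.left WordEnd.left)
          fun n pq hp => ?_
        have := FactorRun.append_left M w hp
        rw [← wordPow_succ'] at this
        rw [show n + 1 + N + 1 = n + N + 1 + 1 by ring]
        exact this
      | right =>
        refine anti (fun n => M.behavior (wordPow w (n + N + 1)) WordEnd.left WordEnd.right)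
          fun n pq hp => ?_
        rw [show n + 1 + N + 1 = n + N + 1 + 1 by ring] at hp
        have hp' := hp
        simp only [behavior, Set.mem_ofPred_eq] at hp'
        rw [wordPow_succ'] at hp'
        obtain ⟨q, hq, -⟩ := FactorRun.split_right M (by
          simp only [entryPos, wordPow_succ, List.length_append]; omega) hp'
        have hq' : (pq.1, q) ∈ M.behavior (wordPow w (n + N + 1)) WordEnd.left WordEnd.right := hq
        have := (hN (n + N + 1) (by omega) pq.1 q pq.2).1 hq' hp
        rwa [this] at hq'
    | right =>
      cases y with
      | left =>
        refine anti (fun n => M.behavior (wordPow w (n + N + 1)) WordEnd.right WordEnd.left)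
          fun n pq hp => ?_
        rw [show n + 1 + N + 1 = n + N + 1 + 1 by ring] at hp
        have hp' := hp
        simp only [behavior, Set.mem_ofPred_eq, entryPos] at hp'
        rw [wordPow_succ, List.length_append] at hp'
        obtain ⟨q, hq⟩ := FactorRun.split_left M (by
          rw [wordPow_succ, List.length_append]; omega) hp'
        have hq' : (pq.1, q) ∈ M.behavior (wordPow w (n + N + 1)) WordEnd.right WordEnd.left := hq
        have := (hN (n + N + 1) (by omega) pq.1 q pq.2).2 hq' hp
        rwa [this] at hq'
      | right =>
        refine mono (fun n => M.behavior (wordPow w (n + N + 1)) WordEnd.right WordEnd.right)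
          fun n pq hp => ?_
        have := FactorRun.append_right M w hp
        rw [← wordPow_succ] at this
        rw [show n + 1 + N + 1 = n + N + 1 + 1 by ring]
        simp only [behavior, Set.mem_ofPred_eq]
        have e1 : entryPos (wordPow w (n + N + 1 + 1)) WordEnd.right =
            w.length + entryPos (wordPow w (n + N + 1)) WordEnd.right := by
          rw [wordPow_succ w (n + N + 1)]; simp [entryPos]
        have e2 : exitPos (wordPow w (n + N + 1 + 1)) WordEnd.right =
            w.length + exitPos (wordPow w (n + N + 1)) WordEnd.right := by
          rw [wordPow_succ w (n + N + 1)]; simp [exitPos, Nat.add_assoc]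
        rw [e1, e2]
        exact this
  choose n0 hn0 using key
  refine ⟨max (max (n0 .left .left) (n0 .left .right))
    (max (n0 .right .left) (n0 .right .right)) + N + 1, fun x y => ?_⟩
  generalize hk : max (max (n0 .left .left) (n0 .left .right))
    (max (n0 .right .left) (n0 .right .right)) = k
  have hle : n0 x y ≤ k := by cases x <;> cases y <;> omega
  rw [show k + N + 1 + 1 = k + 1 + N + 1 by ring, hn0 x y k hle, hn0 x y (k + 1) (by omega)]

/-- In an aperiodic automaton, large powers of a word have the same behavior. -/
theorem behavior_wordPow_of_isAperiodic (h : Monoid.IsAperiodic M.TransitionMonoid) :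
    ∃ N, ∀ n ≥ N, ∀ w : List A, M.behavior (wordPow w n) = M.behavior (wordPow w (n + 1)) := by
  obtain ⟨N, hN⟩ := h
  refine ⟨N, fun n hn w => ?_⟩
  have hx : ((FreeMonoid.ofList w : FreeMonoid A) : M.TransitionMonoid) ^ n =
      ((FreeMonoid.ofList w : FreeMonoid A) : M.TransitionMonoid) ^ (n + 1) := by
    obtain ⟨k, rfl⟩ := Nat.exists_eq_add_of_le hn
    rw [pow_add, add_right_comm, pow_add, ← hN]
  rw [← Con.coe_mk', ← map_pow M.transitionCon.mk', ← map_pow M.transitionCon.mk'] at hx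
  have := (Con.eq _).1 hx
  funext x y
  have := this x y
  rwa [toList_pow, toList_pow] at this

end TwoWayAutomaton

/-! ### The composite machine -/

/-- A sequential transducer whose transition function is total. -/
structure TotalTransducer (S A B : Type*) where
  δ : S → TapeSymbol A → S
  γ : S → TapeSymbol A → List B
  start : S
  accept : Finset S

namespace TotalTransducer

variable {S A B : Type*} (M : TotalTransducer S A B)

/-- The state reached from `p` by reading `t`. -/
def run (p : S) (t : List (TapeSymbol A)) : S := t.foldl M.δ p

@[simp] theorem run_nil (p : S) : M.run p [] = p := rfl

@[simp] theorem run_cons (p : S) (s : TapeSymbol A) (t : List (TapeSymbol A)) :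
    M.run p (s :: t) = M.run (M.δ p s) t := rfl

@[simp] theorem run_append (p : S) (t t' : List (TapeSymbol A)) :
    M.run p (t ++ t') = M.run (M.run p t) t' := by
  simp [run]

/-- The part of the marked output that is produced on `s` in state `p`: the output letters, and
also the endmarker if `s` is one. -/
def block (p : S) (s : TapeSymbol A) : List (TapeSymbol B) :=
  match s with
  | .leftEnd => .leftEnd :: (M.γ p .leftEnd).map .letter
  | .letter a => (M.γ p (.letter a)).map .letter
  | .rightEnd => (M.γ p .rightEnd).map .letter ++ [.rightEnd]

/-- The concatenation of the blocks produced on `t` from state `p`. -/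
def out (p : S) : List (TapeSymbol A) → List (TapeSymbol B)
  | [] => []
  | s :: t => M.block p s ++ out (M.δ p s) t

@[simp] theorem out_nil (p : S) : M.out p [] = [] := rfl

@[simp] theorem out_cons (p : S) (s : TapeSymbol A) (t : List (TapeSymbol A)) :
    M.out p (s :: t) = M.block p s ++ M.out (M.δ p s) t := rfl

@[simp] theorem out_append (p : S) (t t' : List (TapeSymbol A)) :
    M.out p (t ++ t') = M.out p t ++ M.out (M.run p t) t' := by
  induction t generalizing p with
  | nil => rfl
  | cons s t ih => simp [ih]

end TotalTransducer

/-- The states of the composite machine, for a sequential machine with state set `S` and a two-way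
machine with state set `Q`. The parameter `K` bounds the offsets inside a block. -/
inductive CompState (S Q : Type*) (K : ℕ) where
  /-- The two-way machine is in state `q` at offset `i` of the block that the sequential machine
  produces in state `p` on the scanned symbol; the offset `0` means that it has left this block on
  the left. -/
  | simulate (q : Q) (p : S) (i : Fin K) : CompState S Q K
  /-- The two-way machine has moved, in state `q`, to the last position of the block of the scanned
  symbol, and `p` is the state of the sequential machine after this symbol. The state before this
  symbol has to be found. -/
  | retreat (q : Q) (p : S) : CompState S Q K
  /-- The search to the left for the missing state: `g` maps a state after the scanned symbol to
  the candidate for the missing state to which it leads, if there is one. -/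
  | search (q : Q) (g : S → Option S) : CompState S Q K
  /-- The way back: `s₁` and `s₂` are states before the scanned symbol which lead to different
  candidates, so that they merge on the symbol at which the search began. The state `s₁` leads to
  the missing state. -/
  | back (q : Q) (s₁ s₂ : S) : CompState S Q K

namespace CompState

variable {S Q : Type*} {K : ℕ}

instance [Finite S] [Finite Q] : Finite (CompState S Q K) := by
  let f : (Q × S × Fin K) ⊕ (Q × S) ⊕ (Q × (S → Option S)) ⊕ (Q × S × S) → CompState S Q K :=
    Sum.elim (fun x => simulate x.1 x.2.1 x.2.2) (Sum.elim (fun x => retreat x.1 x.2)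
      (Sum.elim (fun x => search x.1 x.2) (fun x => back x.1 x.2.1 x.2.2)))
  refine Finite.of_surjective f ?_
  rintro (⟨q, p, i⟩ | ⟨q, p⟩ | ⟨q, g⟩ | ⟨q, s₁, s₂⟩)
  · exact ⟨.inl (q, p, i), rfl⟩
  · exact ⟨.inr (.inl (q, p)), rfl⟩
  · exact ⟨.inr (.inr (.inl (q, g))), rfl⟩
  · exact ⟨.inr (.inr (.inr (q, s₁, s₂))), rfl⟩

/-- The state `simulate q p i`, if the offset `i` is in the range. -/
def mkSimulate (K : ℕ) (q : Q) (p : S) (i : ℕ) : Option (CompState S Q K) :=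
  if h : i < K then some (simulate q p ⟨i, h⟩) else none

theorem mkSimulate_eq_some {q : Q} {p : S} {i : ℕ} {c : CompState S Q K} :
    mkSimulate K q p i = some c ↔ ∃ j : Fin K, j.1 = i ∧ c = simulate q p j := by
  unfold mkSimulate
  split
  · rename_i h
    constructor
    · intro hc
      exact ⟨⟨i, h⟩, rfl, (Option.some.inj hc).symm⟩
    · rintro ⟨j, rfl, rfl⟩
      rfl
  · rename_i h
    constructor
    · intro hc
      cases hc
    · rintro ⟨j, rfl, rfl⟩
      exact absurd j.2 h

end CompState

/-- The first state, in the enumeration `l`, that has a value under `g` and whose value is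
not `v`. -/
def altState {S : Type*} [DecidableEq S] (l : List S) (g : S → Option S) (v : Option S) :
    Option S :=
  (l.filter fun s => g s ≠ none ∧ g s ≠ v).head?

theorem altState_eq_some {S : Type*} [DecidableEq S] {l : List S} {g : S → Option S}
    {v : Option S} {s : S} (h : altState l g v = some s) : g s ≠ none ∧ g s ≠ v := by
  have := List.mem_of_head? h
  simpa using (List.mem_filter.1 this).2

theorem altState_eq_none {S : Type*} [DecidableEq S] {l : List S} (hl : ∀ s, s ∈ l)
    {g : S → Option S} {v : Option S} :
    altState l g v = none ↔ ∀ s, g s ≠ none → g s = v := by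
  simp only [altState, List.head?_eq_none_iff, List.filter_eq_nil_iff]
  constructor
  · intro h s hs
    by_contra hv
    exact h s (hl s) (by simpa using ⟨hs, hv⟩)
  · intro h s _ hs
    have hs' : g s ≠ none ∧ g s ≠ v := by simpa using hs
    exact hs'.2 (h s hs'.1)

/-- The composite of a total sequential transducer and a two-way transducer: data of the
construction. The list `enum` enumerates the states of the sequential transducer. -/
structure CompData (S Q A B C : Type*) where
  seq : TotalTransducer S A B
  two : TwoWayTransducer Q B C
  enum : List S
  K : ℕ

namespace CompData

variable {S Q A B C : Type*} (D : CompData S Q A B C)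

/-- Enter the block of the symbol `s` from the right. -/
def enterRight (q : Q) (p : S) (s : TapeSymbol A) : Option (CompState S Q D.K × HeadMove) :=
  (CompState.mkSimulate D.K q p (D.seq.block p s).length).map (·, HeadMove.stay)

/-- The transitions from the states `simulate q p i`. -/
def stepSimulate (q : Q) (p : S) (i : ℕ) (s : TapeSymbol A) :
    Option (CompState S Q D.K × HeadMove) :=
  if i = 0 then
    match s with
    | .leftEnd => none
    | _ => some (.retreat q p, .left)
  else
    match (D.seq.block p s)[i - 1]? with
    | some b => (D.two.δ q b).bind fun t =>
        (CompState.mkSimulate D.K t.1 p (t.2.apply i)).map (·, HeadMove.stay)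
    | none =>
      if i = (D.seq.block p s).length + 1 then
        match s with
        | .rightEnd => none
        | _ => (CompState.mkSimulate D.K q (D.seq.δ p s) 1).map (·, HeadMove.right)
      else none

theorem enterRight_eq_some {q : Q} {p : S} {s : TapeSymbol A} {c : CompState S Q D.K}
    {e : HeadMove} (h : D.enterRight q p s = some (c, e)) :
    e = .stay ∧ ∃ j : Fin D.K, j.1 = (D.seq.block p s).length ∧ c = .simulate q p j := by
  simp only [enterRight, Option.map_eq_some_iff, Prod.mk.injEq] at h
  obtain ⟨_, h, rfl, rfl⟩ := h
  exact ⟨rfl, CompState.mkSimulate_eq_some.1 h⟩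

/-- The three kinds of transitions from `simulate q p i`. -/
theorem stepSimulate_eq_some {q : Q} {p : S} {i : ℕ} {s : TapeSymbol A} {c : CompState S Q D.K}
    {e : HeadMove} (h : D.stepSimulate q p i s = some (c, e)) :
    (i = 0 ∧ s ≠ .leftEnd ∧ c = .retreat q p ∧ e = .left) ∨
    (∃ b q' d, i ≠ 0 ∧ (D.seq.block p s)[i - 1]? = some b ∧ D.two.δ q b = some (q', d) ∧
      e = .stay ∧ ∃ j : Fin D.K, j.1 = d.apply i ∧ c = .simulate q' p j) ∨
    (i = (D.seq.block p s).length + 1 ∧ s ≠ .rightEnd ∧ e = .right ∧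
      ∃ j : Fin D.K, j.1 = 1 ∧ c = .simulate q (D.seq.δ p s) j) := by
  unfold stepSimulate at h
  split at h
  · left
    split at h
    · cases h
    · rename_i h1 _ h2
      cases h
      exact ⟨h1, fun hs => h2 hs, rfl, rfl⟩
  · rename_i hi
    right
    split at h
    · rename_i b hb
      left
      simp only [Option.bind_eq_some_iff, Option.map_eq_some_iff, Prod.mk.injEq] at h
      obtain ⟨⟨q', d⟩, h1, _, h2, rfl, rfl⟩ := h
      exact ⟨b, q', d, hi, hb, h1, rfl, CompState.mkSimulate_eq_some.1 h2⟩
    · right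
      split at h
      · rename_i hi'
        split at h
        · cases h
        · rename_i h3
          simp only [Option.map_eq_some_iff, Prod.mk.injEq] at h
          obtain ⟨_, h2, rfl, rfl⟩ := h
          exact ⟨hi', fun hs => h3 hs, rfl, CompState.mkSimulate_eq_some.1 h2⟩
      · cases h

variable [DecidableEq S]

/-- The candidates for the state before the symbol `s`, if `p` is the state after it. -/
def candidate (p : S) (s : TapeSymbol A) (c : S) : Option S :=
  if D.seq.δ c s = p then some c else none

theorem candidate_ne_none {p : S} {s : TapeSymbol A} {c : S} :
    D.candidate p s c ≠ none ↔ D.seq.δ c s = p := by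
  unfold candidate; split <;> simp_all

theorem candidate_eq_some {p : S} {s : TapeSymbol A} {c d : S} :
    D.candidate p s c = some d ↔ D.seq.δ c s = p ∧ c = d := by
  unfold candidate; split <;> simp_all

/-- The transitions from the states `retreat q p`. -/
def stepRetreat (q : Q) (p : S) (s : TapeSymbol A) : Option (CompState S Q D.K × HeadMove) :=
  match s with
  | .leftEnd => if D.seq.δ D.seq.start s = p then D.enterRight q D.seq.start s else none
  | .rightEnd => none
  | .letter _ =>
    (altState D.enum (D.candidate p s) none).bind fun c =>
      match altState D.enum (D.candidate p s) (some c) with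
      | none => D.enterRight q c s
      | some _ => some (.search q (D.candidate p s), .left)

/-- The transitions from the states `search q g`. -/
def stepSearch (q : Q) (g : S → Option S) (s : TapeSymbol A) :
    Option (CompState S Q D.K × HeadMove) :=
  match s with
  | .leftEnd =>
    if g (D.seq.δ D.seq.start s) = none then none
    else (altState D.enum g (g (D.seq.δ D.seq.start s))).map fun s₂ =>
      (.back q (D.seq.δ D.seq.start s) s₂, .right)
  | .rightEnd => none
  | .letter _ =>
    (altState D.enum (fun r => g (D.seq.δ r s)) none).bind fun s₀ =>
      match altState D.enum (fun r => g (D.seq.δ r s)) (g (D.seq.δ s₀ s)) with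
      | some _ => some (.search q (fun r => g (D.seq.δ r s)), .left)
      | none => (altState D.enum g (g (D.seq.δ s₀ s))).map fun s₂ =>
          (.back q (D.seq.δ s₀ s) s₂, .right)

/-- The transitions from the states `back q s₁ s₂`. -/
def stepBack (q : Q) (s₁ s₂ : S) (s : TapeSymbol A) : Option (CompState S Q D.K × HeadMove) :=
  match s with
  | .letter _ =>
    if D.seq.δ s₁ s = D.seq.δ s₂ s then D.enterRight q s₁ s
    else some (.back q (D.seq.δ s₁ s) (D.seq.δ s₂ s), .right)
  | _ => none

/-- The transition function of the composite machine. -/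
def step : CompState S Q D.K → TapeSymbol A → Option (CompState S Q D.K × HeadMove)
  | .simulate q p i, s => D.stepSimulate q p i s
  | .retreat q p, s => D.stepRetreat q p s
  | .search q g, s => D.stepSearch q g s
  | .back q s₁ s₂, s => D.stepBack q s₁ s₂ s

/-- The production function of the composite machine: only the simulated steps of the two-way
machine produce something. -/
def prod : CompState S Q D.K → TapeSymbol A → List C
  | .simulate q p i, s =>
    if i.1 = 0 then [] else
      match (D.seq.block p s)[i.1 - 1]? with
      | some b => D.two.γ q b
      | none => []
  | _, _ => []

/-- The final states of the composite machine: when the head is on `⊣`, these are the states in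
which the simulated head is on `⊣` in a final state and the sequential machine accepts. -/
def IsFinal : CompState S Q D.K → Prop
  | .simulate q p i => q ∈ D.two.accept ∧ D.seq.δ p .rightEnd ∈ D.seq.accept ∧
      i.1 = (D.seq.γ p .rightEnd).length + 1
  | _ => False

theorem step_leftEnd (c d : CompState S Q D.K) : D.step c .leftEnd ≠ some (d, .left) := by
  intro h
  cases c with
  | simulate q p i =>
    rcases D.stepSimulate_eq_some h with h | ⟨_, _, _, -, -, -, h, -⟩ | ⟨-, -, h, -⟩
    · exact h.2.1 rfl
    · cases h
    · cases h
  | retreat q p =>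
    simp only [step, stepRetreat] at h
    split at h
    · exact absurd (D.enterRight_eq_some h).1 (by simp)
    · cases h
  | search q g =>
    simp only [step, stepSearch] at h
    split at h
    · cases h
    · simp at h
  | back q s₁ s₂ => simp [step, stepBack] at h

theorem step_rightEnd (c d : CompState S Q D.K) : D.step c .rightEnd ≠ some (d, .right) := by
  intro h
  cases c with
  | simulate q p i =>
    rcases D.stepSimulate_eq_some h with h | ⟨_, _, _, -, -, -, h, -⟩ | ⟨-, h, -⟩
    · cases h.2.2.2
    · cases h
    · exact h rfl
  | retreat q p => simp [step, stepRetreat] at h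
  | search q g => simp [step, stepSearch] at h
  | back q s₁ s₂ => simp [step, stepBack] at h

/-- The composite machine, for a given initial state. -/
noncomputable def machine [Finite S] [Finite Q] (c₀ : CompState S Q D.K) :
    TwoWayTransducer (CompState S Q D.K) A C where
  δ := D.step
  δ_leftEnd := D.step_leftEnd
  δ_rightEnd := D.step_rightEnd
  start := c₀
  accept := (Set.toFinite {c | D.IsFinal c}).toFinset
  γ := D.prod

end CompData

/-! ### The search for the preceding state -/

namespace CompData

open TwoWayAutomaton

variable {S Q A B C : Type*} [DecidableEq S] (D : CompData S Q A B C)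

/-- The configurations of a search. Here `v` is the tape in front of the symbol where the search
begins, `G` maps the states after `v` to candidates, and `R` is the set of possible states in front
of `v`. While the search goes to the left, at least two candidates are reached from the states
after the scanned symbol. On the way back, the two states lead to different candidates, and the
first of them leads to the only candidate that is reached from `R`. -/
inductive Hunt (R : Set S) (v : List (TapeSymbol A)) (G : S → Option S) (q : Q) :
    CompState S Q D.K → ℕ → Prop
  | search (v₁ v₂ : List (TapeSymbol A)) (hv : v = v₁ ++ v₂) (g : S → Option S)
      (hg : ∀ s, g s = G (D.seq.run s v₂))
      (h₂ : ∃ s s', g s ≠ none ∧ g s' ≠ none ∧ g s ≠ g s') : Hunt R v G q (.search q g) v₁.length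
  | back (v₁ v₂ : List (TapeSymbol A)) (hv : v = v₁ ++ v₂) (s₁ s₂ : S)
      (h₁ : G (D.seq.run s₁ v₂) ≠ none) (h₂ : G (D.seq.run s₂ v₂) ≠ none)
      (hne : G (D.seq.run s₁ v₂) ≠ G (D.seq.run s₂ v₂))
      (hR : ∀ r ∈ R, G (D.seq.run r v) ≠ none → G (D.seq.run r v) = G (D.seq.run s₁ v₂)) :
      Hunt R v G q (.back q s₁ s₂) (v₁.length + 1)

/-- The left endmarker occurs at most at the first position of `t`, and in this case the states
in `R` are initial. -/
def Anchored (R : Set S) (t : List (TapeSymbol A)) : Prop :=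
  ∀ X Y, t = X ++ .leftEnd :: Y → X = [] ∧ ∀ r ∈ R, r = D.seq.start

omit [DecidableEq S] in
theorem anchored_map_letter (R : Set S) (w : List A) : D.Anchored R (w.map .letter) := by
  intro X Y h
  have : TapeSymbol.leftEnd ∈ w.map TapeSymbol.letter := by rw [h]; simp
  simp at this

variable {D}

omit [DecidableEq S] in
theorem tapeCell_eq_some_append {t X Y : List (TapeSymbol A)} (ht : t = X ++ Y)
    {s : TapeSymbol A} (h : tapeCell t (X.length + 1) = some s) : ∃ Y', Y = s :: Y' := by
  subst ht
  cases Y with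
  | nil => simp [tapeCell] at h
  | cons y Y =>
    rw [tapeCell_append_cons] at h
    cases h
    exact ⟨Y, rfl⟩

/-- As long as the head is in `v`, a search continues. -/
theorem Hunt.step (he : ∀ s, s ∈ D.enum) {R : Set S} {v E : List (TapeSymbol A)}
    (ha : D.Anchored R (v ++ E)) {G : S → Option S} {q : Q} {c c' : CompState S Q D.K} {k : ℕ}
    {s : TapeSymbol A} {e : HeadMove} (h : D.Hunt R v G q c k) (hk : k ≤ v.length)
    (hs : tapeCell (v ++ E) k = some s) (hc : D.step c s = some (c', e)) :
    D.Hunt R v G q c' (e.apply k) := by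
  cases h with
  | search v₁ v₂ hv g hg h₂ =>
    rcases List.eq_nil_or_concat v₁ with rfl | ⟨v₃, z, rfl⟩
    · simp [tapeCell] at hs
    have hz : s = z := by
      subst hv
      have := tapeCell_append_cons v₃ (v₂ ++ E) z
      simp only [List.concat_eq_append, List.length_append, List.length_cons, List.length_nil,
        List.append_assoc, List.cons_append, List.nil_append] at hs
      exact Option.some.inj (hs.symm.trans this)
    subst hz
    simp only [List.concat_eq_append] at hv ⊢
    cases s with
    | rightEnd => simp [CompData.step, stepSearch] at hc
    | leftEnd =>
      obtain ⟨hX, hR⟩ := ha v₃ (v₂ ++ E) (by rw [hv]; simp)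
      subst hX
      simp only [CompData.step, stepSearch] at hc
      split at hc
      · cases hc
      rename_i hg0
      simp only [Option.map_eq_some_iff, Prod.mk.injEq] at hc
      obtain ⟨s₂, hs₂, rfl, rfl⟩ := hc
      have hs₂ := altState_eq_some hs₂
      refine Hunt.back (D := D) (R := R) (v := v) (G := G) (q := q) [.leftEnd] v₂ hv _ _
        (by rwa [← hg]) (by rw [← hg]; exact hs₂.1)
        (by rw [← hg, ← hg]; exact hs₂.2.symm) ?_
      intro r hr _
      rw [hR r hr, hv]
      rfl
    | letter a =>
      simp only [CompData.step, stepSearch, Option.bind_eq_some_iff] at hc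
      obtain ⟨s₀, hs₀, hc⟩ := hc
      have hs₀ := altState_eq_some hs₀
      split at hc
      · rename_i s₃ hs₃
        have hs₃ := altState_eq_some hs₃
        cases hc
        have := Hunt.search (R := R) (D := D) (v := v) (G := G) (q := q) v₃ (.letter a :: v₂)
          (by rw [hv]; simp) (fun r => g (D.seq.δ r (.letter a))) (fun r => by rw [hg]; rfl)
          ⟨s₃, s₀, hs₃.1, hs₀.1, hs₃.2⟩
        simpa [HeadMove.apply] using this
      · rename_i hnone
        rw [altState_eq_none he] at hnone
        simp only [Option.map_eq_some_iff, Prod.mk.injEq] at hc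
        obtain ⟨s₂, hs₂, rfl, rfl⟩ := hc
        have hs₂ := altState_eq_some hs₂
        refine Hunt.back (D := D) (R := R) (v := v) (G := G) (q := q) (v₃ ++ [.letter a]) v₂ hv _ _
          (by rw [← hg]; exact hs₀.1)
          (by rw [← hg]; exact hs₂.1) (by rw [← hg, ← hg]; exact hs₂.2.symm) ?_
        intro r _ hr
        have e : D.seq.run r v = D.seq.run (D.seq.δ (D.seq.run r v₃) (.letter a)) v₂ := by
          rw [hv]; simp
        rw [e, ← hg] at hr ⊢
        rw [← hg]
        exact hnone _ hr
  | back v₁ v₂ hv s₁ s₂ h₁ h₂ hne hR =>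
    have hlen : v₂ ≠ [] := by
      rintro rfl
      rw [hv] at hk
      simp at hk
    obtain ⟨z, v₃, rfl⟩ := List.exists_cons_of_ne_nil hlen
    obtain ⟨_, hE⟩ := tapeCell_eq_some_append (X := v₁) (Y := z :: v₃ ++ E)
      (by rw [hv]; simp) hs
    obtain ⟨rfl, -⟩ := List.cons.inj hE
    cases z with
    | rightEnd => simp [CompData.step, stepBack] at hc
    | leftEnd => simp [CompData.step, stepBack] at hc
    | letter a =>
      simp only [CompData.step, stepBack] at hc
      split at hc
      · rename_i heq
        exact absurd (by simp [heq]) hne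
      · cases hc
        have := Hunt.back (D := D) (q := q) (v₁ ++ [.letter a]) v₃ (by rw [hv]; simp) _ _ h₁ h₂ hne
          hR
        simpa [HeadMove.apply] using this

omit [DecidableEq S] in
theorem Hunt.le {R : Set S} {v : List (TapeSymbol A)} {G : S → Option S} {q : Q}
    {c : CompState S Q D.K} {k : ℕ} (h : D.Hunt R v G q c k) : k ≤ v.length + 1 := by
  cases h with
  | search v₁ v₂ hv => rw [hv, List.length_append]; omega
  | back v₁ v₂ hv => rw [hv, List.length_append]; omega

/-- The search for the state before the last symbol `x` of `v ++ [x]` ends at this symbol, with a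
state `c` that is right for all possible states in front of `v` that lead to `p`. -/
def Found (D : CompData S Q A B C) (R : Set S) (v : List (TapeSymbol A)) (x : TapeSymbol A) (p : S)
    (q : Q) (c' : CompState S Q D.K) : Prop :=
  ∃ c, D.seq.δ c x = p ∧ (∀ r ∈ R, D.seq.run r (v ++ [x]) = p → D.seq.run r v = c) ∧
    ∃ j : Fin D.K, j.1 = (D.seq.block c x).length ∧ c' = .simulate q c j

/-- One transition of the search for the state before `x` that begins with `p` after `x`. -/
theorem Hunt.step_target (he : ∀ s, s ∈ D.enum) {R : Set S} {v E : List (TapeSymbol A)}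
    {x : TapeSymbol A} (ha : D.Anchored R (v ++ x :: E)) {p : S} {q : Q}
    {c c' : CompState S Q D.K} {k : ℕ}
    {s : TapeSymbol A} {e : HeadMove} (h : D.Hunt R v (D.candidate p x) q c k)
    (hs : tapeCell (v ++ x :: E) k = some s) (hc : D.step c s = some (c', e)) :
    D.Hunt R v (D.candidate p x) q c' (e.apply k) ∨
      (e.apply k = v.length + 1 ∧ D.Found R v x p q c') := by
  by_cases hk : k ≤ v.length
  · exact .inl (h.step he ha hk hs hc)
  right
  cases h with
  | search v₁ v₂ hv => rw [hv, List.length_append] at hk; omega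
  | back v₁ v₂ hv s₁ s₂ h₁ h₂ hne hR =>
    have hlen : v₂ = [] := by
      rw [hv, List.length_append] at hk
      exact List.length_eq_zero_iff.1 (by omega)
    subst hlen
    rw [List.append_nil] at hv
    subst hv
    rw [tapeCell_append_cons] at hs
    cases hs
    simp only [D.candidate_ne_none, D.seq.run_nil] at h₁ h₂ hR
    cases x with
    | rightEnd => simp [CompData.step, stepBack] at hc
    | leftEnd => simp [CompData.step, stepBack] at hc
    | letter a =>
      simp only [CompData.step, stepBack, h₁, h₂, if_true] at hc
      obtain ⟨rfl, j, hj, rfl⟩ := D.enterRight_eq_some hc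
      refine ⟨rfl, s₁, h₁, fun r hr hp => ?_, j, hj, rfl⟩
      have hp' : D.seq.δ (D.seq.run r v) (.letter a) = p := by simpa using hp
      have := hR r hr hp'
      rw [D.candidate_eq_some.2 ⟨hp', rfl⟩, D.candidate_eq_some.2 ⟨h₁, rfl⟩] at this
      exact Option.some.inj this

/-- The first transition of the search for the state before `x`. -/
theorem stepRetreat_spec (he : ∀ s, s ∈ D.enum) {R : Set S} {v E : List (TapeSymbol A)}
    {x : TapeSymbol A} (ha : D.Anchored R (v ++ x :: E)) {p : S} {q : Q}
    {c' : CompState S Q D.K} {e : HeadMove} (hc : D.step (.retreat q p) x = some (c', e)) :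
    D.Hunt R v (D.candidate p x) q c' (e.apply (v.length + 1)) ∨
      (e.apply (v.length + 1) = v.length + 1 ∧ D.Found R v x p q c') := by
  cases x with
  | rightEnd => simp [CompData.step, stepRetreat] at hc
  | leftEnd =>
    right
    obtain ⟨rfl, hR⟩ := ha _ _ rfl
    simp only [CompData.step, stepRetreat] at hc
    split at hc
    · rename_i hp
      obtain ⟨rfl, j, hj, rfl⟩ := D.enterRight_eq_some hc
      exact ⟨rfl, _, hp, fun r hr _ => hR r hr, j, hj, rfl⟩
    · cases hc
  | letter a =>
    simp only [CompData.step, stepRetreat, Option.bind_eq_some_iff] at hc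
    obtain ⟨c, hc0, hc⟩ := hc
    have hc0 := altState_eq_some hc0
    have hcc : D.candidate p (.letter a) c = some c :=
      D.candidate_eq_some.2 ⟨D.candidate_ne_none.1 hc0.1, rfl⟩
    split at hc
    · rename_i hnone
      rw [altState_eq_none he] at hnone
      obtain ⟨rfl, j, hj, rfl⟩ := D.enterRight_eq_some hc
      refine .inr ⟨rfl, c, D.candidate_ne_none.1 hc0.1, fun r hr hp => ?_, j, hj, rfl⟩
      have hp' : D.seq.δ (D.seq.run r v) (.letter a) = p := by simpa using hp
      have := hnone _ (D.candidate_ne_none.2 hp')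
      exact (D.candidate_eq_some.1 this).2
    · rename_i s₃ hs₃
      have hs₃ := altState_eq_some hs₃
      cases hc
      left
      have := Hunt.search (D := D) (R := R) (v := v) (G := D.candidate p (.letter a)) (q := q) v []
        (by simp) _ (fun s => rfl) ⟨s₃, c, hs₃.1, hc0.1, fun h => hs₃.2 (h.trans hcc)⟩
      simpa [HeadMove.apply] using this

end CompData

/-! ### Runs of the composite machine follow runs of the two-way machine -/

namespace CompData

open TwoWayAutomaton

variable {S Q A B C : Type*} [DecidableEq S] (D : CompData S Q A B C)

/-- The correspondence between the configurations of the composite machine on the tape `Z ++ T`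
and those of the two-way machine on the output that the sequential machine produces on `T` from
state `p₀`. All simulated steps take place on `T`; the searches may enter `Z`. As in `Hunt`, the
set `R` consists of the possible states in front of the tape. A search for the state before the
last symbol of `Z ++ X` only takes place if `X` satisfies `P`. -/
inductive Track (R : Set S) (Z T : List (TapeSymbol A)) (p₀ : S)
    (P : List (TapeSymbol A) → Prop) : CompState S Q D.K → ℕ → Q → ℕ → Prop
  | simulate (X Y : List (TapeSymbol A)) (hT : T = X ++ Y) (q : Q) (i : Fin D.K)
      (hi : Y ≠ [] ∨ i.1 = 1) :
      Track R Z T p₀ P (.simulate q (D.seq.run p₀ X) i) (Z.length + X.length + 1) q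
        ((D.seq.out p₀ X).length + i)
  | retreat (X Y : List (TapeSymbol A)) (hT : T = X ++ Y) (hP : P X) (q : Q) :
      Track R Z T p₀ P (.retreat q (D.seq.run p₀ X)) (Z.length + X.length) q
        (D.seq.out p₀ X).length
  | hunt (X Y : List (TapeSymbol A)) (hT : T = X ++ Y) (hP : P X) (v : List (TapeSymbol A))
      (x : TapeSymbol A) (hv : Z ++ X = v ++ [x]) (q : Q) (c : CompState S Q D.K) (k : ℕ)
      (hH : D.Hunt R v (D.candidate (D.seq.run p₀ X) x) q c k) :
      Track R Z T p₀ P c k q (D.seq.out p₀ X).length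

/-- The assumptions under which `Track` is preserved: `p₀` is a possible state after `Z`, it does
not determine the state before the last symbol of `Z` (so that no search for this state
succeeds), and `P` holds for the places from which a search can begin. -/
structure TrackHyp (R : Set S) (Z T : List (TapeSymbol A)) (p₀ : S)
    (P : List (TapeSymbol A) → Prop) : Prop where
  enum : ∀ s, s ∈ D.enum
  anchored : D.Anchored R (Z ++ T)
  exists_run : ∃ r ∈ R, D.seq.run r Z = p₀
  ambiguous : ∀ v x, Z = v ++ [x] → ∃ r ∈ R, ∃ r' ∈ R, D.seq.run r Z = p₀ ∧
    D.seq.run r' Z = p₀ ∧ D.seq.run r v ≠ D.seq.run r' v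
  boundary : ∀ X x Y, T = X ++ x :: Y → P X

/-- A transition of the two-way machine on the tape `W`, with its output. -/
def TwoStep (W : List (TapeSymbol B)) (q : Q) (m : ℕ) (q' : Q) (m' : ℕ) (o : List C) : Prop :=
  ∃ b d, tapeCell W m = some b ∧ D.two.δ q b = some (q', d) ∧ m' = d.apply m ∧ o = D.two.γ q b

variable {D}

theorem Found.track {R : Set S} {Z T : List (TapeSymbol A)} {p₀ : S}
    {P : List (TapeSymbol A) → Prop} (hyp : D.TrackHyp R Z T p₀ P) {X Y v : List (TapeSymbol A)}
    {x : TapeSymbol A} (hT : T = X ++ Y) (hv : Z ++ X = v ++ [x]) {q : Q} {c : CompState S Q D.K}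
    (h : D.Found R v x (D.seq.run p₀ X) q c) :
    D.Track R Z T p₀ P c (v.length + 1) q (D.seq.out p₀ X).length := by
  obtain ⟨c, -, hR, j, hj, rfl⟩ := h
  rcases List.eq_nil_or_concat X with rfl | ⟨X', z, rfl⟩
  · rw [List.append_nil] at hv
    obtain ⟨r, hr, r', hr', h1, h2, h3⟩ := hyp.ambiguous v x hv
    rw [hv] at h1 h2
    exact absurd ((hR r hr h1).trans (hR r' hr' h2).symm) h3
  · rw [List.concat_eq_append] at *
    rw [← List.append_assoc] at hv
    obtain ⟨rfl, hz⟩ := List.append_inj' hv rfl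
    obtain rfl : z = x := by simpa using hz
    obtain ⟨r, hr, hrZ⟩ := hyp.exists_run
    have hc := hR r hr (by simp [hrZ])
    rw [D.seq.run_append, hrZ] at hc
    subst hc
    have := Track.simulate (D := D) (R := R) (Z := Z) (T := T) (p₀ := p₀) (P := P) X' (z :: Y)
      (by rw [hT]; simp) q j (.inl (by simp))
    rw [hj] at this
    simpa using this

/-- A transition of the composite machine is silent, or it is a transition of the two-way
machine. In the latter case it starts inside a block. -/
theorem Track.step {R : Set S} {Z T : List (TapeSymbol A)} {p₀ : S}
    {P : List (TapeSymbol A) → Prop} (hyp : D.TrackHyp R Z T p₀ P) {c c' : CompState S Q D.K}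
    {k m : ℕ} {q : Q} {s : TapeSymbol A} {e : HeadMove} (h : D.Track R Z T p₀ P c k q m)
    (hs : tapeCell (Z ++ T) k = some s) (hc : D.step c s = some (c', e)) :
    ∃ q' m', D.Track R Z T p₀ P c' (e.apply k) q' m' ∧
      ((q' = q ∧ m' = m ∧ D.prod c s = []) ∨
        (D.TwoStep (D.seq.out p₀ T) q m q' m' (D.prod c s) ∧
          ∃ q p i, c = .simulate q p i ∧ i.1 ≤ (D.seq.block p s).length)) := by
  cases h with
  | simulate X Y hT q i hi =>
    obtain ⟨Y', rfl⟩ := tapeCell_eq_some_append (t := Z ++ T) (X := Z ++ X) (Y := Y)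
      (by rw [hT]; simp)
      (by simpa using hs)
    rcases D.stepSimulate_eq_some hc with ⟨h0, -, rfl, rfl⟩ |
      ⟨b, q', d, hi0, hb, hd, rfl, j, hj, rfl⟩ | ⟨hi', -, rfl, j, hj, rfl⟩
    · refine ⟨q, _, Track.retreat X _ hT (hyp.boundary _ _ _ hT) q, .inl ⟨rfl, ?_, ?_⟩⟩
      · rw [h0]; rfl
      · simp [CompData.prod, h0]
    · refine ⟨q', (D.seq.out p₀ X).length + j, Track.simulate X _ hT q' j (.inl (by simp)),
        .inr ⟨⟨b, d, ?_, hd, ?_, ?_⟩, q, _, i, rfl, ?_⟩⟩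
      · obtain ⟨n, hn⟩ : ∃ n, i.1 = n + 1 := ⟨i.1 - 1, by omega⟩
        rw [hn] at hb ⊢
        rw [hT, D.seq.out_append, D.seq.out_cons]
        exact tapeCell_append_block _ _ _ (by simpa using hb)
      · rw [hj]
        cases d <;> simp only [HeadMove.apply] <;> omega
      · simp [CompData.prod, hi0, hb]
      · by_contra hlt
        rw [List.getElem?_eq_none (by omega)] at hb
        cases hb
    · refine ⟨q, _, ?_, .inl ⟨rfl, rfl, ?_⟩⟩
      · have := Track.simulate (D := D) (R := R) (Z := Z) (T := T) (p₀ := p₀) (P := P) (X ++ [s]) Y'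
          (by rw [hT]; simp) q j (.inr hj)
        have e1 : (D.seq.out p₀ (X ++ [s])).length + j.1 = (D.seq.out p₀ X).length + i.1 := by
          rw [hj, hi']; simp; omega
        rw [e1] at this
        simpa [HeadMove.apply, Nat.add_assoc] using this
      · have hlen : (D.seq.block (D.seq.run p₀ X) s)[i.1 - 1]? = none := by
          rw [hi']; simp
        simp [CompData.prod, hlen]
  | retreat X Y hT hP q =>
    have hne : Z ++ X ≠ [] := by
      intro h0
      rw [← List.length_append, h0] at hs
      simp [tapeCell] at hs
    obtain ⟨v, x, hv⟩ := (List.eq_nil_or_concat (Z ++ X)).resolve_left hne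
    rw [List.concat_eq_append] at hv
    have hlen : Z.length + X.length = v.length + 1 := by
      rw [← List.length_append, hv]; simp
    have htape : Z ++ T = v ++ x :: Y := by
      rw [hT, ← List.append_assoc, hv]; simp
    rw [hlen, htape, tapeCell_append_cons] at hs
    have hs := Option.some.inj hs
    subst hs
    refine ⟨q, _, ?_, .inl ⟨rfl, rfl, rfl⟩⟩
    rw [hlen]
    rcases stepRetreat_spec hyp.enum (htape ▸ hyp.anchored) hc with h | ⟨h1, h2⟩
    · exact Track.hunt X Y hT hP v x hv q _ _ h
    · rw [h1]
      exact h2.track hyp hT hv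
  | hunt X Y hT hP v x hv q c k hH =>
    have htape : Z ++ T = v ++ x :: Y := by
      rw [hT, ← List.append_assoc, hv]; simp
    rw [htape] at hs
    refine ⟨q, _, ?_, .inl ⟨rfl, rfl, ?_⟩⟩
    · rcases hH.step_target hyp.enum (htape ▸ hyp.anchored) hs hc with h | ⟨h1, h2⟩
      · exact Track.hunt X Y hT hP v x hv q _ _ h
      · rw [h1]
        exact h2.track hyp hT hv
    · cases hH <;> rfl

theorem Track.run [Finite S] [Finite Q] {c₀ : CompState S Q D.K} {R : Set S}
    {Z T : List (TapeSymbol A)} {p₀ : S} {P : List (TapeSymbol A) → Prop}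
    (hyp : D.TrackHyp R Z T p₀ P) {c c' : CompState S Q D.K} {k k' m : ℕ} {q : Q}
    (h : D.Track R Z T p₀ P c k q m)
    (hr : Relation.ReflTransGen ((D.machine c₀).TapeStep (Z ++ T)) (c, k) (c', k')) :
    ∃ q' m', D.Track R Z T p₀ P c' k' q' m' ∧
      Relation.ReflTransGen (D.two.TapeStep (D.seq.out p₀ T)) (q, m) (q', m') := by
  generalize hd : (c', k') = d at hr
  induction hr generalizing c' k' with
  | refl => cases hd; exact ⟨q, m, h, .refl⟩
  | @tail b d _ hstep ih =>
    obtain ⟨b1, b2⟩ := b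
    obtain ⟨q', m', h', hrun⟩ := ih rfl
    subst hd
    obtain ⟨s, e, h1, h2, h3⟩ := hstep
    simp only at h1 h2 h3
    subst h3
    obtain ⟨q'', m'', h'', hcase⟩ := h'.step hyp h1 h2
    refine ⟨q'', m'', h'', ?_⟩
    rcases hcase with ⟨rfl, rfl, -⟩ | ⟨⟨b, d, hb, hd, rfl, -⟩, -⟩
    · exact hrun
    · exact hrun.tail ⟨b, d, hb, hd, rfl⟩

omit [DecidableEq S] in
/-- The simulation when it starts in state `p₀` at the left end of a tape. -/
theorem trackHyp_nil (he : ∀ s, s ∈ D.enum) {R : Set S} {T : List (TapeSymbol A)} {p₀ : S}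
    (ha : D.Anchored R T) (hp : p₀ ∈ R) : D.TrackHyp R [] T p₀ (fun _ => True) where
  enum := he
  anchored := ha
  exists_run := ⟨p₀, hp, rfl⟩
  ambiguous := fun v x h => by simp at h
  boundary := fun _ _ _ _ => trivial

end CompData

/-! ### How the composite machine leaves a factor -/

namespace TotalTransducer

variable {S A B : Type*} (M : TotalTransducer S A B)

/-- The state reached from `p` by reading the unmarked word `w`. -/
abbrev runWord (p : S) (w : List A) : S := M.run p (w.map .letter)

/-- The output produced on the unmarked word `w` from state `p`. -/
def outWord (p : S) : List A → List B
  | [] => []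
  | a :: w => M.γ p (.letter a) ++ outWord (M.δ p (.letter a)) w

theorem out_map_letter (p : S) (w : List A) :
    M.out p (w.map .letter) = (M.outWord p w).map .letter := by
  induction w generalizing p with
  | nil => rfl
  | cons a w ih => simp [outWord, block, ih]

theorem outWord_append (p : S) (w z : List A) :
    M.outWord p (w ++ z) = M.outWord p w ++ M.outWord (M.runWord p w) z := by
  induction w generalizing p with
  | nil => rfl
  | cons a w ih => simp [outWord, ih, runWord]

theorem runWord_append (p : S) (w z : List A) :
    M.runWord p (w ++ z) = M.runWord (M.runWord p w) z := by
  simp [runWord]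

end TotalTransducer

namespace CompData

open TwoWayAutomaton

variable {S Q A B C : Type*} [DecidableEq S] (D : CompData S Q A B C)

/-- Every simulated state on `Y ++ E` leads to `p'` over the rest of `Y`. In contrast to `Track`,
this does not need a state in front of `Y` that leads to `p'`. -/
inductive LeadsTo (Y E : List (TapeSymbol A)) (p' : S) : CompState S Q D.K → ℕ → Prop
  | simulate (X X' : List (TapeSymbol A)) (hY : Y = X ++ X') (p : S) (hp : D.seq.run p X' = p')
      (q : Q) (i : Fin D.K) : LeadsTo Y E p' (.simulate q p i) (X.length + 1)
  | exited (c : CompState S Q D.K) : LeadsTo Y E p' c (Y.length + E.length + 1)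
  | retreat (X X' : List (TapeSymbol A)) (hY : Y = X ++ X') (p : S) (hp : D.seq.run p X' = p')
      (q : Q) : LeadsTo Y E p' (.retreat q p) X.length
  | hunt (X X' : List (TapeSymbol A)) (hY : Y = X ++ X') (p : S) (hp : D.seq.run p X' = p')
      (v : List (TapeSymbol A)) (x : TapeSymbol A) (hv : X = v ++ [x]) (q : Q)
      (c : CompState S Q D.K) (k : ℕ) (hH : D.Hunt Set.univ v (D.candidate p x) q c k) :
      LeadsTo Y E p' c k

variable {D}

theorem Found.leadsTo {R : Set S} {Y E : List (TapeSymbol A)} {p' : S} {X X' : List (TapeSymbol A)}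
    (hY : Y = X ++ X') {p : S} (hp : D.seq.run p X' = p') {v : List (TapeSymbol A)}
    {x : TapeSymbol A} (hv : X = v ++ [x]) {q : Q} {c : CompState S Q D.K}
    (h : D.Found R v x p q c) : D.LeadsTo Y E p' c (v.length + 1) := by
  obtain ⟨c, hc, -, j, -, rfl⟩ := h
  exact LeadsTo.simulate v (x :: X') (by rw [hY, hv]; simp) c (by simp [hc, hp]) q j

theorem LeadsTo.step (he : ∀ s, s ∈ D.enum) {Y E : List (TapeSymbol A)} (hE : E.length ≤ 1)
    (ha : D.Anchored Set.univ (Y ++ E)) {p' : S} {c c' : CompState S Q D.K} {k : ℕ}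
    {s : TapeSymbol A} {e : HeadMove} (h : D.LeadsTo Y E p' c k)
    (hs : tapeCell (Y ++ E) k = some s) (hc : D.step c s = some (c', e)) :
    D.LeadsTo Y E p' c' (e.apply k) := by
  cases h with
  | exited c => simp [tapeCell] at hs
  | simulate X X' hY p hp q i =>
    rcases D.stepSimulate_eq_some hc with ⟨h0, -, rfl, rfl⟩ |
      ⟨b, q', d, -, -, -, rfl, j, -, rfl⟩ | ⟨-, -, rfl, j, -, rfl⟩
    · exact LeadsTo.retreat X X' hY p hp q
    · exact LeadsTo.simulate X X' hY p hp q' j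
    · cases X' with
      | nil =>
        rw [List.append_nil] at hY
        subst hY
        obtain ⟨E', rfl⟩ := tapeCell_eq_some_append (t := Y ++ E) rfl hs
        have : E'.length = 0 := by simpa using hE
        have h := LeadsTo.exited (D := D) (Y := Y) (E := s :: E') (p' := p')
          (.simulate q (D.seq.δ p s) j)
        simpa [this, HeadMove.apply] using h
      | cons x X' =>
        obtain ⟨_, h⟩ := tapeCell_eq_some_append (t := Y ++ E) (X := X) (Y := x :: X' ++ E)
          (by rw [hY]; simp) hs
        obtain ⟨rfl, -⟩ := List.cons.inj h
        have := LeadsTo.simulate (D := D) (Y := Y) (E := E) (p' := p') (X ++ [x]) X'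
          (by rw [hY]; simp) (D.seq.δ p x) hp q j
        simpa [HeadMove.apply] using this
  | retreat X X' hY p hp q =>
    have hne : X ≠ [] := by
      rintro rfl
      simp [tapeCell] at hs
    obtain ⟨v, x, hv⟩ := (List.eq_nil_or_concat X).resolve_left hne
    rw [List.concat_eq_append] at hv
    have htape : Y ++ E = v ++ x :: (X' ++ E) := by rw [hY, hv]; simp
    have hlen : X.length = v.length + 1 := by rw [hv]; simp
    rw [hlen, htape, tapeCell_append_cons] at hs
    have hs := Option.some.inj hs
    subst hs
    rw [hlen]
    rcases stepRetreat_spec he (htape ▸ ha) hc with h | ⟨h1, h2⟩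
    · exact LeadsTo.hunt X X' hY p hp v x hv q _ _ h
    · rw [h1]
      exact h2.leadsTo hY hp hv
  | hunt X X' hY p hp v x hv q c k hH =>
    have htape : Y ++ E = v ++ x :: (X' ++ E) := by rw [hY, hv]; simp
    rw [htape] at hs
    rcases hH.step_target he (htape ▸ ha) hs hc with h | ⟨h1, h2⟩
    · exact LeadsTo.hunt X X' hY p hp v x hv q _ _ h
    · rw [h1]
      exact h2.leadsTo hY hp hv

theorem LeadsTo.run [Finite S] [Finite Q] {c₀ : CompState S Q D.K} (he : ∀ s, s ∈ D.enum)
    {Y E : List (TapeSymbol A)} (hE : E.length ≤ 1)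
    (ha : D.Anchored Set.univ (Y ++ E)) {p' : S} {c c' : CompState S Q D.K} {k k' : ℕ}
    (h : D.LeadsTo Y E p' c k)
    (hr : Relation.ReflTransGen ((D.machine c₀).TapeStep (Y ++ E)) (c, k) (c', k')) :
    D.LeadsTo Y E p' c' k' := by
  generalize hd : (c', k') = d at hr
  induction hr generalizing c' k' with
  | refl => cases hd; exact h
  | @tail b d _ hstep ih =>
    subst hd
    obtain ⟨s, e, h1, h2, h3⟩ := hstep
    simp only at h1 h2 h3
    subst h3
    exact (ih rfl).step he hE ha h1 h2

/-- If the machine leaves on the left, then some state in front of `Y` leads to `p'`. -/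
theorem LeadsTo.exists_run {Y E : List (TapeSymbol A)} {p' : S} {c : CompState S Q D.K}
    (h : D.LeadsTo Y E p' c 0) : ∃ r, D.seq.run r Y = p' := by
  generalize hk : 0 = k at h
  cases h with
  | simulate => omega
  | exited => omega
  | retreat X X' hY p hp q =>
    have hX := List.length_eq_zero_iff.1 hk.symm
    subst hX hY
    exact ⟨p, hp⟩
  | hunt X X' hY p hp v x hv q c k hH =>
    cases hH with
    | back => omega
    | search v₁ v₂ hv' g hg h₂ =>
      have hX := List.length_eq_zero_iff.1 hk.symm
      subst hX hv' hv hY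
      obtain ⟨s, -, hs, -⟩ := h₂
      rw [hg, D.candidate_ne_none] at hs
      refine ⟨s, ?_⟩
      rw [← hp, ← hs]
      simp

/-- The states in which the composite machine leaves a word on the left while the two-way machine
is in state `q`, in terms of the prefix `Z` that the simulation does not enter and of the state
`p₀` after it. -/
def LeftExit (D : CompData S Q A B C) (Z : List (TapeSymbol A)) (p₀ : S) (q : Q)
    (c : CompState S Q D.K) : Prop :=
  (Z = [] ∧ c = .retreat q p₀) ∨
    ∃ v x, Z = v ++ [x] ∧ c = .search q fun s => D.candidate p₀ x (D.seq.run s v)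

theorem LeftExit.unique {Z : List (TapeSymbol A)} {p₀ : S} {q : Q} {c c' : CompState S Q D.K}
    (h : D.LeftExit Z p₀ q c) (h' : D.LeftExit Z p₀ q c') : c = c' := by
  rcases h with ⟨h1, rfl⟩ | ⟨v, x, h1, rfl⟩ <;> rcases h' with ⟨h1', rfl⟩ | ⟨v', x', h1', rfl⟩
  · rfl
  · simp [h1] at h1'
  · simp [h1] at h1'
  · rw [h1] at h1'
    obtain ⟨rfl, h2⟩ := List.append_inj' h1' rfl
    obtain rfl : x = x' := by simpa using h2
    rfl

omit [DecidableEq S] in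
/-- The simulation of a run that enters on the right, where `p'` is the state after `Z ++ X₀`. The
prefix `Z` ends at the first place where the states that lead to `p'` agree. -/
theorem trackHyp_right (he : ∀ s, s ∈ D.enum) {Z X₀ E : List (TapeSymbol A)}
    (hE : E.length ≤ 1) (ha : D.Anchored Set.univ (Z ++ (X₀ ++ E))) {p₀ p' : S}
    (hex : ∃ r, D.seq.run r (Z ++ X₀) = p')
    (hZ : ∀ r, D.seq.run r (Z ++ X₀) = p' → D.seq.run r Z = p₀)
    (hamb : ∀ v x, Z = v ++ [x] → ∃ r r', D.seq.run r (Z ++ X₀) = p' ∧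
      D.seq.run r' (Z ++ X₀) = p' ∧ D.seq.run r v ≠ D.seq.run r' v) :
    D.TrackHyp Set.univ Z (X₀ ++ E) p₀ (fun X => X <+: X₀) where
  enum := he
  anchored := ha
  exists_run := by
    obtain ⟨r, hr⟩ := hex
    exact ⟨r, trivial, hZ r hr⟩
  ambiguous := by
    intro v x h
    obtain ⟨r, r', h1, h2, h3⟩ := hamb v x h
    exact ⟨r, trivial, r', trivial, hZ r h1, hZ r' h2, h3⟩
  boundary := by
    intro X x Y h
    have hl := congrArg List.length h
    simp only [List.length_append, List.length_cons] at hl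
    exact List.prefix_of_prefix_length_le (l₃ := X₀ ++ E) (by rw [h]; exact List.prefix_append _ _)
      (List.prefix_append _ _) (by omega)

/-- How a run leaves a word on the left: a search that has crossed `Z` still has the candidate
function that belongs to `Z`. -/
theorem Track.leftExit {Z X₀ E : List (TapeSymbol A)} {p₀ p' : S}
    (hex : ∃ r, D.seq.run r (Z ++ X₀) = p')
    (hZ : ∀ r, D.seq.run r (Z ++ X₀) = p' → D.seq.run r Z = p₀)
    {c : CompState S Q D.K} {q : Q} {m : ℕ}
    (h : D.Track Set.univ Z (X₀ ++ E) p₀ (fun X => X <+: X₀) c 0 q m) :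
    m = 0 ∧ D.LeftExit Z p₀ q c := by
  have hp₀ : D.seq.run p₀ X₀ = p' := by
    obtain ⟨r, hr⟩ := hex
    rw [← hZ r hr, ← hr]
    simp
  generalize hk : 0 = k at h
  cases h with
  | simulate => omega
  | retreat X Y hT hP q =>
    obtain rfl : Z = [] := List.length_eq_zero_iff.1 (by omega)
    obtain rfl : X = [] := List.length_eq_zero_iff.1 (by simpa using hk.symm)
    exact ⟨rfl, .inl ⟨rfl, rfl⟩⟩
  | hunt X Y hT hP v x hv q c k hH =>
    cases hH with
    | back => omega
    | search v₁ v₂ hv' g hg h₂ =>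
      have hX := List.length_eq_zero_iff.1 hk.symm
      subst hX
      rw [List.nil_append] at hv'
      subst hv'
      have key : ∀ s, g s ≠ none → D.seq.run s Z = p₀ := by
        intro s hs
        rw [hg, D.candidate_ne_none] at hs
        obtain ⟨W, hW⟩ := hP
        refine hZ s ?_
        rw [← hp₀, ← hW, ← List.append_assoc, hv, D.seq.run_append, D.seq.run_append,
          D.seq.run_append, ← hs]
        rfl
      rcases List.eq_nil_or_concat X with rfl | ⟨X', z, rfl⟩
      · rw [List.append_nil] at hv
        refine ⟨rfl, .inr ⟨v, x, hv, ?_⟩⟩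
        congr 1
        exact funext hg
      · exfalso
        rw [List.concat_eq_append, ← List.append_assoc] at hv
        obtain ⟨rfl, -⟩ := List.append_inj' hv rfl
        obtain ⟨s, s', h1, h2, h3⟩ := h₂
        rw [hg, hg, D.seq.run_append, D.seq.run_append, key s h1, key s' h2] at h3
        exact h3 rfl

theorem Track.rightExit {R : Set S} {T : List (TapeSymbol A)} {p₀ : S}
    {P : List (TapeSymbol A) → Prop} {c : CompState S Q D.K} {q : Q} {m : ℕ}
    (h : D.Track R [] T p₀ P c (T.length + 1) q m) :
    m = (D.seq.out p₀ T).length + 1 ∧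
      ∃ j : Fin D.K, j.1 = 1 ∧ c = .simulate q (D.seq.run p₀ T) j := by
  generalize hk : T.length + 1 = k at h
  cases h with
  | simulate X Y hT q i hi =>
    have hY : Y = [] := by
      rw [hT] at hk
      simp only [List.length_append, List.length_nil] at hk
      exact List.length_eq_zero_iff.1 (by omega)
    subst hY
    rw [List.append_nil] at hT
    subst hT
    have hi : i.1 = 1 := by simpa using hi
    exact ⟨by rw [hi], i, hi, rfl⟩
  | retreat X Y hT hP q =>
    rw [hT, List.length_append, List.length_nil] at hk
    omega
  | hunt X Y hT hP v x hv q c k hH =>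
    have h1 := hH.le
    have h2 := congrArg List.length hv
    simp only [List.nil_append, List.length_append, List.length_cons, List.length_nil] at h2
    rw [hT, List.length_append] at hk
    omega

end CompData

/-! ### The composite machine is aperiodic -/

namespace TwoWayAutomaton

variable {Q A : Type*} (M : TwoWayAutomaton Q A)

theorem factorRun_eq (w : List A) :
    M.FactorRun w = Relation.ReflTransGen (M.TapeStep (w.map TapeSymbol.letter)) := by
  rw [FactorRun, factorStep_eq]

theorem behavior_append_congr {z z' : List A} (h : M.behavior z = M.behavior z') (v : List A) :
    M.behavior (v ++ z) = M.behavior (v ++ z') := by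
  funext x y
  rw [behavior_append, behavior_append, h]

/-- If large powers of every word have the same behavior, then the words `v ++ t ^ k ++ r` are left
on the left in the same state for all large `k` by the runs that start at a given place of `r`. -/
theorem exit_left_unique {K k : ℕ}
    (hK : ∀ n ≥ K, ∀ t : List A, M.behavior (wordPow t n) = M.behavior (wordPow t (n + 1)))
    (hk : K ≤ k) {v t r : List A} {q q₁ q₂ : Q} {i : ℕ}
    (h₁ : M.FactorRun (v ++ wordPow t k ++ r) (q, (v ++ wordPow t k).length + i) (q₁, 0))
    (h₂ : M.FactorRun (v ++ wordPow t (k + 1) ++ r) (q, (v ++ wordPow t (k + 1)).length + i)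
      (q₂, 0)) : q₁ = q₂ := by
  have hb := M.behavior_append_congr (hK k hk t) v
  have h := FactorRun.congr_prefix M hb r (y := .left) h₁
  exact FactorRun.exit_unique _ (y := .left) h h₂

theorem exit_right_unique {K k : ℕ}
    (hK : ∀ n ≥ K, ∀ t : List A, M.behavior (wordPow t n) = M.behavior (wordPow t (n + 1)))
    (hk : K ≤ k) {v t : List A} {q q₁ q₂ : Q}
    (h₁ : M.FactorRun (v ++ wordPow t k) (q, v.length + 1)
      (q₁, (v ++ wordPow t k).length + 1))
    (h₂ : M.FactorRun (v ++ wordPow t (k + 1)) (q, v.length + 1)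
      (q₂, (v ++ wordPow t (k + 1)).length + 1)) : q₁ = q₂ := by
  have h := FactorRun.congr_suffix M (hK k hk t) v (y := .right) le_rfl h₁
  exact FactorRun.exit_unique _ (y := .right) h h₂

end TwoWayAutomaton

namespace TotalTransducer

open TwoWayAutomaton

variable {S A B : Type*} (M : TotalTransducer S A B)

theorem runWord_wordPow {e : S} {w : List A} (he : M.runWord e w = e) (k : ℕ) :
    M.runWord e (wordPow w k) = e := by
  induction k with
  | zero => rfl
  | succ k ih => rw [wordPow_succ, runWord_append, he, ih]

theorem outWord_wordPow {e : S} {w : List A} (he : M.runWord e w = e) (k : ℕ) :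
    M.outWord e (wordPow w k) = wordPow (M.outWord e w) k := by
  induction k with
  | zero => rfl
  | succ k ih => rw [wordPow_succ, outWord_append, he, ih, wordPow_succ]

end TotalTransducer

namespace CompData

open TwoWayAutomaton

variable {S Q A B C : Type*} [DecidableEq S] {D : CompData S Q A B C}

/-- The invariant of a run that enters a factor on the left: it either simulates the two-way machine
from some state of the sequential machine at the left end, or it runs two different states to the
right. -/
inductive LeftEntry (T : List (TapeSymbol A)) : CompState S Q D.K → ℕ → Prop
  | track (p : S) (c : CompState S Q D.K) (k : ℕ) (q : Q) (m : ℕ)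
      (h : D.Track Set.univ [] T p (fun _ => True) c k q m) : LeftEntry T c k
  | back (X Y : List (TapeSymbol A)) (hT : T = X ++ Y) (r₁ r₂ : S) (q : Q)
      (hne : X = [] ∨ D.seq.run r₁ X ≠ D.seq.run r₂ X.tail) :
      LeftEntry T (.back q (D.seq.run r₁ X) (D.seq.run r₂ X.tail)) (X.length + 1)
  | dead (c : CompState S Q D.K) : LeftEntry T c 0

/-- When the two states of the way back merge, a simulation begins from the first of them, which is
reached from some state at the left end. -/
theorem LeftEntry.step (he : ∀ s, s ∈ D.enum) {T : List (TapeSymbol A)}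
    (ha : D.Anchored Set.univ T) {c c' : CompState S Q D.K} {k : ℕ} {s : TapeSymbol A}
    {e : HeadMove} (h : LeftEntry (D := D) T c k) (hs : tapeCell T k = some s)
    (hc : D.step c s = some (c', e)) : LeftEntry (D := D) T c' (e.apply k) := by
  cases h with
  | track p c k q m h =>
    obtain ⟨q', m', h', -⟩ := h.step (trackHyp_nil he ha (Set.mem_univ p)) hs hc
    exact .track p _ _ _ _ h'
  | back X Y hT r₁ r₂ q hne =>
    obtain ⟨Y', rfl⟩ := tapeCell_eq_some_append hT hs
    cases s with
    | leftEnd => simp [CompData.step, stepBack] at hc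
    | rightEnd => simp [CompData.step, stepBack] at hc
    | letter a =>
      simp only [CompData.step, stepBack] at hc
      split at hc
      · obtain ⟨rfl, j, -, rfl⟩ := D.enterRight_eq_some hc
        have := Track.simulate (D := D) (R := Set.univ) (Z := []) (p₀ := r₁)
          (P := fun _ => True) X _ hT q j (.inl (by simp))
        exact .track r₁ _ _ _ _ (by simpa [HeadMove.apply] using this)
      · rename_i hd
        cases hc
        cases X with
        | nil =>
          exact .back [.letter a] Y' (by simpa using hT) r₁ (D.seq.δ r₂ (.letter a)) q
            (.inr (by simpa using hd))
        | cons x X =>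
          have := LeftEntry.back (D := D) (T := T) (x :: X ++ [.letter a]) Y' (by rw [hT]; simp) r₁
            r₂ q (.inr (by simpa using hd))
          simpa [HeadMove.apply] using this
  | dead => simp [tapeCell] at hs

/-- The states in which a run that entered a factor on the left leaves it on the right. -/
theorem LeftEntry.rightExit {T : List (TapeSymbol A)} {c : CompState S Q D.K} (hT : T ≠ [])
    (h : LeftEntry (D := D) T c (T.length + 1)) :
    (∃ (p : S) (q : Q) (j : Fin D.K), j.1 = 1 ∧ c = .simulate q (D.seq.run p T) j) ∨
    ∃ (r₁ r₂ : S) (q : Q), D.seq.run r₁ T ≠ D.seq.run r₂ T.tail ∧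
      c = .back q (D.seq.run r₁ T) (D.seq.run r₂ T.tail) := by
  generalize hk : T.length + 1 = k at h
  cases h with
  | track p c k q m h =>
    subst hk
    obtain ⟨-, j, hj, rfl⟩ := h.rightExit
    exact .inl ⟨p, q, j, hj, rfl⟩
  | back X Y hXY r₁ r₂ q hne =>
    have : Y = [] := by
      rw [hXY, List.length_append] at hk
      exact List.length_eq_zero_iff.1 (by omega)
    subst this
    rw [List.append_nil] at hXY
    subst hXY
    exact .inr ⟨r₁, r₂, q, hne.resolve_left hT, rfl⟩
  | dead => omega

variable [Finite S] [Finite Q] {c₀ : CompState S Q D.K}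

theorem LeftEntry.run (he : ∀ s, s ∈ D.enum) {T : List (TapeSymbol A)}
    (ha : D.Anchored Set.univ T) {c c' : CompState S Q D.K} {k k' : ℕ}
    (h : LeftEntry (D := D) T c k)
    (hr : Relation.ReflTransGen ((D.machine c₀).TapeStep T) (c, k) (c', k')) :
    LeftEntry (D := D) T c' k' := by
  generalize hd : (c', k') = d at hr
  induction hr generalizing c' k' with
  | refl => cases hd; exact h
  | @tail b d _ hstep ih =>
    subst hd
    obtain ⟨s, e, h1, h2, h3⟩ := hstep
    simp only at h1 h2 h3
    subst h3
    exact (ih rfl).step he ha h1 h2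

/-- After the first transition of a run that enters on the left, the invariant holds. -/
theorem LeftEntry.of_step (he : ∀ s, s ∈ D.enum) {T : List (TapeSymbol A)}
    (ha : D.Anchored Set.univ T) {c c' : CompState S Q D.K} {k' : ℕ}
    (h : (D.machine c₀).TapeStep T (c, 1) (c', k')) : LeftEntry (D := D) T c' k' := by
  obtain ⟨s, e, hs, hc, hk⟩ := h
  simp only at hs hk
  replace hc : D.step c s = some (c', e) := hc
  subst hk
  obtain ⟨Y, hT⟩ := tapeCell_eq_some_append (t := T) (X := []) (Y := T) rfl hs
  have hT' : T = [] ++ T := rfl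
  cases c with
  | simulate q p i =>
    refine LeftEntry.step he ha ?_ hs hc
    have := Track.simulate (D := D) (R := Set.univ) (Z := []) (p₀ := p)
      (P := fun _ => True) [] T hT' q i (.inl (by rw [hT]; simp))
    exact .track p _ _ _ _ this
  | back q s₁ s₂ =>
    exact LeftEntry.step he ha (.back [] T hT' s₁ s₂ q (.inl rfl)) hs hc
  | retreat q p =>
    have hstep := stepRetreat_spec (v := []) (E := Y) he (hT ▸ ha) hc
    rcases hstep with h | ⟨h1, c, -, -, j, -, rfl⟩
    · change D.Hunt Set.univ [] _ q c' (e.apply 1) at h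
      generalize e.apply 1 = k at h
      cases h with
      | search v₁ v₂ hv g hg h₂ =>
        obtain ⟨rfl, -⟩ := List.append_eq_nil_iff.1 hv.symm
        exact .dead _
      | back v₁ v₂ hv s₁ s₂ h₁ h₂ hne hR =>
        obtain ⟨rfl, -⟩ := List.append_eq_nil_iff.1 hv.symm
        exact .back [] T hT' s₁ s₂ q (.inl rfl)
    · have := Track.simulate (D := D) (R := Set.univ) (Z := []) (p₀ := c)
        (P := fun _ => True) [] T hT' q j (.inl (by rw [hT]; simp))
      rw [show e.apply 1 = 1 from h1]
      exact .track c _ _ _ _ this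
  | search q g =>
    cases s with
    | leftEnd =>
      simp only [CompData.step, stepSearch] at hc
      split at hc
      · cases hc
      rename_i hg0
      simp only [Option.map_eq_some_iff, Prod.mk.injEq] at hc
      obtain ⟨s₂, hs₂, rfl, rfl⟩ := hc
      have hs₂ := altState_eq_some hs₂
      exact .back [.leftEnd] Y hT D.seq.start s₂ q (.inr fun h => hs₂.2 (by
        rw [show s₂ = D.seq.δ D.seq.start .leftEnd from h.symm]))
    | rightEnd => simp [CompData.step, stepSearch] at hc
    | letter a =>
      simp only [CompData.step, stepSearch, Option.bind_eq_some_iff] at hc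
      obtain ⟨s₀, hs₀, hc⟩ := hc
      split at hc
      · cases hc
        exact .dead _
      · simp only [Option.map_eq_some_iff, Prod.mk.injEq] at hc
        obtain ⟨s₂, hs₂, rfl, rfl⟩ := hc
        have hs₂ := altState_eq_some hs₂
        exact .back [.letter a] Y hT s₀ s₂ q (.inr fun h => hs₂.2 (by
          rw [show s₂ = D.seq.δ s₀ (.letter a) from h.symm]))

/-- Two different states that the rest of the tape does not change never merge. -/
theorem back_run {X T : List (TapeSymbol A)} {s₁ s₂ : S} (h₁ : D.seq.run s₁ T = s₁)
    (h₂ : D.seq.run s₂ T = s₂) (hne : s₁ ≠ s₂) {q : Q} {c : CompState S Q D.K} {k : ℕ}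
    (hr : Relation.ReflTransGen ((D.machine c₀).TapeStep (X ++ T))
      (.back q s₁ s₂, X.length + 1) (c, k)) :
    ∃ Y Y', T = Y ++ Y' ∧ k = X.length + Y.length + 1 ∧
      c = .back q (D.seq.run s₁ Y) (D.seq.run s₂ Y) := by
  generalize hd : (c, k) = d at hr
  induction hr generalizing c k with
  | refl => cases hd; exact ⟨[], T, rfl, rfl, rfl⟩
  | @tail b d _ hstep ih =>
    subst hd
    obtain ⟨s, e, hs, hc, hk⟩ := hstep
    obtain ⟨Y, Y', hT, hb2, hb1⟩ := ih (c := b.1) (k := b.2) rfl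
    simp only at hc hk
    rw [hb1] at hc
    rw [hb2] at hs hk
    obtain ⟨Y'', rfl⟩ := tapeCell_eq_some_append (t := X ++ T) (X := X ++ Y) (Y := Y')
      (by rw [hT]; simp) (by simpa using hs)
    cases s with
    | leftEnd => simp [machine, CompData.step, stepBack] at hc
    | rightEnd => simp [machine, CompData.step, stepBack] at hc
    | letter a =>
      simp only [machine, CompData.step, stepBack] at hc
      split at hc
      · rename_i heq
        refine absurd ?_ hne
        rw [← h₁, ← h₂, hT]
        simp [heq]
      · cases hc
        refine ⟨Y ++ [.letter a], Y'', by rw [hT]; simp, ?_, by simp⟩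
        rw [hk]
        simp [HeadMove.apply, Nat.add_assoc]

/-- The state in which a run that crosses a large power of `w` from left to right leaves it does
not depend on the exponent. After `N + 1` factors, all states of the sequential machine are fixed
by `w`. -/
theorem crossing_left_right (he : ∀ s, s ∈ D.enum) {N K : ℕ} {w : List A} (hw : w ≠ [])
    (hN : ∀ p, D.seq.runWord (D.seq.runWord p (wordPow w N)) w = D.seq.runWord p (wordPow w N))
    (hK : ∀ n ≥ K, ∀ t : List B, D.two.behavior (wordPow t n) = D.two.behavior (wordPow t (n + 1)))
    {k : ℕ} (hk : K ≤ k) (hk0 : 0 < k) {c d d' : CompState S Q D.K}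
    (h : (c, d) ∈ (D.machine c₀).behavior (wordPow w (N + 1 + k)) .left .right)
    (h' : (c, d') ∈ (D.machine c₀).behavior (wordPow w (N + 1 + k + 1)) .left .right) :
    d = d' := by
  -- The first `N + 1` factors make up the word `x`, which the run leaves on the right in the same
  -- state `τ` in both cases.
  set x := wordPow w (N + 1) with hx
  have hxw : x = w ++ wordPow w N := wordPow_succ w N
  have hx0 : x ≠ [] := by rw [hxw]; simp [hw]
  have hxlen : 1 ≤ x.length := List.length_pos_iff.2 hx0
  have hsplit : ∀ n d, (c, d) ∈ (D.machine c₀).behavior (wordPow w (N + 1 + n)) .left .right →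
      ∃ τ, (D.machine c₀).FactorRun x (c, 1) (τ, x.length + 1) ∧
        (D.machine c₀).FactorRun (x ++ wordPow w n) (τ, x.length + 1)
          (d, (x ++ wordPow w n).length + 1) := by
    intro n d hd
    rw [wordPow_add] at hd
    exact FactorRun.split_right _ (c := (c, 1)) hxlen hd
  obtain ⟨τ, hτ, h⟩ := hsplit k d h
  obtain ⟨τ', hτ', h'⟩ := hsplit (k + 1) d' (by rw [← Nat.add_assoc]; exact h')
  obtain rfl : τ = τ' := FactorRun.exit_unique _ (y := .right) hτ hτ'
  rw [factorRun_eq] at hτ h h'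
  have hent : LeftEntry (D := D) (x.map .letter) τ ((x.map TapeSymbol.letter).length + 1) := by
    rcases Relation.ReflTransGen.cases_head hτ with h0 | ⟨⟨c1, k1⟩, h1, h2⟩
    · have := (Prod.mk.inj h0).2
      omega
    · have := (LeftEntry.of_step he (D.anchored_map_letter _ x) h1).run he
        (D.anchored_map_letter _ x) h2
      rwa [List.length_map]
  have hmap : x.map (TapeSymbol.letter) ≠ [] := by simpa using hx0
  have hfix : ∀ p, D.seq.runWord (D.seq.runWord p x) w = D.seq.runWord p x := by
    intro p
    rw [hxw, D.seq.runWord_append, hN]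
  have hfix' : ∀ p, D.seq.runWord (D.seq.run p (x.map TapeSymbol.letter).tail) w =
      D.seq.run p (x.map TapeSymbol.letter).tail := by
    intro p
    obtain ⟨a, w', rfl⟩ := List.exists_cons_of_ne_nil hw
    have e : (x.map TapeSymbol.letter).tail =
        w'.map .letter ++ (wordPow (a :: w') N).map .letter := by rw [hxw]; simp
    rw [e, D.seq.run_append]
    exact hN (D.seq.runWord p w')
  rcases hent.rightExit hmap with ⟨p, q, j, hj, rfl⟩ | ⟨r₁, r₂, q, hne, rfl⟩
  · have key : ∀ n d, 0 < n → Relation.ReflTransGen ((D.machine c₀).TapeStep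
        ((x ++ wordPow w n).map .letter))
        (.simulate q (D.seq.run p (x.map .letter)) j, x.length + 1)
        (d, (x ++ wordPow w n).length + 1) →
        ∃ q', (∃ i : Fin D.K, i.1 = 1 ∧ d = .simulate q' (D.seq.runWord p x) i) ∧
          D.two.FactorRun (D.seq.outWord p x ++
              wordPow (D.seq.outWord (D.seq.runWord p x) w) n)
            (q, (D.seq.outWord p x).length + 1)
            (q', (D.seq.outWord p x ++
              wordPow (D.seq.outWord (D.seq.runWord p x) w) n).length + 1) := by
      intro n d hn hr
      have hw0 : wordPow w n ≠ [] := by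
        obtain ⟨n, rfl⟩ := Nat.exists_eq_succ_of_ne_zero hn.ne'
        rw [wordPow_succ]; simp [hw]
      have hT : (x ++ wordPow w n).map TapeSymbol.letter =
        x.map .letter ++ (wordPow w n).map .letter := by simp
      have hstart := Track.simulate (D := D) (R := Set.univ) (Z := []) (p₀ := p)
        (P := fun _ => True) _ _ hT q j (.inl (by simpa using hw0))
      have hyp := trackHyp_nil he (D.anchored_map_letter Set.univ (x ++ wordPow w n))
        (Set.mem_univ p)
      simp only [List.length_nil, List.length_map, Nat.zero_add] at hstart
      obtain ⟨q', m', h1, h2⟩ := hstart.run hyp hr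
      rw [show (x ++ wordPow w n).length = ((x ++ wordPow w n).map TapeSymbol.letter).length by
        simp] at h1
      obtain ⟨rfl, i, hi, rfl⟩ := h1.rightExit
      have hrun : D.seq.runWord p (x ++ wordPow w n) = D.seq.runWord p x := by
        rw [D.seq.runWord_append, D.seq.runWord_wordPow (hfix p)]
      refine ⟨q', ⟨i, hi, by rw [← hrun]⟩, ?_⟩
      rw [D.seq.out_map_letter, ← factorRun_eq, D.seq.out_map_letter, D.seq.outWord_append,
        D.seq.outWord_wordPow (hfix p), hj, List.length_map, List.length_map] at h2
      exact h2
    obtain ⟨q₁, ⟨i, hi, rfl⟩, h1⟩ := key k d hk0 h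
    obtain ⟨q₂, ⟨i', hi', rfl⟩, h2⟩ := key (k + 1) d' (by omega) h'
    obtain rfl := D.two.exit_right_unique hK hk h1 h2
    obtain rfl : i = i' := Fin.ext (hi.trans hi'.symm)
    rfl
  · have key : ∀ n d, Relation.ReflTransGen ((D.machine c₀).TapeStep
        ((x ++ wordPow w n).map .letter))
        (.back q (D.seq.run r₁ (x.map .letter)) (D.seq.run r₂ (x.map .letter).tail), x.length + 1)
        (d, (x ++ wordPow w n).length + 1) →
        d = .back q (D.seq.run r₁ (x.map .letter)) (D.seq.run r₂ (x.map .letter).tail) := by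
      intro n d hr
      have e1 := D.seq.runWord_wordPow (hfix r₁) n
      have e2 := D.seq.runWord_wordPow (hfix' r₂) n
      rw [List.map_append] at hr
      obtain ⟨Y, Y', hY, hlen, rfl⟩ := back_run (X := x.map .letter) e1 e2 hne
        (by simpa only [List.length_map] using hr)
      have : Y' = [] := by
        have := congrArg List.length hY
        simp only [List.length_map, List.length_append] at this hlen
        exact List.length_eq_zero_iff.1 (by omega)
      rw [this, List.append_nil] at hY
      rw [← hY]
      exact congrArg₂ (CompState.back q) e1 e2
    rw [key k d h, key (k + 1) d' h']

/-- A run that enters on the right, at a place after the states in `w ^ (N + k) ++ w₀`, leaves on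
the left in a state that is determined by a place in the first `N` factors and by a run of the two-way
machine. The configurations at which such runs start are described by `hs` and `hl`. -/
theorem exists_leftExit (he : ∀ s, s ∈ D.enum) {N : ℕ} {w w₀ E : List A} (hw : w = w₀ ++ E)
    (hE : E.length ≤ 1)
    (hN : ∀ p, D.seq.runWord (D.seq.runWord p (wordPow w N)) w = D.seq.runWord p (wordPow w N))
    {c : CompState S Q D.K} {p : S} {q : Q} {κ ι : ℕ}
    (hs : ∀ Z X p₀, D.seq.run p₀ X = p →
      D.Track Set.univ Z (X ++ E.map .letter) p₀ (fun Y => Y <+: X) c (Z.length + X.length + κ) q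
        ((D.seq.out p₀ X).length + ι))
    (hl : ∀ Y, D.LeadsTo Y (E.map .letter) p c (Y.length + κ)) :
    ∃ Z p₀ v t i, ∀ k d, (D.machine c₀).FactorRun (wordPow w (N + k) ++ w)
        (c, (wordPow w (N + k) ++ w₀).length + κ) (d, 0) →
      ∃ q', D.LeftExit Z p₀ q' d ∧
        D.two.FactorRun (v ++ wordPow t k ++ t) (q, (v ++ wordPow t k).length + i) (q', 0) := by
  have hE' : (E.map (TapeSymbol.letter)).length ≤ 1 := by rwa [List.length_map]
  set x := wordPow w N with hx
  have hpow : ∀ r k, D.seq.runWord r (wordPow w (N + k)) = D.seq.runWord r x := by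
    intro r k
    rw [wordPow_add, D.seq.runWord_append, D.seq.runWord_wordPow (hN r)]
  -- The states in front of the word that lead to `p` do not depend on `k`.
  let I : Set S := {r | D.seq.runWord (D.seq.runWord r x) w₀ = p}
  have hI : ∀ r k, D.seq.runWord r (wordPow w (N + k) ++ w₀) = p ↔ r ∈ I := by
    intro r k
    rw [D.seq.runWord_append, hpow]
    rfl
  by_cases hex : ∃ r₀, r₀ ∈ I
  swap
  -- If no state leads to `p`, then the run does not leave the word on the left.
  · refine ⟨[], p, [], [], 0, fun k d hd => ?_⟩
    exfalso
    have hY := hl ((wordPow w (N + k) ++ w₀).map .letter)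
    rw [factorRun_eq] at hd
    have htape : (wordPow w (N + k) ++ w).map TapeSymbol.letter =
        (wordPow w (N + k) ++ w₀).map .letter ++ E.map .letter := by
      rw [hw]; simp
    have ha := D.anchored_map_letter Set.univ (wordPow w (N + k) ++ w)
    rw [htape] at hd ha
    rw [List.length_map] at hY
    obtain ⟨r, hr⟩ := (hY.run he hE' ha hd).exists_run
    exact hex ⟨r, (hI r k).1 hr⟩
  obtain ⟨r₀, hr₀⟩ := hex
  -- After `x`, all of these states agree, since the state after `x` is also the state after `E`.
  have hagree : ∀ r ∈ I, D.seq.runWord r x = D.seq.runWord p E := by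
    intro r hr
    have : D.seq.runWord (D.seq.runWord r x) w₀ = p := hr
    rw [← this, ← D.seq.runWord_append, ← hw, hN]
  have hJ : ∃ J, ∀ r ∈ I, ∀ r' ∈ I,
      D.seq.run r ((x.map .letter).take J) = D.seq.run r' ((x.map .letter).take J) := by
    refine ⟨x.length, fun r hr r' hr' => ?_⟩
    rw [List.take_of_length_le (by simp)]
    exact (hagree r hr).trans (hagree r' hr').symm
  -- The shortest prefix `Z` after which these states agree.
  classical
  set J := Nat.find hJ with hJdef
  have hJle : J ≤ x.length := by
    refine Nat.find_min' hJ fun r hr r' hr' => ?_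
    rw [List.take_of_length_le (by simp)]
    exact (hagree r hr).trans (hagree r' hr').symm
  have hJspec := Nat.find_spec hJ
  rw [← hJdef] at hJspec
  set Z := (x.map TapeSymbol.letter).take J with hZdef
  set p₀ := D.seq.run r₀ Z with hp₀
  set e := D.seq.runWord r₀ x with hedef
  have hee : D.seq.runWord e w = e := hN r₀
  have hZx : x.map TapeSymbol.letter = Z ++ (x.drop J).map .letter := by
    rw [hZdef, List.map_drop]
    exact (List.take_append_drop J _).symm
  have hp₀e : D.seq.runWord p₀ (x.drop J) = e := by
    rw [hedef, hp₀, TotalTransducer.runWord, TotalTransducer.runWord, hZx, D.seq.run_append]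
  have hew₀ : D.seq.runWord e w₀ = p := hr₀
  -- The output after `Z` is `v ++ t ^ k ++ t`, where `v` is produced on the rest
  -- of `x` and `t` on `w`.
  refine ⟨Z, p₀, D.seq.outWord p₀ (x.drop J), D.seq.outWord e w, (D.seq.outWord e w₀).length + ι,
    fun k d hd => ?_⟩
  rw [factorRun_eq] at hd
  set X₀ := (x.drop J ++ wordPow w k ++ w₀).map TapeSymbol.letter with hX₀
  have hZX : Z ++ X₀ = (wordPow w (N + k) ++ w₀).map .letter := by
    rw [hX₀, wordPow_add, ← hx]
    simp only [List.map_append, ← List.append_assoc]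
    rw [← hZx]
  have htape : (wordPow w (N + k) ++ w).map TapeSymbol.letter = Z ++ (X₀ ++ E.map .letter) := by
    rw [← List.append_assoc, hZX]
    conv_lhs => rw [hw]
    simp
    rw [← hw]
  have ha := D.anchored_map_letter Set.univ (wordPow w (N + k) ++ w)
  have hexr : ∃ r, D.seq.run r (Z ++ X₀) = p := ⟨r₀, by rw [hZX]; exact (hI r₀ k).2 hr₀⟩
  have hZr : ∀ r, D.seq.run r (Z ++ X₀) = p → D.seq.run r Z = p₀ := by
    intro r hr
    rw [hZX] at hr
    exact hJspec r ((hI r k).1 hr) r₀ hr₀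
  have hamb : ∀ v y, Z = v ++ [y] → ∃ r r', D.seq.run r (Z ++ X₀) = p ∧
      D.seq.run r' (Z ++ X₀) = p ∧ D.seq.run r v ≠ D.seq.run r' v := by
    intro v y hv
    have hlen : J = v.length + 1 := by
      have := congrArg List.length hv
      rw [hZdef, List.length_take, List.length_map, List.length_append] at this
      simpa [hJle] using this
    have hmin := Nat.find_min hJ (m := v.length) (by omega)
    push Not at hmin
    obtain ⟨r, hr, r', hr', hne⟩ := hmin
    have hvt : (x.map TapeSymbol.letter).take v.length = v := by
      have : ((x.map TapeSymbol.letter).take J).take v.length = v := by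
        rw [← hZdef, hv]; simp
      rw [List.take_take, min_eq_left (by omega)] at this
      exact this
    rw [hvt] at hne
    exact ⟨r, r', by rw [hZX]; exact (hI r k).2 hr, by rw [hZX]; exact (hI r' k).2 hr', hne⟩
  rw [htape] at hd ha
  have hyp := trackHyp_right he hE' ha hexr hZr hamb
  have hp₀X : D.seq.run p₀ X₀ = p := by
    obtain ⟨r, hr⟩ := hexr
    rw [← hZr r hr, ← hr, D.seq.run_append]
  have hstart := hs Z X₀ p₀ hp₀X
  have hpos : Z.length + X₀.length + κ = (wordPow w (N + k) ++ w₀).length + κ := by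
    rw [← List.length_append, hZX, List.length_map]
  rw [hpos] at hstart
  obtain ⟨q', m', h1, h2⟩ := hstart.run hyp hd
  obtain ⟨rfl, hexit⟩ := h1.leftExit hexr hZr
  refine ⟨q', hexit, ?_⟩
  have hout : D.seq.out p₀ X₀ = (D.seq.outWord p₀ (x.drop J) ++
      wordPow (D.seq.outWord e w) k ++ D.seq.outWord e w₀).map .letter := by
    rw [hX₀, D.seq.out_map_letter, D.seq.outWord_append, D.seq.outWord_append,
      D.seq.runWord_append, hp₀e, D.seq.outWord_wordPow hee, D.seq.runWord_wordPow hee]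
  have hout' : D.seq.out p₀ (X₀ ++ E.map .letter) = (D.seq.outWord p₀ (x.drop J) ++
      wordPow (D.seq.outWord e w) k ++ D.seq.outWord e w).map .letter := by
    have : D.seq.outWord e w = D.seq.outWord e w₀ ++ D.seq.outWord p E := by
      conv_lhs => rw [hw]
      rw [D.seq.outWord_append, hew₀]
    rw [D.seq.out_append, hp₀X, hout, D.seq.out_map_letter p E, ← List.map_append]
    congr 1
    rw [List.append_assoc, ← this]
  rw [hout', ← factorRun_eq, hout, List.length_map, List.length_append, Nat.add_assoc] at h2
  exact h2

/-- A search that comes from the right of a factor leaves it on the left only if it crosses the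
factor without turning back. -/
theorem search_run (he : ∀ s, s ∈ D.enum) {w : List A} {q : Q} {g : S → Option S}
    {d : CompState S Q D.K} (hw : w ≠ [])
    (h : (D.machine c₀).FactorRun w (.search q g, w.length) (d, 0)) :
    d = .search q fun s => g (D.seq.runWord s w) := by
  have ha := D.anchored_map_letter Set.univ w
  rw [factorRun_eq] at h
  -- A search can only make a transition if there are at least two candidates.
  have h₂ : ∃ s s', g s ≠ none ∧ g s' ≠ none ∧ g s ≠ g s' := by
    rcases Relation.ReflTransGen.cases_head h with h0 | ⟨c1, ⟨s, e, hs, hc, -⟩, -⟩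
    · exact absurd (Prod.mk.inj h0).2 (by simpa using hw)
    · have hc : D.step (.search q g) s = some (c1.1, e) := hc
      cases s with
      | rightEnd => simp [CompData.step, stepSearch] at hc
      | leftEnd =>
        simp only [CompData.step, stepSearch] at hc
        split at hc
        · cases hc
        · rename_i hg0
          simp only [Option.map_eq_some_iff, Prod.mk.injEq] at hc
          obtain ⟨s₂, hs₂, -⟩ := hc
          exact ⟨s₂, _, (altState_eq_some hs₂).1, hg0, (altState_eq_some hs₂).2⟩
      | letter a =>
        simp only [CompData.step, stepSearch, Option.bind_eq_some_iff] at hc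
        obtain ⟨s₀, hs₀, hc⟩ := hc
        have hs₀ := (altState_eq_some hs₀).1
        split at hc
        · rename_i s₃ hs₃
          exact ⟨_, _, (altState_eq_some hs₃).1, hs₀, (altState_eq_some hs₃).2⟩
        · simp only [Option.map_eq_some_iff, Prod.mk.injEq] at hc
          obtain ⟨s₂, hs₂, -⟩ := hc
          exact ⟨s₂, _, (altState_eq_some hs₂).1, hs₀, (altState_eq_some hs₂).2⟩
  have hstart : D.Hunt Set.univ (w.map .letter) g q (.search q g) w.length := by
    have := Hunt.search (D := D) (R := Set.univ) (q := q) (w.map .letter) []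
      (List.append_nil _).symm g (fun s => rfl) h₂
    rwa [List.length_map] at this
  have hrun : ∀ c : CompState S Q D.K × ℕ, Relation.ReflTransGen
      ((D.machine c₀).TapeStep (w.map .letter)) (.search q g, w.length) c →
      D.Hunt Set.univ (w.map .letter) g q c.1 c.2 := by
    intro c hc
    induction hc with
    | refl => exact hstart
    | tail _ hstep ih =>
      obtain ⟨s, e, hs, hc, hk⟩ := hstep
      rw [hk]
      refine ih.step (E := []) he (by rwa [List.append_nil]) ?_ (by rwa [List.append_nil]) hc
      rw [← factorCell_eq] at hs
      rw [List.length_map]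
      exact (factorCell_some hs).2
  have hd := hrun _ h
  generalize hk : ((d, 0) : CompState S Q D.K × ℕ).2 = k at hd
  simp only at hk hd
  cases hd with
  | back => omega
  | search v₁ v₂ hv g' hg =>
    obtain rfl := List.length_eq_zero_iff.1 hk.symm
    rw [List.nil_append] at hv
    subst hv
    congr 1
    exact funext hg

/-- The state in which a run that crosses a large power of `w` from right to left leaves it does
not depend on the exponent. A run that enters with a search crosses the word in this search; all
other runs are covered by `exists_leftExit`, after their first transition if they enter on the way
back of a search. -/
theorem crossing_right_left (he : ∀ s, s ∈ D.enum) {N K : ℕ} {w : List A} (hw : w ≠ [])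
    (hN : ∀ p, D.seq.runWord (D.seq.runWord p (wordPow w N)) w = D.seq.runWord p (wordPow w N))
    (hK : ∀ n ≥ K, ∀ t : List B, D.two.behavior (wordPow t n) = D.two.behavior (wordPow t (n + 1)))
    {k : ℕ} (hk : K ≤ k) {c d d' : CompState S Q D.K}
    (h : (c, d) ∈ (D.machine c₀).behavior (wordPow w (N + k + 1)) .right .left)
    (h' : (c, d') ∈ (D.machine c₀).behavior (wordPow w (N + (k + 1) + 1)) .right .left) :
    d = d' := by
  obtain ⟨w₀, a, hwa⟩ := (List.eq_nil_or_concat w).resolve_left hw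
  rw [List.concat_eq_append] at hwa
  have hlast : ∀ n, wordPow w (n + 1) = (wordPow w n ++ w₀) ++ [a] := by
    intro n
    rw [wordPow_succ', List.append_assoc, ← hwa]
  have hlen : ∀ n, (wordPow w (n + 1)).length = (wordPow w n ++ w₀).length + 1 := by
    intro n
    rw [hlast]; simp [Nat.add_assoc]
  have hcell : ∀ n, factorCell (wordPow w (n + 1)) (wordPow w (n + 1)).length =
      some (.letter a) := by
    intro n
    rw [factorCell_eq, hlen, hlast, List.map_append]
    have := tapeCell_append_cons ((wordPow w n ++ w₀).map TapeSymbol.letter) [] (.letter a)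
    rwa [List.length_map] at this
  have huniq : ∀ {c : CompState S Q D.K} {Z p₀ v t i q},
      (∀ k d, (D.machine c₀).FactorRun (wordPow w (N + k + 1))
        (c, (wordPow w (N + k + 1)).length) (d, 0) →
        ∃ q', D.LeftExit Z p₀ q' d ∧
        D.two.FactorRun (v ++ wordPow t k ++ t) (q, (v ++ wordPow t k).length + i) (q', 0)) →
      (D.machine c₀).FactorRun (wordPow w (N + k + 1)) (c, (wordPow w (N + k + 1)).length) (d, 0) →
      (D.machine c₀).FactorRun (wordPow w (N + (k + 1) + 1))
        (c, (wordPow w (N + (k + 1) + 1)).length) (d', 0) → d = d' := by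
    intro c Z p₀ v t i q hc h h'
    obtain ⟨q₁, he₁, h₁⟩ := hc k d h
    obtain ⟨q₂, he₂, h₂⟩ := hc (k + 1) d' h'
    obtain rfl := D.two.exit_left_unique hK hk h₁ h₂
    exact he₁.unique he₂
  have hsim : ∀ {q p i},
      (D.machine c₀).FactorRun (wordPow w (N + k + 1))
        (.simulate q p i, (wordPow w (N + k + 1)).length) (d, 0) →
      (D.machine c₀).FactorRun (wordPow w (N + (k + 1) + 1))
        (.simulate q p i, (wordPow w (N + (k + 1) + 1)).length) (d', 0) → d = d' := by
    intro q p i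
    obtain ⟨Z, p₀, v, t, j, hc⟩ := exists_leftExit (D := D) (c₀ := c₀) he hwa le_rfl hN
      (c := .simulate q p i) (p := p) (q := q) (κ := 1) (ι := i)
      (fun Z X p₀ h => by
        have := Track.simulate (D := D) (R := Set.univ) (Z := Z) (p₀ := p₀) (P := fun Y => Y <+: X)
          X ([a].map .letter) rfl q i (.inl (by simp))
        rwa [h] at this)
      (fun Y => LeadsTo.simulate Y [] (List.append_nil _).symm p rfl q i)
    refine huniq (Z := Z) (p₀ := p₀) (v := v) (t := t) (i := j) (q := q) fun k d hd => hc k d ?_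
    rw [← hlen, ← wordPow_succ']
    exact hd
  change (D.machine c₀).FactorRun _ (c, (wordPow w (N + k + 1)).length) (d, 0) at h
  change (D.machine c₀).FactorRun _ (c, (wordPow w (N + (k + 1) + 1)).length) (d', 0) at h'
  have hpow0 : ∀ n, wordPow w (n + 1) ≠ [] := fun n => by rw [hlast]; simp
  cases c with
  | simulate q p i => exact hsim h h'
  | retreat q p =>
    obtain ⟨Z, p₀, v, t, j, hc⟩ := exists_leftExit (D := D) (c₀ := c₀) (w₀ := w) (E := []) he
      (List.append_nil _).symm (Nat.zero_le _) hN (c := .retreat q p) (p := p) (q := q) (κ := 0)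
      (ι := 0)
      (fun Z X p₀ h => by
        have := Track.retreat (D := D) (R := Set.univ) (Z := Z) (p₀ := p₀) (P := fun Y => Y <+: X)
          (T := X ++ [].map .letter) X ([].map .letter) rfl (List.prefix_refl _) q
        rwa [h] at this)
      (fun Y => LeadsTo.retreat Y [] (List.append_nil _).symm p rfl q)
    refine huniq (Z := Z) (p₀ := p₀) (v := v) (t := t) (i := j) (q := q)
      (fun k d hd => hc k d ?_) h h'
    rw [← wordPow_succ']
    exact hd
  | search q g =>
    rw [search_run he (hpow0 _) h, search_run he (hpow0 _) h']
    congr 1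
    funext s
    rw [show N + k + 1 = N + (k + 1) by ring, show N + (k + 1) + 1 = N + (k + 1 + 1) by ring,
      wordPow_add, wordPow_add w N, D.seq.runWord_append, D.seq.runWord_append,
      D.seq.runWord_wordPow (hN s), D.seq.runWord_wordPow (hN s)]
  | back q s₁ s₂ =>
    rcases Relation.ReflTransGen.cases_head h with h0 | ⟨⟨c1, k1⟩, hst, h⟩
    · exact absurd (Prod.mk.inj h0).2 (by simpa using hpow0 _)
    rcases Relation.ReflTransGen.cases_head h' with h0 | ⟨⟨c2, k2⟩, hst', h'⟩
    · exact absurd (Prod.mk.inj h0).2 (by simpa using hpow0 _)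
    obtain ⟨s, e, hs, hc, hk1⟩ := hst
    obtain ⟨s', e', hs', hc', hk2⟩ := hst'
    simp only [hcell] at hs hs'
    obtain rfl := Option.some.inj hs
    obtain rfl := Option.some.inj hs'
    obtain ⟨rfl, rfl⟩ := Prod.mk.inj (Option.some.inj (hc.symm.trans hc'))
    have hc : D.step (.back q s₁ s₂) (.letter a) = some (c1, e) := hc
    simp only [CompData.step, stepBack] at hc
    split at hc
    · obtain ⟨rfl, j, -, rfl⟩ := D.enterRight_eq_some hc
      simp only [HeadMove.apply] at hk1 hk2
      subst hk1 hk2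
      exact hsim h h'
    · cases hc
      simp only [HeadMove.apply] at hk1
      subst hk1
      have := FactorRun.exit_eq _ (y := .right) h
      have := (Prod.mk.inj this).2
      simp [exitPos] at this

/-- The composite machine satisfies the assumption of `isAperiodic_of_crossing` if the two given
machines are aperiodic. -/
theorem machine_crossing (he : ∀ s, s ∈ D.enum)
    (hA : ∃ N, ∀ (w : List A) (p : S),
      D.seq.runWord (D.seq.runWord p (wordPow w N)) w = D.seq.runWord p (wordPow w N))
    (hB : D.two.IsAperiodic) (w : List A) (hw : w ≠ []) :
    ∃ N, ∀ n ≥ N, ∀ p q q',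
      ((p, q) ∈ (D.machine c₀).behavior (wordPow w n) .left .right →
        (p, q') ∈ (D.machine c₀).behavior (wordPow w (n + 1)) .left .right → q = q') ∧
      ((p, q) ∈ (D.machine c₀).behavior (wordPow w n) .right .left →
        (p, q') ∈ (D.machine c₀).behavior (wordPow w (n + 1)) .right .left → q = q') := by
  obtain ⟨N, hN⟩ := hA
  obtain ⟨K, hK⟩ := D.two.behavior_wordPow_of_isAperiodic hB
  refine ⟨N + 1 + (K + 1), fun n hn p q q' => ?_⟩
  obtain ⟨k, rfl⟩ := Nat.exists_eq_add_of_le hn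
  constructor
  · intro h h'
    rw [show N + 1 + (K + 1) + k = N + 1 + (K + 1 + k) by ring] at h h'
    exact crossing_left_right he hw (hN w) hK (by omega) (by omega) h h'
  · intro h h'
    rw [show N + 1 + (K + 1) + k = N + (K + 1 + k) + 1 by ring] at h h'
    rw [show N + (K + 1 + k) + 1 + 1 = N + (K + 1 + k + 1) + 1 by ring] at h'
    exact crossing_right_left he hw (hN w) hK (by omega) h h'

end CompData

/-! ### The composite machine realizes the composition -/

namespace TotalTransducer

variable {S A B : Type*} (M : TotalTransducer S A B)

/-- The output produced on the marked word `⊢ u ⊣`. -/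
def output (u : List A) : List B :=
  M.γ M.start .leftEnd ++ (M.outWord (M.δ M.start .leftEnd) u ++
    M.γ (M.runWord (M.δ M.start .leftEnd) u) .rightEnd)

theorem out_markedWord (u : List A) : M.out M.start (markedWord u) = markedWord (M.output u) := by
  simp [markedWord, output, block, out_map_letter]

end TotalTransducer

/-- The first symbol of a marked word is `⊢`, the last one is `⊣`, and the others are letters. -/
theorem markedWord_eq_append_cons {A : Type*} {u : List A} {X Y : List (TapeSymbol A)}
    {s : TapeSymbol A} (h : markedWord u = X ++ s :: Y) :
    (X = [] ∧ s = .leftEnd ∧ Y ≠ []) ∨ (X ≠ [] ∧ Y ≠ [] ∧ ∃ a, s = .letter a) ∨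
      (X ≠ [] ∧ Y = [] ∧ s = .rightEnd ∧ X.length = u.length + 1) := by
  cases X with
  | nil =>
    left
    obtain ⟨rfl, rfl⟩ := List.cons.inj h
    exact ⟨rfl, rfl, by simp⟩
  | cons x X =>
    right
    obtain ⟨-, h⟩ := List.cons.inj h
    rcases List.eq_nil_or_concat Y with rfl | ⟨Y, y, rfl⟩
    · right
      obtain ⟨h1, h2⟩ := List.append_inj' h rfl
      refine ⟨by simp, rfl, by simpa using h2.symm, ?_⟩
      rw [← h1]; simp
    · left
      refine ⟨by simp, by simp, ?_⟩
      have h' : u.map TapeSymbol.letter ++ [.rightEnd] = (X ++ s :: Y) ++ [y] := by simpa using h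
      obtain ⟨h1, -⟩ := List.append_inj' h' rfl
      have : s ∈ u.map TapeSymbol.letter := by rw [h1]; simp
      obtain ⟨a, -, rfl⟩ := List.mem_map.1 this
      exact ⟨a, rfl⟩

namespace CompData

open TwoWayAutomaton

variable {S Q A B C : Type*} [DecidableEq S] {D : CompData S Q A B C}

omit [DecidableEq S] in
theorem anchored_markedWord (u : List A) : D.Anchored {D.seq.start} (markedWord u) := by
  intro X Y h
  rcases markedWord_eq_append_cons h with ⟨rfl, -⟩ | ⟨-, -, a, ha⟩ | ⟨-, -, ha, -⟩
  · exact ⟨rfl, fun r hr => hr⟩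
  · cases ha
  · cases ha

omit [DecidableEq S] in
theorem length_markedWord (u : List A) : (markedWord u).length = u.length + 2 := by
  simp [markedWord]

/-- Positions on a marked word are shifted by one against those on a tape, since a machine does not
move left on the left endmarker. -/
theorem apply_add_one {u : List A} {k : ℕ} {s : TapeSymbol A} (hs : (markedWord u)[k]? = some s)
    {c c' : CompState S Q D.K} {e : HeadMove} (hc : D.step c s = some (c', e)) :
    e.apply (k + 1) = e.apply k + 1 := by
  cases e with
  | stay => rfl
  | right => rfl
  | left =>
    cases k with
    | zero =>
      obtain rfl : TapeSymbol.leftEnd = s := by simpa [markedWord] using hs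
      exact absurd hc (D.step_leftEnd c c')
    | succ k => rfl

variable [Finite S] [Finite Q] {c₀ : CompState S Q D.K}

theorem mem_accept {c : CompState S Q D.K} : c ∈ (D.machine c₀).accept ↔ D.IsFinal c := by
  simp [machine]

/-- A run of the composite machine that accepts gives an accepting run of the two-way machine over
the output of the sequential machine. The positions of `Track` exceed those on a marked word
by one. -/
theorem produces_sound (he : ∀ s, s ∈ D.enum) {u : List A} {c : CompState S Q D.K} {k : ℕ}
    {o : List C} (h : (D.machine c₀).Produces u c k o) {q : Q} {m : ℕ}
    (ht : D.Track {D.seq.start} [] (markedWord u) D.seq.start (fun _ => True) c (k + 1) q m) :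
    D.seq.run D.seq.start (markedWord u) ∈ D.seq.accept ∧ 1 ≤ m ∧
      D.two.Produces (D.seq.output u) q (m - 1) o := by
  have hyp := trackHyp_nil he (anchored_markedWord (D := D) u) (Set.mem_singleton D.seq.start)
  have hlen : (D.seq.out D.seq.start (markedWord u)).length = (D.seq.output u).length + 2 := by
    rw [D.seq.out_markedWord, length_markedWord]
  induction h generalizing q m with
  | halt c k h =>
    obtain ⟨hk, hc⟩ := h
    rw [mem_accept] at hc
    subst hk
    generalize hk' : u.length + 1 + 1 = k at ht
    cases ht with
    | simulate X Y hT q i hi =>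
      simp only [List.length_nil, Nat.zero_add] at hk'
      obtain ⟨hq, hp, hi'⟩ := hc
      have hY : Y.length = 1 := by
        have := congrArg List.length hT
        rw [length_markedWord, List.length_append] at this
        omega
      obtain ⟨s, rfl⟩ := List.length_eq_one_iff.1 hY
      obtain ⟨-, -, rfl, -⟩ : X ≠ [] ∧ ([] : List (TapeSymbol A)) = [] ∧ s = .rightEnd ∧ _ := by
        rcases markedWord_eq_append_cons hT with ⟨-, -, h⟩ | ⟨-, h, -⟩ | h
        · exact absurd rfl h
        · exact absurd rfl h
        · exact h
      have hm : (D.seq.out D.seq.start X).length + i.1 = (D.seq.output u).length + 2 := by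
        rw [← hlen, hT, hi']
        simp [TotalTransducer.block]
      refine ⟨?_, by omega, .halt _ _ ⟨by omega, hq⟩⟩
      rw [hT]
      simpa using hp
    | retreat => exact hc.elim
    | hunt X Y hT hP v x hv q c k hH => cases hH <;> exact hc.elim
  | step c c' k s e o h hs hd _ ih =>
    obtain ⟨q', m', ht', hcase⟩ := ht.step hyp hs hd
    rw [apply_add_one hs hd] at ht'
    obtain ⟨hacc, hm', hprod⟩ := ih ht'
    refine ⟨hacc, ?_⟩
    rcases hcase with ⟨rfl, rfl, hnil⟩ | ⟨⟨b, d, hb, hδ, rfl, hprod'⟩, q₁, p, i, rfl, hi⟩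
    · refine ⟨hm', ?_⟩
      change D.two.Produces _ _ _ (D.prod c s ++ o)
      rw [hnil]
      exact hprod
    · cases m with
      | zero => simp [tapeCell] at hb
      | succ m =>
        refine ⟨by omega, ?_⟩
        change D.two.Produces _ _ _ (D.prod (.simulate q₁ p i) s ++ o)
        rw [hprod']
        have hpos : d.apply (m + 1) - 1 = d.apply m := by
          cases d <;> rfl
        rw [hpos] at hprod
        rw [D.seq.out_markedWord] at hb
        refine .step q q' m b d o ?_ hb hδ hprod
        -- If the two-way machine accepts here, then the composite machine accepts as well.
        rintro ⟨hm, hq⟩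
        generalize hk : k + 1 = k' at ht
        generalize hmm : m + 1 = m' at ht
        cases ht with
        | hunt X Y hT hP v x hv q c k hH => cases hH
        | simulate X Y hT q i hi' =>
          obtain rfl : k = X.length := by simpa using hk
          obtain ⟨Y', rfl⟩ := tapeCell_eq_some_append hT (s := s) hs
          have hl : (D.seq.out D.seq.start X).length + i.1 =
              (D.seq.out D.seq.start X).length +
                ((D.seq.block (D.seq.run D.seq.start X) s).length +
                (D.seq.out (D.seq.δ (D.seq.run D.seq.start X) s) Y').length) := by
            rw [hT] at hlen
            simp only [D.seq.out_append, D.seq.out_cons, List.length_append] at hlen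
            omega
          have hY' : Y' = [] := by
            by_contra hne
            obtain ⟨Y₁, y, rfl⟩ := (List.eq_nil_or_concat Y').resolve_left hne
            have hy : y = .rightEnd := by
              rcases markedWord_eq_append_cons (X := X ++ s :: Y₁) (s := y) (Y := [])
                (u := u) (by rw [hT]; simp) with ⟨h, -⟩ | ⟨-, h, -⟩ | h
              · simp at h
              · exact absurd rfl h
              · exact h.2.2.1
            subst hy
            have h1 : 1 ≤ (D.seq.out (D.seq.δ (D.seq.run D.seq.start X) s)
                (Y₁.concat .rightEnd)).length := by
              simp only [List.concat_eq_append, D.seq.out_append, D.seq.out_cons,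
                TotalTransducer.block, List.length_append, List.length_cons]
              omega
            omega
          subst hY'
          obtain ⟨-, -, rfl, hX⟩ : X ≠ [] ∧ ([] : List (TapeSymbol A)) = [] ∧ s = .rightEnd ∧
              X.length = u.length + 1 := by
            rcases markedWord_eq_append_cons hT with ⟨-, -, h⟩ | ⟨-, h, -⟩ | h
            · exact absurd rfl h
            · exact absurd rfl h
            · exact h
          refine h ⟨hX, mem_accept.2 ⟨hq, ?_, ?_⟩⟩
          · rw [hT] at hacc
            simpa using hacc
          · simp [TotalTransducer.block] at hl
            omega

/-- A silent transition of the composite machine from a non-final state. -/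
theorem produces_of_step {u : List A} {c c' : CompState S Q D.K} {k : ℕ} {s : TapeSymbol A}
    {e : HeadMove} {o : List C} (hfin : ¬ (k = u.length + 1 ∧ D.IsFinal c))
    (hs : (markedWord u)[k]? = some s) (hc : D.step c s = some (c', e)) (hp : D.prod c s = [])
    (h : (D.machine c₀).Produces u c' (e.apply k) o) : (D.machine c₀).Produces u c k o := by
  have := TwoWayTransducer.Produces.step (T := D.machine c₀) c c' k s e o
    (fun hacc => hfin ⟨hacc.1, mem_accept.1 hacc.2⟩) hs hc h
  change (D.machine c₀).Produces u c k (D.prod c s ++ o) at this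
  rwa [hp] at this

omit [DecidableEq S] [Finite S] [Finite Q] in
theorem getElem?_of_eq_append {t X Y : List (TapeSymbol A)} {s : TapeSymbol A}
    (h : t = X ++ s :: Y) : t[X.length]? = some s := by
  rw [h]; simp

omit [DecidableEq S] [Finite S] [Finite Q] in
theorem enterRight_eq (hK : ∀ p s, (D.seq.block p s).length + 1 < D.K) (q : Q) (p : S)
    (s : TapeSymbol A) :
    D.enterRight q p s = some (.simulate q p ⟨(D.seq.block p s).length,
      (Nat.lt_succ_self _).trans (hK p s)⟩, .stay) := by
  have : (D.seq.block p s).length < D.K := (Nat.lt_succ_self _).trans (hK p s)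
  simp [enterRight, CompState.mkSimulate, this]

omit [DecidableEq S] [Finite S] [Finite Q] in
theorem Hunt.not_isFinal {R : Set S} {v : List (TapeSymbol A)} {G : S → Option S} {q : Q}
    {c : CompState S Q D.K} {k : ℕ} (h : D.Hunt R v G q c k) : ¬ D.IsFinal c := by
  cases h <;> exact id

omit [DecidableEq S] [Finite S] [Finite Q] in
theorem Hunt.prod_eq_nil {R : Set S} {v : List (TapeSymbol A)} {G : S → Option S} {q : Q}
    {c : CompState S Q D.K} {k : ℕ} (h : D.Hunt R v G q c k) (s : TapeSymbol A) :
    D.prod c s = [] := by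
  cases h <;> rfl

omit [Finite S] [Finite Q] in
/-- A search that takes place on a marked word does not get stuck. -/
theorem Hunt.exists_step (he : ∀ s, s ∈ D.enum)
    (hK : ∀ p s, (D.seq.block p s).length + 1 < D.K) {u : List A} {V E : List (TapeSymbol A)}
    {x : TapeSymbol A} (hT : markedWord u = V ++ x :: E) (hE : E ≠ []) {p : S}
    (hp : D.seq.run D.seq.start (V ++ [x]) = p) {q : Q} {c : CompState S Q D.K} {k : ℕ}
    (h : D.Hunt {D.seq.start} V (D.candidate p x) q c (k + 1))
    (hk : ∀ s₁ s₂, c = .back q s₁ s₂ → 1 ≤ k) :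
    ∃ s c' e, (markedWord u)[k]? = some s ∧ D.step c s = some (c', e) := by
  have hcand : D.candidate p x (D.seq.run D.seq.start V) ≠ none := by
    rw [D.candidate_ne_none, ← hp]; simp
  generalize hk' : k + 1 = k' at h
  cases h with
  | search v₁ v₂ hv g hg h₂ =>
    obtain ⟨v₃, z, rfl⟩ : ∃ v₃ z, v₁ = v₃ ++ [z] := by
      rcases List.eq_nil_or_concat v₁ with rfl | ⟨v₃, z, rfl⟩
      · simp at hk'
      · exact ⟨v₃, z, by simp⟩
    have hT' : markedWord u = v₃ ++ z :: (v₂ ++ x :: E) := by rw [hT, hv]; simp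
    have hk : k = v₃.length := by simpa using hk'
    refine ⟨z, ?_⟩
    rw [hk, getElem?_of_eq_append hT']
    have hgz : g (D.seq.δ (D.seq.run D.seq.start v₃) z) ≠ none := by
      rw [hg]
      convert hcand using 2
      rw [hv]; simp
    have halt : ∀ v, ∃ s₂, altState D.enum g v = some s₂ := by
      intro v
      rw [← Option.ne_none_iff_exists']
      intro hnone
      rw [altState_eq_none he] at hnone
      obtain ⟨s, s', h1, h2, h3⟩ := h₂
      exact h3 ((hnone s h1).trans (hnone s' h2).symm)
    rcases markedWord_eq_append_cons hT' with ⟨rfl, rfl, -⟩ | ⟨-, -, a, rfl⟩ | ⟨-, h0, -⟩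
    · obtain ⟨s₂, hs₂⟩ := halt (g (D.seq.δ D.seq.start .leftEnd))
      have hgz' : g (D.seq.δ D.seq.start .leftEnd) ≠ none := hgz
      simp [CompData.step, stepSearch, hgz', hs₂]
    · obtain ⟨s₀, hs₀⟩ : ∃ s₀, altState D.enum (fun r => g (D.seq.δ r (.letter a))) none =
          some s₀ := by
        rw [← Option.ne_none_iff_exists']
        intro hnone
        rw [altState_eq_none he] at hnone
        exact hgz (hnone _ hgz)
      obtain ⟨s₂, hs₂⟩ := halt (g (D.seq.δ s₀ (.letter a)))
      simp only [CompData.step, stepSearch, hs₀, Option.bind_some, hs₂, Option.map_some]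
      cases altState D.enum (fun r => g (D.seq.δ r (.letter a))) (g (D.seq.δ s₀ (.letter a))) with
      | none => exact ⟨_, _, trivial, rfl⟩
      | some _ => exact ⟨_, _, trivial, rfl⟩
    · simp at h0
  | back v₁ v₂ hv s₁ s₂ h₁ h₂ hne hR =>
    obtain rfl : k = v₁.length := by simpa using hk'
    have hv₁ : v₁ ≠ [] := List.length_pos_iff.1 (hk s₁ s₂ rfl)
    have hex : ∃ z v₃, v₂ ++ x :: E = z :: v₃ ∧ v₃ ≠ [] := by
      cases v₂ with
      | nil => exact ⟨x, E, rfl, hE⟩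
      | cons z v₂ => exact ⟨z, v₂ ++ x :: E, rfl, by simp⟩
    obtain ⟨z, v₃, hz, hv₃⟩ := hex
    have hT' : markedWord u = v₁ ++ z :: v₃ := by rw [hT, hv, ← hz]; simp
    refine ⟨z, ?_⟩
    rw [getElem?_of_eq_append hT']
    rcases markedWord_eq_append_cons hT' with ⟨h0, -⟩ | ⟨-, -, a, rfl⟩ | ⟨-, h0, -⟩
    · exact absurd h0 hv₁
    · simp only [CompData.step, stepBack, enterRight_eq hK]
      split
      · exact ⟨_, _, trivial, rfl⟩
      · exact ⟨_, _, trivial, rfl⟩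
    · exact absurd h0 hv₃

/-- A search on a marked word ends with the right state. -/
theorem Hunt.produces (he : ∀ s, s ∈ D.enum)
    (hK : ∀ p s, (D.seq.block p s).length + 1 < D.K) {u : List A} {V E : List (TapeSymbol A)}
    {x : TapeSymbol A} (hT : markedWord u = V ++ x :: E) (hE : E ≠ []) {p : S}
    (hp : D.seq.run D.seq.start (V ++ [x]) = p) {q : Q} {j : Fin D.K}
    (hj : j.1 = (D.seq.block (D.seq.run D.seq.start V) x).length) {o : List C}
    (ho : (D.machine c₀).Produces u (.simulate q (D.seq.run D.seq.start V) j) V.length o)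
    {c : CompState S Q D.K} {k : ℕ} (h : D.Hunt {D.seq.start} V (D.candidate p x) q c (k + 1))
    (hk : ∀ s₁ s₂, c = .back q s₁ s₂ → 1 ≤ k) : (D.machine c₀).Produces u c k o := by
  have ha : D.Anchored {D.seq.start} (V ++ x :: E) := hT ▸ anchored_markedWord u
  -- The search first goes to the left and then to the right, up to the position `|V|`.
  let μ : CompState S Q D.K → ℕ → ℕ := fun c k =>
    match c with
    | .search _ _ => V.length + 2 + k
    | _ => V.length + 1 - k
  generalize hn : μ c k = n
  induction n using Nat.strong_induction_on generalizing c k with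
  | _ n ih =>
  obtain ⟨s, c', e, hs, hc⟩ := h.exists_step he hK hT hE hp hk
  have hfin : ¬ (k = u.length + 1 ∧ D.IsFinal c) := by
    rintro ⟨-, hf⟩
    exact h.not_isFinal hf
  refine produces_of_step hfin hs hc (h.prod_eq_nil s) ?_
  have hstep := h.step_target he ha (hT ▸ hs) hc
  rw [apply_add_one hs hc] at hstep
  rcases hstep with h' | ⟨h1, c₁, -, h2, j', hj', rfl⟩
  · generalize k + 1 = k' at h
    cases h with
    | search v₁ v₂ hv g hg h₂ =>
      have hmove : (∃ g', c' = .search q g' ∧ e = .left) ∨ ∃ s₁ s₂, c' = .back q s₁ s₂ ∧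
          e = .right := by
        cases s with
        | rightEnd => simp [CompData.step, stepSearch] at hc
        | leftEnd =>
          simp only [CompData.step, stepSearch] at hc
          split at hc
          · cases hc
          · simp only [Option.map_eq_some_iff, Prod.mk.injEq] at hc
            obtain ⟨s₂, -, rfl, rfl⟩ := hc
            exact .inr ⟨_, _, rfl, rfl⟩
        | letter a =>
          simp only [CompData.step, stepSearch, Option.bind_eq_some_iff] at hc
          obtain ⟨s₀, -, hc⟩ := hc
          split at hc
          · cases hc
            exact .inl ⟨_, rfl, rfl⟩
          · simp only [Option.map_eq_some_iff, Prod.mk.injEq] at hc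
            obtain ⟨s₂, -, rfl, rfl⟩ := hc
            exact .inr ⟨_, _, rfl, rfl⟩
      rcases hmove with ⟨g', rfl, rfl⟩ | ⟨s₁, s₂, rfl, rfl⟩
      · have hk0 : k ≠ 0 := by
          rintro rfl
          obtain rfl : TapeSymbol.leftEnd = s := by simpa [markedWord] using hs
          exact D.step_leftEnd _ _ hc
        refine ih _ ?_ h' (by simp) rfl
        simp only [μ, HeadMove.apply] at hn ⊢
        omega
      · refine ih _ ?_ h' (fun _ _ _ => Nat.succ_pos _) rfl
        simp only [μ, HeadMove.apply] at hn ⊢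
        omega
    | back v₁ v₂ hv s₁ s₂ h₁ h₂ hne hR =>
      have hmove : ∃ s₁ s₂, c' = .back q s₁ s₂ ∧ e = .right := by
        cases s with
        | leftEnd => simp [CompData.step, stepBack] at hc
        | rightEnd => simp [CompData.step, stepBack] at hc
        | letter a =>
          simp only [CompData.step, stepBack] at hc
          split at hc
          · obtain ⟨-, j, -, rfl⟩ := D.enterRight_eq_some hc
            cases h'
          · cases hc
            exact ⟨_, _, rfl, rfl⟩
      obtain ⟨s₁', s₂', rfl, rfl⟩ := hmove
      refine ih _ ?_ h' (fun _ _ _ => Nat.succ_pos _) rfl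
      have hle := h'.le
      simp only [μ, HeadMove.apply] at hn hle ⊢
      omega
  · obtain rfl := h2 D.seq.start rfl hp
    obtain rfl : j' = j := Fin.ext (hj'.trans hj.symm)
    rw [Nat.succ.inj h1]
    exact ho

/-- The search for the preceding state on a marked word. -/
theorem produces_retreat (he : ∀ s, s ∈ D.enum)
    (hK : ∀ p s, (D.seq.block p s).length + 1 < D.K) {u : List A} {V E : List (TapeSymbol A)}
    {x : TapeSymbol A} (hT : markedWord u = V ++ x :: E) (hE : E ≠ []) {p : S}
    (hp : D.seq.run D.seq.start (V ++ [x]) = p) {q : Q} {j : Fin D.K}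
    (hj : j.1 = (D.seq.block (D.seq.run D.seq.start V) x).length) {o : List C}
    (ho : (D.machine c₀).Produces u (.simulate q (D.seq.run D.seq.start V) j) V.length o) :
    (D.machine c₀).Produces u (.retreat q p) V.length o := by
  have ha : D.Anchored {D.seq.start} (V ++ x :: E) := hT ▸ anchored_markedWord u
  have hs := getElem?_of_eq_append hT
  have hp' : D.seq.δ (D.seq.run D.seq.start V) x = p := by rw [← hp]; simp
  have hex : ∃ c' e, D.step (.retreat q p) x = some (c', e) := by
    rcases markedWord_eq_append_cons hT with ⟨rfl, rfl, -⟩ | ⟨-, -, a, rfl⟩ | ⟨-, h0, -⟩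
    · have hp'' : D.seq.δ D.seq.start .leftEnd = p := hp'
      simp only [CompData.step, stepRetreat, hp'', if_true, enterRight_eq hK]
      exact ⟨_, _, rfl⟩
    · obtain ⟨c, hc⟩ : ∃ c, altState D.enum (D.candidate p (.letter a)) none = some c := by
        rw [← Option.ne_none_iff_exists']
        intro hnone
        rw [altState_eq_none he] at hnone
        exact absurd (hnone _ (D.candidate_ne_none.2 hp')) (D.candidate_ne_none.2 hp')
      simp only [CompData.step, stepRetreat, hc, Option.bind_some, enterRight_eq hK]
      split <;> exact ⟨_, _, rfl⟩
    · exact absurd h0 hE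
  obtain ⟨c', e, hc⟩ := hex
  refine produces_of_step (fun h => h.2) hs hc rfl ?_
  have hstep := stepRetreat_spec he ha hc
  rw [apply_add_one hs hc] at hstep
  rcases hstep with h' | ⟨h1, c₁, -, h2, j', hj', rfl⟩
  · refine h'.produces he hK hT hE hp hj ho ?_
    rintro s₁ s₂ rfl
    cases x with
    | leftEnd =>
      simp only [CompData.step, stepRetreat] at hc
      split at hc
      · obtain ⟨-, j, -, h⟩ := D.enterRight_eq_some hc
        cases h
      · cases hc
    | rightEnd => simp [CompData.step, stepRetreat] at hc
    | letter a =>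
      simp only [CompData.step, stepRetreat, Option.bind_eq_some_iff] at hc
      obtain ⟨c, -, hc⟩ := hc
      split at hc
      · obtain ⟨-, j, -, h⟩ := D.enterRight_eq_some hc
        cases h
      · cases hc
  · obtain rfl := h2 D.seq.start rfl hp
    obtain rfl : j' = j := Fin.ext (hj'.trans hj.symm)
    rw [Nat.succ.inj h1]
    exact ho

/-- It suffices to consider the configurations in which the simulated head is inside the block of
the scanned symbol. -/
theorem produces_normalize (he : ∀ s, s ∈ D.enum)
    (hK : ∀ p s, (D.seq.block p s).length + 1 < D.K) {u : List A} {q : Q} {m : ℕ} {o : List C}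
    (hm : 1 ≤ m) (hm' : m ≤ (D.seq.out D.seq.start (markedWord u)).length)
    (h : ∀ X s Y (i : Fin D.K), markedWord u = X ++ s :: Y → 1 ≤ i.1 →
      i.1 ≤ (D.seq.block (D.seq.run D.seq.start X) s).length →
      (D.seq.out D.seq.start X).length + i.1 = m →
      (D.machine c₀).Produces u (.simulate q (D.seq.run D.seq.start X) i) X.length o)
    {X Y : List (TapeSymbol A)} {s : TapeSymbol A} {i : Fin D.K}
    (hT : markedWord u = X ++ s :: Y)
    (hi : i.1 ≤ (D.seq.block (D.seq.run D.seq.start X) s).length + 1)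
    (him : (D.seq.out D.seq.start X).length + i.1 = m) :
    (D.machine c₀).Produces u (.simulate q (D.seq.run D.seq.start X) i) X.length o := by
  have hright : ∀ n X s Y (i : Fin D.K), Y.length = n → markedWord u = X ++ s :: Y →
      i.1 = (D.seq.block (D.seq.run D.seq.start X) s).length + 1 →
      (D.seq.out D.seq.start X).length + i.1 = m →
      (D.machine c₀).Produces u (.simulate q (D.seq.run D.seq.start X) i) X.length o := by
    intro n
    induction n with
    | zero =>
      intro X s Y i hn hT hi him
      obtain rfl := List.length_eq_zero_iff.1 hn
      rw [hT] at hm'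
      simp only [D.seq.out_append, D.seq.out_cons, D.seq.out_nil, List.length_append,
        List.length_nil] at hm'
      omega
    | succ n ih =>
      intro X s Y i hn hT hi him
      obtain ⟨s', Y', rfl⟩ := List.exists_cons_of_ne_nil (l := Y) (by rintro rfl; simp at hn)
      have h1K : 1 < D.K := by have := hK D.seq.start s; omega
      have hsr : s ≠ .rightEnd := by
        rintro rfl
        rcases markedWord_eq_append_cons hT with ⟨-, h, -⟩ | ⟨-, -, a, h⟩ | ⟨-, h, -⟩ <;> simp at h
      have hnone : (D.seq.block (D.seq.run D.seq.start X) s)[i.1 - 1]? = none := by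
        rw [hi]; simp
      have hstep : D.step (.simulate q (D.seq.run D.seq.start X) i) s =
          some (.simulate q (D.seq.run D.seq.start (X ++ [s])) ⟨1, h1K⟩, .right) := by
        simp only [CompData.step, stepSimulate, hi, if_true]
        cases s <;> simp_all [CompState.mkSimulate]
      have hprod : D.prod (.simulate q (D.seq.run D.seq.start X) i) s = [] := by
        simp [CompData.prod, hnone]
      refine produces_of_step ?_ (getElem?_of_eq_append hT) hstep hprod ?_
      · rintro ⟨hX, -⟩
        have := congrArg List.length hT
        rw [length_markedWord] at this
        simp at this
        omega
      · have hT' : markedWord u = (X ++ [s]) ++ s' :: Y' := by rw [hT]; simp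
        have hout : (D.seq.out D.seq.start (X ++ [s])).length + 1 = m := by
          rw [← him, hi]; simp; omega
        have hX : (X ++ [s]).length = X.length + 1 := by simp
        change (D.machine c₀).Produces u _ (X.length + 1) o
        rw [← hX]
        by_cases hb : 1 ≤ (D.seq.block (D.seq.run D.seq.start (X ++ [s])) s').length
        · exact h _ _ _ _ hT' le_rfl hb hout
        · exact ih _ _ _ _ (by simpa using hn) hT' (by simp only; omega) hout
  have hleft : ∀ n X s Y (i : Fin D.K), X.length = n → markedWord u = X ++ s :: Y →
      i.1 = 0 → (D.seq.out D.seq.start X).length + i.1 = m →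
      (D.machine c₀).Produces u (.simulate q (D.seq.run D.seq.start X) i) X.length o := by
    intro n
    induction n with
    | zero =>
      intro X s Y i hn hT hi him
      obtain rfl := List.length_eq_zero_iff.1 hn
      simp only [D.seq.out_nil, List.length_nil] at him
      omega
    | succ n ih =>
      intro X s Y i hn hT hi him
      obtain ⟨V, x, rfl⟩ := (List.eq_nil_or_concat X).resolve_left (by rintro rfl; simp at hn)
      rw [List.concat_eq_append] at *
      have hsl : s ≠ .leftEnd := by
        rintro rfl
        rcases markedWord_eq_append_cons hT with ⟨h, -⟩ | ⟨-, -, a, h⟩ | ⟨-, -, h, -⟩ <;> simp at h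
      have hstep : D.step (.simulate q (D.seq.run D.seq.start (V ++ [x])) i) s =
          some (.retreat q (D.seq.run D.seq.start (V ++ [x])), .left) := by
        simp only [CompData.step, stepSimulate, hi, if_true]
      have hprod : D.prod (.simulate q (D.seq.run D.seq.start (V ++ [x])) i) s = [] := by
        simp [CompData.prod, hi]
      refine produces_of_step ?_ (getElem?_of_eq_append hT) hstep hprod ?_
      · rintro ⟨-, -, -, h0⟩
        omega
      · have hT' : markedWord u = V ++ x :: (s :: Y) := by rw [hT]; simp
        have hX : HeadMove.left.apply (V ++ [x]).length = V.length := by simp [HeadMove.apply]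
        rw [hX]
        have hout : (D.seq.out D.seq.start V).length +
            (D.seq.block (D.seq.run D.seq.start V) x).length = m := by
          rw [← him, hi]; simp
        refine produces_retreat he hK hT' (by simp) rfl (j := ⟨_, (Nat.lt_succ_self _).trans
          (hK (D.seq.run D.seq.start V) x)⟩) rfl ?_
        by_cases hb : 1 ≤ (D.seq.block (D.seq.run D.seq.start V) x).length
        · exact h _ _ _ _ hT' hb le_rfl hout
        · exact ih _ _ _ _ (by simpa using hn) hT' (by simp only; omega) hout
  rcases Nat.eq_zero_or_pos i.1 with h0 | h0
  · exact hleft _ _ _ _ _ rfl hT h0 him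
  · rcases Nat.lt_or_ge (D.seq.block (D.seq.run D.seq.start X) s).length i.1 with h1 | h1
    · exact hright _ _ _ _ _ rfl hT (by omega) him
    · exact h _ _ _ _ hT h0 h1 him

/-- An accepting run of the two-way machine over the output of the sequential machine gives a run of
the composite machine that accepts with the same output. -/
theorem produces_complete (he : ∀ s, s ∈ D.enum)
    (hK : ∀ p s, (D.seq.block p s).length + 1 < D.K) {u : List A}
    (hacc : D.seq.run D.seq.start (markedWord u) ∈ D.seq.accept) {q : Q} {m : ℕ} {o : List C}
    (h : D.two.Produces (D.seq.output u) q m o) {X Y : List (TapeSymbol A)} {s : TapeSymbol A}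
    {i : Fin D.K} (hT : markedWord u = X ++ s :: Y)
    (hi : i.1 ≤ (D.seq.block (D.seq.run D.seq.start X) s).length + 1)
    (him : (D.seq.out D.seq.start X).length + i.1 = m + 1) :
    (D.machine c₀).Produces u (.simulate q (D.seq.run D.seq.start X) i) X.length o := by
  have hlen : (D.seq.out D.seq.start (markedWord u)).length = (D.seq.output u).length + 2 := by
    rw [D.seq.out_markedWord, length_markedWord]
  have hsplit : ∀ {X Y s}, markedWord u = X ++ s :: Y →
      (D.seq.out D.seq.start X).length + (D.seq.block (D.seq.run D.seq.start X) s).length +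
      (D.seq.out (D.seq.run D.seq.start (X ++ [s])) Y).length = (D.seq.output u).length + 2 := by
    intro X Y s hT
    rw [← hlen, hT]
    simp [Nat.add_assoc]
  induction h generalizing X Y s i with
  | halt q m h =>
    obtain ⟨rfl, hq⟩ := h
    refine produces_normalize he hK (by omega) (by omega) ?_ hT hi him
    intro X s Y i hT hi0 hi him
    have hl := hsplit hT
    rcases markedWord_eq_append_cons hT with ⟨rfl, rfl, hY⟩ | ⟨-, hY, a, rfl⟩ | ⟨-, rfl, rfl, hX⟩
    -- The block of the last symbol is not empty, so the simulated head is on the last symbol.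
    · exfalso
      obtain ⟨Y₁, y, rfl⟩ := (List.eq_nil_or_concat Y).resolve_left hY
      rcases markedWord_eq_append_cons (X := [] ++ .leftEnd :: Y₁) (s := y) (Y := [])
        (u := u) (by rw [hT]; simp) with ⟨h, -⟩ | ⟨-, h, -⟩ | ⟨-, -, rfl, -⟩
      · simp at h
      · exact absurd rfl h
      · simp [TotalTransducer.block] at hl him hi
        omega
    · exfalso
      obtain ⟨Y₁, y, rfl⟩ := (List.eq_nil_or_concat Y).resolve_left hY
      rcases markedWord_eq_append_cons (X := X ++ .letter a :: Y₁) (s := y) (Y := [])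
        (u := u) (by rw [hT]; simp) with ⟨h, -⟩ | ⟨-, h, -⟩ | ⟨-, -, rfl, -⟩
      · simp at h
      · exact absurd rfl h
      · simp [TotalTransducer.block] at hl him hi
        omega
    · refine .halt _ _ ⟨hX, mem_accept.2 ⟨hq, ?_, ?_⟩⟩
      · rw [hT] at hacc
        simpa using hacc
      · simp [TotalTransducer.block] at hl him hi
        omega
  | step q q' m b d o h hs hd _ ih =>
    have hm : m < (D.seq.output u).length + 2 := by
      rw [← length_markedWord]
      exact (List.getElem?_eq_some_iff.1 hs).1
    refine produces_normalize he hK (by omega) (by omega) ?_ hT hi him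
    intro X s Y i hT hi0 hi him
    obtain ⟨n, hn⟩ : ∃ n, i.1 = n + 1 := ⟨i.1 - 1, by omega⟩
    have hb : (D.seq.block (D.seq.run D.seq.start X) s)[i.1 - 1]? = some b := by
      rw [← D.seq.out_markedWord, hT] at hs
      have hm' : m = (D.seq.out D.seq.start X).length + n := by omega
      rw [hm', D.seq.out_append, D.seq.out_cons, List.getElem?_append_right (by omega),
        List.getElem?_append_left (by omega)] at hs
      rw [hn]
      simpa using hs
    have hdle : d.apply i.1 ≤ (D.seq.block (D.seq.run D.seq.start X) s).length + 1 := by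
      cases d <;> simp only [HeadMove.apply] <;> omega
    have hdK : d.apply i.1 < D.K := lt_of_le_of_lt hdle (hK _ _)
    have hstep : D.step (.simulate q (D.seq.run D.seq.start X) i) s =
        some (.simulate q' (D.seq.run D.seq.start X) ⟨d.apply i.1, hdK⟩, .stay) := by
      have h0 : i.1 ≠ 0 := by omega
      simp [CompData.step, stepSimulate, h0, hb, hd, CompState.mkSimulate, hdK]
    have hprod : D.prod (.simulate q (D.seq.run D.seq.start X) i) s = D.two.γ q b := by
      have h0 : i.1 ≠ 0 := by omega
      simp [CompData.prod, h0, hb]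
    have hout : (D.seq.out D.seq.start X).length + d.apply i.1 = d.apply m + 1 := by
      cases d with
      | stay => simp only [HeadMove.apply]; omega
      | right => simp only [HeadMove.apply]; omega
      | left =>
        have : m ≠ 0 := by
          rintro rfl
          obtain rfl : TapeSymbol.leftEnd = b := by simpa [markedWord] using hs
          exact D.two.δ_leftEnd _ _ hd
        simp only [HeadMove.apply]
        omega
    have hnext := ih (X := X) (Y := Y) (s := s) (i := ⟨d.apply i.1, hdK⟩) hT hdle hout
    rw [← hprod]
    refine TwoWayTransducer.Produces.step (T := D.machine c₀) _ _ _ s .stay o ?_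
      (getElem?_of_eq_append hT) hstep hnext
    -- If the composite machine accepts here, then the two-way machine accepts as well.
    rintro ⟨hX, hf⟩
    obtain ⟨hq, -, hi'⟩ := mem_accept.1 hf
    refine h ⟨?_, hq⟩
    have hl := hsplit hT
    have hYlen : Y = [] := by
      have := congrArg List.length hT
      rw [length_markedWord] at this
      simp at this
      exact List.length_eq_zero_iff.1 (by omega)
    subst hYlen
    rcases markedWord_eq_append_cons hT with ⟨-, -, hY⟩ | ⟨-, hY, -⟩ | ⟨-, -, rfl, -⟩
    · exact absurd rfl hY
    · exact absurd rfl hY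
    · simp [TotalTransducer.block] at hl
      omega

/-- The composite machine starts with the simulated head on `⊢`, which is the first symbol of the
first block. -/
theorem produces_iff (he : ∀ s, s ∈ D.enum)
    (hK : ∀ p s, (D.seq.block p s).length + 1 < D.K) {i : Fin D.K} (hi : i.1 = 1) {u : List A}
    {o : List C} :
    (D.machine c₀).Produces u (.simulate D.two.start D.seq.start i) 0 o ↔
      D.seq.run D.seq.start (markedWord u) ∈ D.seq.accept ∧
        D.two.Produces (D.seq.output u) D.two.start 0 o := by
  constructor
  · intro h
    have ht := Track.simulate (D := D) (R := {D.seq.start}) (Z := []) (p₀ := D.seq.start)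
      (P := fun _ => True) [] (markedWord u) rfl D.two.start i (.inl (by simp [markedWord]))
    obtain ⟨h1, -, h2⟩ := produces_sound he h ht
    refine ⟨h1, ?_⟩
    simpa [hi] using h2
  · rintro ⟨h1, h2⟩
    exact produces_complete he hK h1 h2 (X := []) rfl (by simp [hi]) (by simp [hi])

end CompData

/-! ### The construction on descriptions -/

namespace CompCode

/-- Descriptions of the two machines that are composed. -/
abbrev Input : Type := SequentialCode × TwoWayCode

/-- Descriptions of the states of the composite machine: a tag for the kind of the state, the state
of the two-way machine, and a list of the other components. The state `none` of the completed
sequential machine has the number `0`, and `some p` has the number `p + 1`. A candidate function is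
written as the list of its values, with `0` for `none`. -/
abbrev State : Type := ℕ × ℕ × List ℕ

/-- The entry of the table of the sequential machine for a state of its completion, for which there
is an empty row. -/
def seqEntry (P : Input) (p j : ℕ) : Option ℕ × List ℕ :=
  (([] :: P.1.2.1).getD p []).getD j (none, [])

/-- The transition function of the completed sequential machine. -/
def next (P : Input) (p j : ℕ) : ℕ := (seqEntry P p j).1.elim 0 Nat.succ

/-- The initial state of the completed sequential machine. -/
def start (P : Input) : ℕ := P.1.2.2.1 + 1

/-- The number of `⊣` as a symbol of the sequential machine. -/
def endSymbol (P : Input) : ℕ := P.1.1.2.1 + 1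

/-- The block that is produced in state `p` on the symbol `j`. -/
def block (P : Input) (p j : ℕ) : List ℕ :=
  (if j = 0 then [0] else []) ++ ((seqEntry P p j).2.map Nat.succ ++
    if j = endSymbol P then [P.1.1.2.2 + 1] else [])

/-- The entry of the table of the two-way machine. -/
def twoEntry (P : Input) (q b : ℕ) : Option (ℕ × ℕ) × List ℕ :=
  (P.2.2.1.getD q []).getD b (none, [])

/-- A bound for the offsets, by the total length of all productions. -/
def bound (P : Input) : ℕ := (P.1.2.1.flatten.flatMap Prod.snd).length + 3

/-- The first number in the list `G` at which there is a value other than `0` and `v`. -/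
def alt (G : List ℕ) (v : ℕ) : Option ℕ :=
  ((List.range G.length).filterMap fun s =>
    if G.getD s 0 = 0 then none else if G.getD s 0 = v then none else some s).head?

/-- The candidates for the state before the symbol `j`. -/
def candidate (P : Input) (p j : ℕ) : List ℕ :=
  (List.range (P.1.1.1 + 1)).map fun c => if next P c j = p then c + 1 else 0

/-- The composition of a candidate function with the transition function for `j`. -/
def pull (P : Input) (G : List ℕ) (j : ℕ) : List ℕ :=
  (List.range (P.1.1.1 + 1)).map fun r => G.getD (next P r j) 0

/-- A transition with the move `d` to a state that simulates the two-way machine. -/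
def simulate (P : Input) (q p i d : ℕ) : Option (State × ℕ) :=
  if i < bound P then some ((0, q, [p, i]), d) else none

/-- The counterpart of `CompData.enterRight`. -/
def enterRight (P : Input) (q p j : ℕ) : Option (State × ℕ) :=
  simulate P q p (block P p j).length 1

/-- The counterpart of `CompData.stepSimulate`. -/
def stepSimulate (P : Input) (q p i j : ℕ) : Option (State × ℕ) :=
  if i = 0 then if j = 0 then none else some ((1, q, [p]), 0)
  else
    (block P p j)[i - 1]?.elim
      (if i = (block P p j).length + 1 then
        if j = endSymbol P then none else simulate P q (next P p j) 1 2
      else none)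
      fun b => (twoEntry P q b).1.bind fun t => simulate P t.1 p (i + t.2 - 1) 1

/-- The counterpart of `CompData.stepRetreat`. -/
def stepRetreat (P : Input) (q p j : ℕ) : Option (State × ℕ) :=
  if j = 0 then if next P (start P) j = p then enterRight P q (start P) j else none
  else if j = endSymbol P then none
  else
    (alt (candidate P p j) 0).bind fun c =>
      (alt (candidate P p j) (c + 1)).elim (enterRight P q c j) fun _ =>
        some ((2, q, candidate P p j), 0)

/-- A transition to the way back, for the value `v` of the candidate function `G` that belongs to
the state `s₁`. -/
def turn (q : ℕ) (G : List ℕ) (s₁ v : ℕ) : Option (State × ℕ) :=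
  (alt G v).map fun s₂ => ((3, q, [s₁, s₂]), 2)

/-- The counterpart of `CompData.stepSearch`. -/
def stepSearch (P : Input) (q : ℕ) (G : List ℕ) (j : ℕ) : Option (State × ℕ) :=
  if j = 0 then
    if G.getD (next P (start P) j) 0 = 0 then none
    else turn q G (next P (start P) j) (G.getD (next P (start P) j) 0)
  else if j = endSymbol P then none
  else
    (alt (pull P G j) 0).bind fun s₀ =>
      (alt (pull P G j) (G.getD (next P s₀ j) 0)).elim
        (turn q G (next P s₀ j) (G.getD (next P s₀ j) 0))
        fun _ => some ((2, q, pull P G j), 0)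

/-- The counterpart of `CompData.stepBack`. -/
def stepBack (P : Input) (q s₁ s₂ j : ℕ) : Option (State × ℕ) :=
  if j = 0 then none
  else if j = endSymbol P then none
  else if next P s₁ j = next P s₂ j then enterRight P q s₁ j
  else some ((3, q, [next P s₁ j, next P s₂ j]), 2)

/-- The transition function of the composite machine. -/
def step (P : Input) (x : State) (j : ℕ) : Option (State × ℕ) :=
  if x.1 = 0 then stepSimulate P x.2.1 (x.2.2.getD 0 0) (x.2.2.getD 1 0) j
  else if x.1 = 1 then stepRetreat P x.2.1 (x.2.2.getD 0 0) j
  else if x.1 = 2 then stepSearch P x.2.1 x.2.2 j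
  else stepBack P x.2.1 (x.2.2.getD 0 0) (x.2.2.getD 1 0) j

/-- The production function of the composite machine. -/
def prod (P : Input) (x : State) (j : ℕ) : List ℕ :=
  if x.1 = 0 then
    if x.2.2.getD 1 0 = 0 then []
    else (block P (x.2.2.getD 0 0) j)[x.2.2.getD 1 0 - 1]?.elim [] fun b => (twoEntry P x.2.1 b).2
  else []

/-- Whether a state of the composite machine is final. -/
def isFinal (P : Input) (x : State) : Bool :=
  decide (x.1 = 0) && (decide (x.2.1 ∈ P.2.2.2.2) &&
    (decide (next P (x.2.2.getD 0 0) (endSymbol P) ∈ P.1.2.2.2.map Nat.succ) &&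
      decide (x.2.2.getD 1 0 = (seqEntry P (x.2.2.getD 0 0) (endSymbol P)).2.length + 1)))

/-- All lists of length `k` of numbers less than `v`. -/
def words (v k : ℕ) : List (List ℕ) :=
  Nat.rec [[]] (fun _ ls => ls.flatMap fun l => (List.range v).map fun a => a :: l) k

/-- A list of the states of the composite machine. -/
def allStates (P : Input) : List State :=
  (List.range P.2.1.1).flatMap fun q =>
    (List.range (P.1.1.1 + 1)).flatMap (fun p =>
      (1, q, [p]) :: ((List.range (bound P)).map (fun i => (0, q, [p, i])) ++
        (List.range (P.1.1.1 + 1)).map fun s₂ => (3, q, [p, s₂]))) ++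
    (words (P.1.1.1 + 2) (P.1.1.1 + 1)).map fun G => (2, q, G)

/-- A list of the states of the composite machine, without repetitions. -/
def states (P : Input) : List State := (allStates P).foldr List.insert []

/-- The row of a state in the table of the composite machine. -/
def row (P : Input) (x : State) : List (Option (ℕ × ℕ) × List ℕ) :=
  (List.range (P.1.1.2.1 + 2)).map fun j =>
    ((step P x j).map fun t => ((states P).idxOf t.1, t.2), prod P x j)

/-- The numbers of the final states of the composite machine. -/
def finals (P : Input) : List ℕ :=
  (List.range (states P).length).filterMap fun i =>
    if isFinal P ((states P).getD i (0, 0, [])) = true then some i else none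

/-- The description of the composite machine. -/
def build (P : Input) : TwoWayCode :=
  (((states P).length, P.1.1.2.1, P.2.1.2.2),
    (states P).map (row P),
    (states P).idxOf (0, P.2.2.2.1, [start P, 1]),
    finals P)

/-! ### Computability of the construction -/

/-! The closure properties of primitive recursive functions are stated as rules for `fun_prop`,
for functions of one variable that are built from others by pointwise application. -/

attribute [fun_prop] Primrec

section Rules

variable {α β γ σ : Type*} [Primcodable α] [Primcodable β] [Primcodable γ] [Primcodable σ]

@[fun_prop] theorem primrec_id : Primrec fun a : α => a := Primrec.id

@[fun_prop] theorem primrec_const (b : β) : Primrec fun _ : α => b := Primrec.const b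

@[fun_prop] theorem primrec_comp {f : β → γ} {g : α → β} (hf : Primrec f) (hg : Primrec g) :
    Primrec fun a => f (g a) := hf.comp hg

@[fun_prop] theorem primrec_fst {f : α → β × γ} (hf : Primrec f) : Primrec fun a => (f a).1 :=
  Primrec.fst.comp hf

@[fun_prop] theorem primrec_snd {f : α → β × γ} (hf : Primrec f) : Primrec fun a => (f a).2 :=
  Primrec.snd.comp hf

@[fun_prop] theorem primrec_mk {f : α → β} {g : α → γ} (hf : Primrec f) (hg : Primrec g) :
    Primrec fun a => (f a, g a) := hf.pair hg

@[fun_prop] theorem primrec_some {f : α → β} (hf : Primrec f) : Primrec fun a => some (f a) :=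
  Primrec.option_some.comp hf

@[fun_prop] theorem primrec_succ {f : α → ℕ} (hf : Primrec f) : Primrec fun a => (f a).succ :=
  Primrec.succ.comp hf

@[fun_prop] theorem primrec_add {f g : α → ℕ} (hf : Primrec f) (hg : Primrec g) :
    Primrec fun a => f a + g a := Primrec.nat_add.comp hf hg

@[fun_prop] theorem primrec_sub {f g : α → ℕ} (hf : Primrec f) (hg : Primrec g) :
    Primrec fun a => f a - g a := Primrec.nat_sub.comp hf hg

@[fun_prop] theorem primrec_ite_eq [DecidableEq γ] {f g : α → γ} {h k : α → β} (hf : Primrec f)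
    (hg : Primrec g) (hh : Primrec h) (hk : Primrec k) :
    Primrec fun a => if f a = g a then h a else k a :=
  Primrec.ite (Primrec.eq.comp hf hg) hh hk

@[fun_prop] theorem primrec_ite_lt {f g : α → ℕ} {h k : α → β} (hf : Primrec f)
    (hg : Primrec g) (hh : Primrec h) (hk : Primrec k) :
    Primrec fun a => if f a < g a then h a else k a :=
  Primrec.ite (Primrec.nat_lt.comp hf hg) hh hk

@[fun_prop] theorem primrec_elim {o : α → Option γ} {f : α → β} {g : α → γ → β} (ho : Primrec o)
    (hf : Primrec f) (hg : Primrec fun x : α × γ => g x.1 x.2) :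
    Primrec fun a => (o a).elim (f a) (g a) :=
  (Primrec.option_casesOn ho hf hg).of_eq fun a => by cases o a <;> rfl

@[fun_prop] theorem primrec_bind {o : α → Option γ} {g : α → γ → Option β} (ho : Primrec o)
    (hg : Primrec fun x : α × γ => g x.1 x.2) : Primrec fun a => (o a).bind (g a) :=
  Primrec.option_bind ho hg

@[fun_prop] theorem primrec_option_map {o : α → Option γ} {g : α → γ → β} (ho : Primrec o)
    (hg : Primrec fun x : α × γ => g x.1 x.2) : Primrec fun a => (o a).map (g a) :=
  Primrec.option_map ho hg

@[fun_prop] theorem primrec_getElem? {l : α → List β} {i : α → ℕ} (hl : Primrec l)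
    (hi : Primrec i) : Primrec fun a => (l a)[i a]? :=
  Primrec.list_getElem?.comp hl hi

@[fun_prop] theorem primrec_getD {l : α → List β} {i : α → ℕ} {d : β} (hl : Primrec l)
    (hi : Primrec i) : Primrec fun a => (l a).getD (i a) d :=
  (Primrec.list_getD d).comp hl hi

@[fun_prop] theorem primrec_cons {f : α → β} {l : α → List β} (hf : Primrec f) (hl : Primrec l) :
    Primrec fun a => f a :: l a := Primrec.list_cons.comp hf hl

@[fun_prop] theorem primrec_append {l l' : α → List β} (hl : Primrec l) (hl' : Primrec l') :
    Primrec fun a => l a ++ l' a := Primrec.list_append.comp hl hl'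

@[fun_prop] theorem primrec_length {l : α → List β} (hl : Primrec l) :
    Primrec fun a => (l a).length := Primrec.list_length.comp hl

@[fun_prop] theorem primrec_head? {l : α → List β} (hl : Primrec l) :
    Primrec fun a => (l a).head? := Primrec.list_head?.comp hl

@[fun_prop] theorem primrec_range {f : α → ℕ} (hf : Primrec f) :
    Primrec fun a => List.range (f a) := Primrec.list_range.comp hf

@[fun_prop] theorem primrec_flatten {l : α → List (List β)} (hl : Primrec l) :
    Primrec fun a => (l a).flatten := Primrec.list_flatten.comp hl

@[fun_prop] theorem primrec_list_map {l : α → List γ} {g : α → γ → β} (hl : Primrec l)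
    (hg : Primrec fun x : α × γ => g x.1 x.2) : Primrec fun a => (l a).map (g a) :=
  Primrec.list_map hl hg

@[fun_prop] theorem primrec_flatMap {l : α → List γ} {g : α → γ → List β} (hl : Primrec l)
    (hg : Primrec fun x : α × γ => g x.1 x.2) : Primrec fun a => (l a).flatMap (g a) :=
  Primrec.list_flatMap hl hg

@[fun_prop] theorem primrec_filterMap {l : α → List γ} {g : α → γ → Option β} (hl : Primrec l)
    (hg : Primrec fun x : α × γ => g x.1 x.2) : Primrec fun a => (l a).filterMap (g a) :=
  Primrec.listFilterMap hl hg

@[fun_prop] theorem primrec_idxOf [BEq β] [LawfulBEq β] {f : α → β} {l : α → List β}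
    (hf : Primrec f) (hl : Primrec l) : Primrec fun a => (l a).idxOf (f a) := by
  classical
  exact (Primrec.list_idxOf.comp hf hl).of_eq fun a => by
    congr 1
    exact lawful_beq_subsingleton _ _

@[fun_prop] theorem primrec_and {f g : α → Bool} (hf : Primrec f) (hg : Primrec g) :
    Primrec fun a => f a && g a := Primrec.and.comp hf hg

@[fun_prop] theorem primrec_decide_eq [DecidableEq β] {f g : α → β} (hf : Primrec f)
    (hg : Primrec g) : Primrec fun a => decide (f a = g a) := (Primrec.eq.comp hf hg).decide

@[fun_prop] theorem primrec_decide_mem [DecidableEq β] {f : α → β} {l : α → List β}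
    (hf : Primrec f) (hl : Primrec l) : Primrec fun a => decide (f a ∈ l a) :=
  (Primrec.nat_lt.comp (primrec_idxOf hf hl) (primrec_length hl)).decide.of_eq fun a => by
    simp [List.idxOf_lt_length_iff]

@[fun_prop] theorem primrec_insert [BEq β] [LawfulBEq β] {f : α → β} {l : α → List β}
    (hf : Primrec f) (hl : Primrec l) : Primrec fun a => (l a).insert (f a) := by
  classical
  exact (primrec_ite_eq (primrec_decide_mem hf hl) (primrec_const true) hl
    (primrec_cons hf hl)).of_eq fun a => by by_cases h : f a ∈ l a <;> simp [h]

@[fun_prop] theorem primrec_seqEntry {P : α → Input} {p j : α → ℕ} (hP : Primrec P)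
    (hp : Primrec p) (hj : Primrec j) : Primrec fun a => seqEntry (P a) (p a) (j a) := by
  unfold seqEntry; fun_prop

@[fun_prop] theorem primrec_next {P : α → Input} {p j : α → ℕ} (hP : Primrec P)
    (hp : Primrec p) (hj : Primrec j) : Primrec fun a => next (P a) (p a) (j a) := by
  unfold next; fun_prop

@[fun_prop] theorem primrec_start {P : α → Input} (hP : Primrec P) :
    Primrec fun a => start (P a) := by
  unfold start; fun_prop

@[fun_prop] theorem primrec_endSymbol {P : α → Input} (hP : Primrec P) :
    Primrec fun a => endSymbol (P a) := by
  unfold endSymbol; fun_prop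

@[fun_prop] theorem primrec_block {P : α → Input} {p j : α → ℕ} (hP : Primrec P)
    (hp : Primrec p) (hj : Primrec j) : Primrec fun a => block (P a) (p a) (j a) := by
  unfold block; fun_prop

@[fun_prop] theorem primrec_twoEntry {P : α → Input} {q b : α → ℕ} (hP : Primrec P)
    (hq : Primrec q) (hb : Primrec b) : Primrec fun a => twoEntry (P a) (q a) (b a) := by
  unfold twoEntry; fun_prop

@[fun_prop] theorem primrec_bound {P : α → Input} (hP : Primrec P) :
    Primrec fun a => bound (P a) := by
  unfold bound; fun_prop

@[fun_prop] theorem primrec_alt {G : α → List ℕ} {v : α → ℕ} (hG : Primrec G) (hv : Primrec v) :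
    Primrec fun a => alt (G a) (v a) := by
  unfold alt; fun_prop

@[fun_prop] theorem primrec_candidate {P : α → Input} {p j : α → ℕ} (hP : Primrec P)
    (hp : Primrec p) (hj : Primrec j) : Primrec fun a => candidate (P a) (p a) (j a) := by
  unfold candidate; fun_prop

@[fun_prop] theorem primrec_pull {P : α → Input} {G : α → List ℕ} {j : α → ℕ} (hP : Primrec P)
    (hG : Primrec G) (hj : Primrec j) : Primrec fun a => pull (P a) (G a) (j a) := by
  unfold pull; fun_prop

@[fun_prop] theorem primrec_simulate {P : α → Input} {q p i d : α → ℕ} (hP : Primrec P)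
    (hq : Primrec q) (hp : Primrec p) (hi : Primrec i) (hd : Primrec d) :
    Primrec fun a => simulate (P a) (q a) (p a) (i a) (d a) := by
  unfold simulate; fun_prop

@[fun_prop] theorem primrec_enterRight {P : α → Input} {q p j : α → ℕ} (hP : Primrec P)
    (hq : Primrec q) (hp : Primrec p) (hj : Primrec j) :
    Primrec fun a => enterRight (P a) (q a) (p a) (j a) := by
  unfold enterRight; fun_prop

@[fun_prop] theorem primrec_stepSimulate {P : α → Input} {q p i j : α → ℕ} (hP : Primrec P)
    (hq : Primrec q) (hp : Primrec p) (hi : Primrec i) (hj : Primrec j) :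
    Primrec fun a => stepSimulate (P a) (q a) (p a) (i a) (j a) := by
  unfold stepSimulate; fun_prop

@[fun_prop] theorem primrec_stepRetreat {P : α → Input} {q p j : α → ℕ} (hP : Primrec P)
    (hq : Primrec q) (hp : Primrec p) (hj : Primrec j) :
    Primrec fun a => stepRetreat (P a) (q a) (p a) (j a) := by
  unfold stepRetreat; fun_prop

@[fun_prop] theorem primrec_turn {q : α → ℕ} {G : α → List ℕ} {s₁ v : α → ℕ} (hq : Primrec q)
    (hG : Primrec G) (hs : Primrec s₁) (hv : Primrec v) :
    Primrec fun a => turn (q a) (G a) (s₁ a) (v a) := by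
  unfold turn; fun_prop

@[fun_prop] theorem primrec_stepSearch {P : α → Input} {q : α → ℕ} {G : α → List ℕ} {j : α → ℕ}
    (hP : Primrec P) (hq : Primrec q) (hG : Primrec G) (hj : Primrec j) :
    Primrec fun a => stepSearch (P a) (q a) (G a) (j a) := by
  unfold stepSearch; fun_prop

@[fun_prop] theorem primrec_stepBack {P : α → Input} {q s₁ s₂ j : α → ℕ} (hP : Primrec P)
    (hq : Primrec q) (h₁ : Primrec s₁) (h₂ : Primrec s₂) (hj : Primrec j) :
    Primrec fun a => stepBack (P a) (q a) (s₁ a) (s₂ a) (j a) := by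
  unfold stepBack; fun_prop

@[fun_prop] theorem primrec_step {P : α → Input} {x : α → State} {j : α → ℕ}
    (hP : Primrec P) (hx : Primrec x) (hj : Primrec j) :
    Primrec fun a => step (P a) (x a) (j a) := by
  unfold step; fun_prop

@[fun_prop] theorem primrec_prod {P : α → Input} {x : α → State} {j : α → ℕ}
    (hP : Primrec P) (hx : Primrec x) (hj : Primrec j) :
    Primrec fun a => prod (P a) (x a) (j a) := by
  unfold prod; fun_prop

@[fun_prop] theorem primrec_isFinal {P : α → Input} {x : α → State} (hP : Primrec P)
    (hx : Primrec x) : Primrec fun a => isFinal (P a) (x a) := by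
  unfold isFinal; fun_prop

@[fun_prop] theorem primrec_words {v k : α → ℕ} (hv : Primrec v) (hk : Primrec k) :
    Primrec fun a => words (v a) (k a) := by
  unfold words
  refine Primrec.nat_rec' (h := fun a (x : ℕ × List (List ℕ)) =>
    x.2.flatMap fun l => (List.range (v a)).map fun a => a :: l) hk (primrec_const [[]]) ?_
  unfold Primrec₂
  fun_prop

@[fun_prop] theorem primrec_allStates {P : α → Input} (hP : Primrec P) :
    Primrec fun a => allStates (P a) := by
  unfold allStates; fun_prop

@[fun_prop] theorem primrec_states {P : α → Input} (hP : Primrec P) :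
    Primrec fun a => states (P a) := by
  unfold states
  have h : Primrec fun x : α × State × List State => List.insert x.2.1 x.2.2 :=
    primrec_insert (primrec_fst (primrec_snd primrec_id)) (primrec_snd (primrec_snd primrec_id))
  exact Primrec.list_foldr (primrec_allStates hP) (primrec_const []) h.to₂

@[fun_prop] theorem primrec_row {P : α → Input} {x : α → State} (hP : Primrec P)
    (hx : Primrec x) : Primrec fun a => row (P a) (x a) := by
  unfold row; fun_prop

@[fun_prop] theorem primrec_finals {P : α → Input} (hP : Primrec P) :
    Primrec fun a => finals (P a) := by
  unfold finals; fun_prop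

end Rules

theorem primrec_build : Primrec build := by
  unfold build
  have h : Primrec fun P : Input => (states P).map (row P) := by fun_prop
  have h' : Primrec fun P : Input => (states P).idxOf (0, P.2.2.2.1, [start P, 1]) :=
    primrec_idxOf (by fun_prop) (by fun_prop)
  exact primrec_mk (by fun_prop) (primrec_mk h (primrec_mk h' (by fun_prop)))

end CompCode

/-! ### The completion of a sequential transducer -/

namespace SequentialTransducer

variable {Q A B : Type*} (T : SequentialTransducer Q A B)

/-- The completion of a sequential transducer, with a sink `none` that produces nothing. -/
def complete : TotalTransducer (Option Q) A B where
  δ o s := o.bind fun p => T.δ p s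
  γ o s := o.elim [] fun p => T.γ p s
  start := some T.start
  accept := T.accept.map Function.Embedding.some

theorem complete_run_none (t : List (TapeSymbol A)) : T.complete.run none t = none := by
  induction t with
  | nil => rfl
  | cons s t ih => exact ih

theorem exists_run_iff {p q : Q} {t : List (TapeSymbol A)} :
    (∃ v, T.Run p t q v) ↔ T.complete.run (some p) t = some q := by
  induction t generalizing p with
  | nil =>
    constructor
    · rintro ⟨v, h⟩
      cases h
      rfl
    · intro h
      cases h
      exact ⟨_, .nil _⟩
  | cons s t ih =>
    rw [TotalTransducer.run_cons]
    change _ ↔ T.complete.run (T.δ p s) t = some q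
    constructor
    · rintro ⟨v, h⟩
      cases h with
      | cons _ p' _ _ _ v hd h => rw [hd, ← ih]; exact ⟨v, h⟩
    · intro h
      cases hd : T.δ p s with
      | none => rw [hd, complete_run_none] at h; cases h
      | some p' =>
        rw [hd, ← ih] at h
        obtain ⟨v, h⟩ := h
        exact ⟨_, .cons p p' q s t v hd h⟩

/-- The output of a run over `u ⊣`. -/
theorem Run.eq_outWord {p q : Q} {u : List A} {v : List B}
    (h : T.Run p (u.map .letter ++ [.rightEnd]) q v) :
    v = T.complete.outWord (some p) u ++
      T.complete.γ (T.complete.runWord (some p) u) .rightEnd := by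
  induction u generalizing p v with
  | nil =>
    cases h with
    | cons _ p' _ _ _ v hd h =>
      cases h
      exact List.append_nil _
  | cons a u ih =>
    cases h with
    | cons _ p' _ _ _ v hd h =>
      have hd' : T.complete.δ (some p) (.letter a) = some p' := hd
      rw [ih h]
      simp only [TotalTransducer.outWord, TotalTransducer.runWord, List.map_cons,
        TotalTransducer.run_cons, hd', List.append_assoc]
      rfl

theorem produces_iff_complete {u : List A} {v : List B} :
    T.Produces u v ↔ T.complete.run T.complete.start (markedWord u) ∈ T.complete.accept ∧
      v = T.complete.output u := by
  have hout : ∀ {q v}, T.Run T.start (markedWord u) q v → v = T.complete.output u := by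
    intro q v h
    cases h with
    | cons _ p' _ _ _ v hd h =>
      have hd' : T.complete.δ T.complete.start .leftEnd = some p' := hd
      rw [Run.eq_outWord T h, TotalTransducer.output, hd']
      rfl
  constructor
  · rintro ⟨q, hq, h⟩
    refine ⟨?_, hout h⟩
    have : T.complete.run T.complete.start (markedWord u) = some q := (T.exists_run_iff).1 ⟨v, h⟩
    rw [this]
    exact Finset.mem_map_of_mem _ hq
  · rintro ⟨h, rfl⟩
    obtain ⟨q, hq, h⟩ := Finset.mem_map.1 h
    obtain ⟨v, hv⟩ := (T.exists_run_iff).2 h.symm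
    rw [← hout hv]
    exact ⟨q, hq, hv⟩

open TwoWayAutomaton in
/-- In the completion of an aperiodic sequential transducer, the states reached by the powers of a
word become constant. -/
theorem complete_runWord_wordPow (h : T.IsAperiodic) :
    ∃ N, ∀ (w : List A) (p : Option Q),
      T.complete.runWord (T.complete.runWord p (wordPow w N)) w =
        T.complete.runWord p (wordPow w N) := by
  obtain ⟨N, hN⟩ := h
  refine ⟨N, fun w p => ?_⟩
  cases p with
  | none => simp [complete_run_none]
  | some p =>
    have hx := hN ((FreeMonoid.ofList w : FreeMonoid A) : T.TransitionMonoid)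
    rw [← Con.coe_mk', ← map_pow T.transitionCon.mk', ← map_pow T.transitionCon.mk'] at hx
    have hb : T.behavior _ = T.behavior _ := (Con.eq _).1 hx
    rw [toList_pow, toList_pow, wordPow_succ', FreeMonoid.toList_ofList] at hb
    rw [← TotalTransducer.runWord_append]
    ext q
    have := Set.ext_iff.1 hb (p, q)
    simp only [behavior, Set.mem_ofPred_eq, exists_run_iff] at this
    exact this.symm

end SequentialTransducer

/-! ### Renaming the states of a two-way transducer -/

namespace TwoWayTransducer

variable {Q Q' A B : Type*} (T : TwoWayTransducer Q A B) (e : Q ≃ Q')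

/-- The two-way transducer with the states renamed by `e`. -/
def relabel : TwoWayTransducer Q' A B where
  δ p s := (T.δ (e.symm p) s).map fun t => (e t.1, t.2)
  δ_leftEnd p q h := by
    obtain ⟨t, ht, h⟩ := Option.map_eq_some_iff.1 h
    exact T.δ_leftEnd _ t.1 (by rw [ht, ← (Prod.mk.inj h).2])
  δ_rightEnd p q h := by
    obtain ⟨t, ht, h⟩ := Option.map_eq_some_iff.1 h
    exact T.δ_rightEnd _ t.1 (by rw [ht, ← (Prod.mk.inj h).2])
  start := e T.start
  accept := T.accept.map e.toEmbedding
  γ p s := T.γ (e.symm p) s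

theorem relabel_δ_eq_some {p q : Q'} {s : TapeSymbol A} {d : HeadMove} :
    (T.relabel e).δ p s = some (q, d) ↔ T.δ (e.symm p) s = some (e.symm q, d) := by
  simp only [relabel, Option.map_eq_some_iff, Prod.mk.injEq, Prod.exists]
  constructor
  · rintro ⟨q', d', h, rfl, rfl⟩
    rw [h, e.symm_apply_apply]
  · intro h
    exact ⟨_, _, h, e.apply_symm_apply q, rfl⟩

theorem relabel_accepting {u : List A} {p : Q'} {m : ℕ} :
    (T.relabel e).Accepting u p m ↔ T.Accepting u (e.symm p) m := by
  simp [Accepting, relabel]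

theorem relabel_produces {u : List A} {p : Q'} {m : ℕ} {v : List B} :
    (T.relabel e).Produces u p m v ↔ T.Produces u (e.symm p) m v := by
  constructor
  · intro h
    induction h with
    | halt p m h => exact .halt _ _ ((T.relabel_accepting e).1 h)
    | step p q m s d v h hs hd _ ih =>
      exact .step _ _ m s d v (fun h' => h ((T.relabel_accepting e).2 h')) hs
        ((T.relabel_δ_eq_some e).1 hd) ih
  · intro h
    generalize hq : e.symm p = q at h
    induction h generalizing p with
    | halt q m h =>
      subst hq
      exact .halt _ _ ((T.relabel_accepting e).2 h)
    | step q q' m s d v h hs hd _ ih =>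
      subst hq
      exact .step (T := T.relabel e) p (e q') m s d v
        (fun h' => h ((T.relabel_accepting e).1 h')) hs
        ((T.relabel_δ_eq_some e).2 (by rw [hd, e.symm_apply_apply])) (ih (e.symm_apply_apply q'))

theorem relabel_behavior {w : List A} {x y : WordEnd} {p q : Q'} :
    (p, q) ∈ (T.relabel e).behavior w x y ↔ (e.symm p, e.symm q) ∈ T.behavior w x y := by
  constructor
  · intro h
    refine Relation.ReflTransGen.lift (fun c : Q' × ℕ => (e.symm c.1, c.2)) ?_ _ _ h
    rintro c d ⟨s, m, h1, h2, h3⟩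
    exact ⟨s, m, h1, (T.relabel_δ_eq_some e).1 h2, h3⟩
  · intro h
    have := Relation.ReflTransGen.lift (p := (T.relabel e).FactorStep w)
      (fun c : Q × ℕ => (e c.1, c.2)) ?_ _ _ h
    · simp only [Function.onFun, e.apply_symm_apply] at this
      exact this
    rintro c d ⟨s, m, h1, h2, h3⟩
    exact ⟨s, m, h1, (T.relabel_δ_eq_some e).2 (by simpa using h2), h3⟩

theorem relabel_isAperiodic (h : T.IsAperiodic) : (T.relabel e).IsAperiodic := by
  have : (T.relabel e).transitionCon = T.transitionCon := by
    refine Con.ext fun w z => ?_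
    refine forall₂_congr fun x y => ?_
    constructor
    · intro h
      ext ⟨p, q⟩
      have := Set.ext_iff.1 h (e p, e q)
      rwa [relabel_behavior, relabel_behavior, e.symm_apply_apply, e.symm_apply_apply] at this
    · intro h
      ext ⟨p, q⟩
      rw [relabel_behavior, relabel_behavior, h]
  unfold IsAperiodic TwoWayAutomaton.TransitionMonoid
  rw [this]
  exact h

end TwoWayTransducer

/-! ### The described machine is the composite machine -/

namespace CompCode

/-- The number of a symbol. -/
def symbol {k : ℕ} : TapeSymbol (Fin k) → ℕ
  | .leftEnd => 0
  | .letter i => i.val + 1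
  | .rightEnd => k + 1

/-- The number of a state of the completed sequential machine. -/
def num {n : ℕ} (p : Option (Fin n)) : ℕ := p.elim 0 fun i => i.val + 1

/-- The number of a candidate. -/
def optNum {n : ℕ} (v : Option (Option (Fin n))) : ℕ := v.elim 0 fun p => num p + 1

/-- The states of the completed sequential machine in the order of their numbers. -/
def enum (n : ℕ) : List (Option (Fin n)) := none :: (List.finRange n).map some

/-- The list of the values of a candidate function. -/
def values {n : ℕ} (g : Option (Fin n) → Option (Option (Fin n))) : List ℕ :=
  (enum n).map fun s => optNum (g s)

section Numbers

variable {n k : ℕ}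

theorem getElem?_symbol (s : TapeSymbol (Fin k)) :
    (markedWord (List.finRange k))[symbol s]? = some s := by
  cases s with
  | leftEnd => rfl
  | letter i => simp [markedWord, symbol]
  | rightEnd => simp [markedWord, symbol]

theorem map_symbol : (markedWord (List.finRange k)).map symbol = List.range (k + 2) := by
  refine List.ext_getElem? fun j => ?_
  rw [List.getElem?_map]
  rcases Nat.lt_trichotomy j (k + 1) with h | rfl | h
  · cases j with
    | zero => simp [markedWord, symbol]
    | succ j =>
      have := getElem?_symbol (TapeSymbol.letter (⟨j, by omega⟩ : Fin k))
      simp only [symbol] at this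
      rw [this, List.getElem?_range (by omega)]
      rfl
  · have := getElem?_symbol (TapeSymbol.rightEnd : TapeSymbol (Fin k))
    simp only [symbol] at this
    rw [this, List.getElem?_range (by omega)]
    rfl
  · rw [List.getElem?_eq_none (by simp [markedWord]; omega), List.getElem?_eq_none (by simp; omega)]
    rfl

theorem symbol_leftEnd : symbol (.leftEnd : TapeSymbol (Fin k)) = 0 := rfl

theorem symbol_rightEnd : symbol (.rightEnd : TapeSymbol (Fin k)) = k + 1 := rfl

theorem symbol_rightEnd_ne_zero : symbol (.rightEnd : TapeSymbol (Fin k)) ≠ 0 := Nat.succ_ne_zero _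

theorem symbol_letter_ne_zero (i : Fin k) : symbol (.letter i) ≠ 0 := Nat.succ_ne_zero _

theorem symbol_letter_ne_end (i : Fin k) : symbol (.letter i) ≠ k + 1 :=
  fun h => i.2.ne (Nat.succ.inj h)

theorem num_injective : Function.Injective (num (n := n)) := by
  rintro (_ | p) (_ | p') h
  · rfl
  · simp [num] at h
  · simp [num] at h
  · simp only [num, Option.elim] at h
    rw [Fin.ext (Nat.succ.inj h)]

theorem num_lt (p : Option (Fin n)) : num p < n + 1 := by
  cases p with
  | none => simp [num]
  | some p => simp [num]

theorem exists_num {i : ℕ} (h : i < n + 1) : ∃ p : Option (Fin n), num p = i := by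
  cases i with
  | zero => exact ⟨none, rfl⟩
  | succ i => exact ⟨some ⟨i, by omega⟩, rfl⟩

theorem optNum_injective : Function.Injective (optNum (n := n)) := by
  rintro (_ | p) (_ | p') h
  · rfl
  · simp [optNum] at h
  · simp [optNum] at h
  · simp only [optNum, Option.elim] at h
    rw [num_injective (Nat.succ.inj h)]

theorem optNum_eq_zero {v : Option (Option (Fin n))} : optNum v = 0 ↔ v = none := by
  cases v <;> simp [optNum]

theorem optNum_lt (v : Option (Option (Fin n))) : optNum v < n + 2 := by
  cases v with
  | none => simp [optNum]
  | some p => have := num_lt p; simp [optNum]; omega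

theorem exists_optNum {i : ℕ} (h : i < n + 2) : ∃ v : Option (Option (Fin n)), optNum v = i := by
  cases i with
  | zero => exact ⟨none, rfl⟩
  | succ i =>
    obtain ⟨p, hp⟩ := exists_num (n := n) (i := i) (by omega)
    exact ⟨some p, by simp [optNum, hp]⟩

theorem mem_enum (p : Option (Fin n)) : p ∈ enum n := by
  cases p <;> simp [enum]

theorem getElem?_enum (p : Option (Fin n)) : (enum n)[num p]? = some p := by
  cases p <;> simp [enum, num]

theorem length_enum : (enum n).length = n + 1 := by simp [enum]

theorem map_num : (enum n).map num = List.range (n + 1) := by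
  refine List.ext_getElem? fun j => ?_
  rw [List.getElem?_map]
  by_cases h : j < n + 1
  · obtain ⟨p, rfl⟩ := exists_num h
    rw [getElem?_enum, List.getElem?_range h]
    rfl
  · rw [List.getElem?_eq_none (by rw [length_enum]; omega), List.getElem?_eq_none (by simp; omega)]
    rfl

theorem length_values (g : Option (Fin n) → Option (Option (Fin n))) :
    (values g).length = n + 1 := by rw [values, List.length_map, length_enum]

theorem getD_values (g : Option (Fin n) → Option (Option (Fin n))) (s : Option (Fin n)) :
    (values g).getD (num s) 0 = optNum (g s) := by
  rw [List.getD_eq_getElem?_getD, values, List.getElem?_map, getElem?_enum]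
  rfl

/-- A function on numbers that agrees with `g` is written as `values g`. -/
theorem map_range (f : ℕ → ℕ) (g : Option (Fin n) → Option (Option (Fin n)))
    (h : ∀ s, f (num s) = optNum (g s)) : (List.range (n + 1)).map f = values g := by
  rw [← map_num, List.map_map]
  exact List.map_congr_left fun s _ => h s

theorem filterMap_ite {α β : Type*} (l : List α) (p : α → Prop) [DecidablePred p] (f : α → β) :
    (l.filterMap fun a => if p a then some (f a) else none) = (l.filter p).map f := by
  induction l with
  | nil => rfl
  | cons a l ih => by_cases h : p a <;> simp [h, ih]

theorem alt_values (g : Option (Fin n) → Option (Option (Fin n)))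
    (v : Option (Option (Fin n))) :
    alt (values g) (optNum v) = (altState (enum n) g v).map num := by
  rw [alt, length_values, ← map_num, List.filterMap_map, altState, ← List.head?_map,
    ← filterMap_ite]
  congr 2
  funext s
  simp only [Function.comp, getD_values, optNum_eq_zero, optNum_injective.eq_iff]
  by_cases h : g s = none <;> by_cases h' : g s = v <;> simp [h, h']

theorem alt_values_zero (g : Option (Fin n) → Option (Option (Fin n))) :
    alt (values g) 0 = (altState (enum n) g none).map num := alt_values g none

end Numbers

variable {n m a b c : ℕ} (𝒜 : SequentialTransducer (Fin n) (Fin a) (Fin b))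
  (ℬ : TwoWayTransducer (Fin m) (Fin b) (Fin c))

/-- The data of the composite machine. -/
def data : CompData (Option (Fin n)) (Fin m) (Fin a) (Fin b) (Fin c) where
  seq := 𝒜.complete
  two := ℬ
  enum := enum n
  K := bound (𝒜.code, ℬ.code)

theorem seqEntry_num (p : Option (Fin n)) (s : TapeSymbol (Fin a)) :
    seqEntry (𝒜.code, ℬ.code) (num p) (symbol s) =
      p.elim (none, []) fun p => ((𝒜.δ p s).map Fin.val, (𝒜.γ p s).map Fin.val) := by
  cases p with
  | none => simp [seqEntry, num]
  | some p =>
    simp [seqEntry, num, SequentialTransducer.code, List.getD_eq_getElem?_getD, getElem?_symbol]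

theorem next_num (p : Option (Fin n)) (s : TapeSymbol (Fin a)) :
    next (𝒜.code, ℬ.code) (num p) (symbol s) = num (𝒜.complete.δ p s) := by
  rw [next, seqEntry_num]
  cases p with
  | none => rfl
  | some p =>
    change _ = num (𝒜.δ p s)
    cases h : 𝒜.δ p s <;> simp [h, num]

theorem start_eq : start (𝒜.code, ℬ.code) = num 𝒜.complete.start := rfl

theorem endSymbol_eq : endSymbol (𝒜.code, ℬ.code) = a + 1 := rfl

theorem seqEntry_snd (p : Option (Fin n)) (s : TapeSymbol (Fin a)) :
    (seqEntry (𝒜.code, ℬ.code) (num p) (symbol s)).2 = (𝒜.complete.γ p s).map Fin.val := by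
  rw [seqEntry_num]
  cases p <;> rfl

theorem block_num (p : Option (Fin n)) (s : TapeSymbol (Fin a)) :
    block (𝒜.code, ℬ.code) (num p) (symbol s) = (𝒜.complete.block p s).map symbol := by
  rw [block, seqEntry_snd, endSymbol_eq]
  cases s with
  | leftEnd => simp [TotalTransducer.block, symbol]
  | letter x =>
    rw [if_neg (symbol_letter_ne_zero x), if_neg (symbol_letter_ne_end x)]
    simp [TotalTransducer.block, symbol]
  | rightEnd => simp [TotalTransducer.block, symbol, SequentialTransducer.code]

theorem twoEntry_eq (q : Fin m) (s : TapeSymbol (Fin b)) :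
    twoEntry (𝒜.code, ℬ.code) q.val (symbol s) =
      ((ℬ.δ q s).map (fun t => (t.1.val, t.2.code)), (ℬ.γ q s).map Fin.val) := by
  simp [twoEntry, TwoWayTransducer.code, List.getD_eq_getElem?_getD, getElem?_symbol]

/-- All productions occur in the table of the sequential machine, so their lengths are bounded by
the total length. -/
theorem length_γ_le (p : Option (Fin n)) (s : TapeSymbol (Fin a)) :
    (𝒜.complete.γ p s).length + 3 ≤ bound (𝒜.code, ℬ.code) := by
  cases p with
  | none => simp [bound, SequentialTransducer.complete]
  | some p =>
    refine Nat.add_le_add_right ?_ 3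
    have h1 : (𝒜.γ p s).map Fin.val ∈ (𝒜.code.2.1.flatten.map Prod.snd) := by
      refine List.mem_map.2 ⟨((𝒜.δ p s).map Fin.val, (𝒜.γ p s).map Fin.val), ?_, rfl⟩
      refine List.mem_flatten.2 ⟨_, List.mem_map.2 ⟨p, List.mem_finRange p, rfl⟩, ?_⟩
      exact List.mem_map.2 ⟨s, List.mem_of_getElem? (getElem?_symbol s), rfl⟩
    have := (List.sublist_flatten_of_mem h1).length_le
    rw [List.length_map] at this
    rw [List.flatMap_def]
    exact this

theorem length_block_lt (p : Option (Fin n)) (s : TapeSymbol (Fin a)) :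
    ((data 𝒜 ℬ).seq.block p s).length + 1 < (data 𝒜 ℬ).K := by
  have := length_γ_le 𝒜 ℬ p s
  change (𝒜.complete.block p s).length + 1 < bound (𝒜.code, ℬ.code)
  cases s <;> simp only [TotalTransducer.block, List.length_cons, List.length_map,
    List.length_append, List.length_nil] <;> omega

/-- The description of a state of the composite machine. -/
def state {K : ℕ} : CompState (Option (Fin n)) (Fin m) K → State
  | .simulate q p i => (0, q.val, [num p, i.val])
  | .retreat q p => (1, q.val, [num p])
  | .search q g => (2, q.val, values g)
  | .back q s₁ s₂ => (3, q.val, [num s₁, num s₂])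

theorem state_injective {K : ℕ} :
    Function.Injective (state : CompState (Option (Fin n)) (Fin m) K → State) := by
  intro x y h
  cases x <;> cases y <;> simp only [state, Prod.mk.injEq, List.cons.injEq] at h
  all_goals try omega
  · obtain ⟨-, h1, h2, h3, -⟩ := h
    rw [Fin.ext h1, num_injective h2, Fin.ext h3]
  · obtain ⟨-, h1, h2, -⟩ := h
    rw [Fin.ext h1, num_injective h2]
  · rename_i q g q' g'
    obtain ⟨-, h1, h2⟩ := h
    have : g = g' := by
      funext s
      apply optNum_injective
      rw [← getD_values, ← getD_values, h2]
    rw [Fin.ext h1, this]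
  · obtain ⟨-, h1, h2, h3, -⟩ := h
    rw [Fin.ext h1, num_injective h2, num_injective h3]

/-- The description of a new state and a move. -/
def target {K : ℕ} (t : CompState (Option (Fin n)) (Fin m) K × HeadMove) : State × ℕ :=
  (state t.1, t.2.code)

theorem simulate_eq (q : Fin m) (p : Option (Fin n)) (i : ℕ) (d : HeadMove) :
    simulate (𝒜.code, ℬ.code) q.val (num p) i d.code =
      ((CompState.mkSimulate (data 𝒜 ℬ).K q p i).map (·, d)).map target := by
  unfold simulate CompState.mkSimulate
  change (if i < (data 𝒜 ℬ).K then _ else _) = _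
  split <;> rfl

theorem enterRight_eq (q : Fin m) (p : Option (Fin n)) (s : TapeSymbol (Fin a)) :
    enterRight (𝒜.code, ℬ.code) q.val (num p) (symbol s) =
      ((data 𝒜 ℬ).enterRight q p s).map target := by
  rw [enterRight, block_num, List.length_map]
  exact simulate_eq 𝒜 ℬ q p _ .stay

theorem candidate_eq (p : Option (Fin n)) (s : TapeSymbol (Fin a)) :
    candidate (𝒜.code, ℬ.code) (num p) (symbol s) = values ((data 𝒜 ℬ).candidate p s) := by
  refine map_range (n := n) _ _ fun r => ?_
  rw [next_num, if_congr num_injective.eq_iff rfl rfl, CompData.candidate]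
  change _ = optNum (if 𝒜.complete.δ r s = p then some r else none)
  split <;> rfl

theorem pull_eq (g : Option (Fin n) → Option (Option (Fin n))) (s : TapeSymbol (Fin a)) :
    pull (𝒜.code, ℬ.code) (values g) (symbol s) =
      values (fun r => g ((data 𝒜 ℬ).seq.δ r s)) := by
  refine map_range (n := n) _ _ fun r => ?_
  rw [next_num, getD_values]
  rfl

theorem stepSimulate_eq (q : Fin m) (p : Option (Fin n)) (i : ℕ) (s : TapeSymbol (Fin a)) :
    stepSimulate (𝒜.code, ℬ.code) q.val (num p) i (symbol s) =
      ((data 𝒜 ℬ).stepSimulate q p i s).map target := by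
  unfold stepSimulate CompData.stepSimulate
  rw [block_num, endSymbol_eq, next_num]
  by_cases hi : i = 0
  · rw [if_pos hi, if_pos hi]
    cases s with
    | leftEnd => rfl
    | letter x => rw [if_neg (symbol_letter_ne_zero x)]; rfl
    | rightEnd => rfl
  rw [if_neg hi, if_neg hi, List.getElem?_map, List.length_map]
  rw [show (data 𝒜 ℬ).seq = 𝒜.complete from rfl]
  cases hb : (𝒜.complete.block p s)[i - 1]? with
  | some x =>
    simp only [Option.map_some, Option.elim_some, twoEntry_eq]
    change _ = Option.map target ((ℬ.δ q x).bind _)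
    cases ℬ.δ q x with
    | none => rfl
    | some t =>
      simp only [Option.map_some, Option.bind_some]
      have : i + t.2.code - 1 = t.2.apply i := by
        cases t.2 <;> simp [HeadMove.code, HeadMove.apply]
      rw [this]
      exact simulate_eq 𝒜 ℬ t.1 p _ .stay
  | none =>
    simp only [Option.map_none, Option.elim_none]
    split
    · cases s with
      | rightEnd => rw [if_pos symbol_rightEnd]; rfl
      | leftEnd => exact simulate_eq 𝒜 ℬ q _ 1 .right
      | letter x =>
        rw [if_neg (symbol_letter_ne_end x)]
        exact simulate_eq 𝒜 ℬ q _ 1 .right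
    · rfl

theorem stepRetreat_eq (q : Fin m) (p : Option (Fin n)) (s : TapeSymbol (Fin a)) :
    stepRetreat (𝒜.code, ℬ.code) q.val (num p) (symbol s) =
      ((data 𝒜 ℬ).stepRetreat q p s).map target := by
  unfold stepRetreat CompData.stepRetreat
  rw [start_eq, next_num, enterRight_eq, if_congr num_injective.eq_iff rfl rfl,
    candidate_eq, endSymbol_eq]
  cases s with
  | leftEnd =>
    rw [if_pos symbol_leftEnd]
    change (if 𝒜.complete.δ 𝒜.complete.start .leftEnd = p then _ else _) =
      Option.map target (if 𝒜.complete.δ 𝒜.complete.start .leftEnd = p then _ else _)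
    split <;> rfl
  | rightEnd => rw [if_neg symbol_rightEnd_ne_zero, if_pos symbol_rightEnd]; rfl
  | letter x =>
    rw [if_neg (symbol_letter_ne_zero x), if_neg (symbol_letter_ne_end x)]
    rw [alt_values_zero]
    simp only [show (data 𝒜 ℬ).enum = enum n from rfl]
    cases altState (enum n) ((data 𝒜 ℬ).candidate p (.letter x)) none with
    | none => rfl
    | some r =>
      simp only [Option.map_some, Option.bind_some]
      rw [show num r + 1 = optNum (some r) from rfl, alt_values, enterRight_eq]
      cases altState (enum n) ((data 𝒜 ℬ).candidate p (.letter x)) (some r) <;> rfl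

theorem turn_eq (q : Fin m) (g : Option (Fin n) → Option (Option (Fin n))) (s₁ : Option (Fin n))
    (v : Option (Option (Fin n))) :
    turn q.val (values g) (num s₁) (optNum v) =
      ((altState (enum n) g v).map fun s₂ =>
        ((.back q s₁ s₂, .right) : CompState (Option (Fin n)) (Fin m) (data 𝒜 ℬ).K × HeadMove)).map
          target := by
  rw [turn, alt_values]
  cases altState (enum n) g v <;> rfl

theorem stepSearch_eq (q : Fin m) (g : Option (Fin n) → Option (Option (Fin n)))
    (s : TapeSymbol (Fin a)) :
    stepSearch (𝒜.code, ℬ.code) q.val (values g) (symbol s) =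
      ((data 𝒜 ℬ).stepSearch q g s).map target := by
  unfold stepSearch CompData.stepSearch
  rw [start_eq, next_num, pull_eq, endSymbol_eq, getD_values,
    turn_eq 𝒜 ℬ, if_congr optNum_eq_zero rfl rfl]
  cases s with
  | leftEnd =>
    rw [if_pos symbol_leftEnd]
    change (if g (𝒜.complete.δ 𝒜.complete.start .leftEnd) = none then _ else _) =
      Option.map target (if g (𝒜.complete.δ 𝒜.complete.start .leftEnd) = none then _ else _)
    split <;> rfl
  | rightEnd => rw [if_neg symbol_rightEnd_ne_zero, if_pos symbol_rightEnd]; rfl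
  | letter x =>
    rw [if_neg (symbol_letter_ne_zero x), if_neg (symbol_letter_ne_end x)]
    rw [alt_values_zero]
    simp only [show (data 𝒜 ℬ).enum = enum n from rfl, show (data 𝒜 ℬ).seq = 𝒜.complete from rfl]
    cases altState (enum n) (fun r => g (𝒜.complete.δ r (.letter x))) none with
    | none => rfl
    | some r =>
      simp only [Option.map_some, Option.bind_some]
      rw [next_num, getD_values, alt_values, turn_eq 𝒜 ℬ]
      cases altState (enum n) (fun r => g (𝒜.complete.δ r (.letter x)))
          (g (𝒜.complete.δ r (.letter x))) <;> rfl

theorem stepBack_eq (q : Fin m) (s₁ s₂ : Option (Fin n)) (s : TapeSymbol (Fin a)) :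
    stepBack (𝒜.code, ℬ.code) q.val (num s₁) (num s₂) (symbol s) =
      ((data 𝒜 ℬ).stepBack q s₁ s₂ s).map target := by
  unfold stepBack CompData.stepBack
  rw [next_num, next_num, enterRight_eq, if_congr num_injective.eq_iff rfl rfl, endSymbol_eq]
  cases s with
  | leftEnd => rfl
  | rightEnd => rw [if_neg symbol_rightEnd_ne_zero, if_pos symbol_rightEnd]; rfl
  | letter x =>
    rw [if_neg (symbol_letter_ne_zero x), if_neg (symbol_letter_ne_end x)]
    change (if 𝒜.complete.δ s₁ (.letter x) = 𝒜.complete.δ s₂ (.letter x) then _ else _) =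
      Option.map target (if 𝒜.complete.δ s₁ (.letter x) = 𝒜.complete.δ s₂ (.letter x) then _ else _)
    split <;> rfl

theorem step_eq (x : CompState (Option (Fin n)) (Fin m) (data 𝒜 ℬ).K) (s : TapeSymbol (Fin a)) :
    step (𝒜.code, ℬ.code) (state x) (symbol s) = ((data 𝒜 ℬ).step x s).map target := by
  cases x with
  | simulate q p i => exact stepSimulate_eq 𝒜 ℬ q p i.val s
  | retreat q p => exact stepRetreat_eq 𝒜 ℬ q p s
  | search q g => exact stepSearch_eq 𝒜 ℬ q g s
  | back q s₁ s₂ => exact stepBack_eq 𝒜 ℬ q s₁ s₂ s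

theorem prod_eq (x : CompState (Option (Fin n)) (Fin m) (data 𝒜 ℬ).K) (s : TapeSymbol (Fin a)) :
    prod (𝒜.code, ℬ.code) (state x) (symbol s) = ((data 𝒜 ℬ).prod x s).map Fin.val := by
  cases x with
  | simulate q p i =>
    simp only [prod, state, CompData.prod, if_true, List.getD_cons_zero, List.getD_cons_succ,
      block_num, List.getElem?_map, show (data 𝒜 ℬ).seq = 𝒜.complete from rfl,
      show (data 𝒜 ℬ).two = ℬ from rfl]
    split
    · rfl
    · cases (𝒜.complete.block p s)[i.val - 1]? with
      | none => rfl
      | some b => simp [twoEntry_eq]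
  | retreat q p => rfl
  | search q g => rfl
  | back q s₁ s₂ => rfl

theorem isFinal_iff (x : CompState (Option (Fin n)) (Fin m) (data 𝒜 ℬ).K) :
    isFinal (𝒜.code, ℬ.code) (state x) = true ↔ (data 𝒜 ℬ).IsFinal x := by
  cases x with
  | simulate q p i =>
    have h1 : q.val ∈ ℬ.code.2.2.2 ↔ q ∈ ℬ.accept := by
      simp [TwoWayTransducer.code, Fin.val_inj]
    have h2 : ∀ r : Option (Fin n), num r ∈ 𝒜.code.2.2.2.map Nat.succ ↔ r ∈ 𝒜.complete.accept := by
      intro r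
      cases r with
      | none => simp [num, SequentialTransducer.complete]
      | some r => simp [num, SequentialTransducer.complete, SequentialTransducer.code, Fin.val_inj]
    have h3 := next_num 𝒜 ℬ p .rightEnd
    have h4 := seqEntry_snd 𝒜 ℬ p .rightEnd
    simp only [isFinal, Bool.and_eq_true, decide_eq_true_eq]
    change 0 = 0 ∧ q.val ∈ ℬ.code.2.2.2 ∧
      next (𝒜.code, ℬ.code) (num p) (symbol (.rightEnd : TapeSymbol (Fin a))) ∈
        𝒜.code.2.2.2.map Nat.succ ∧
      i.val = (seqEntry (𝒜.code, ℬ.code) (num p)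
        (symbol (.rightEnd : TapeSymbol (Fin a)))).2.length + 1 ↔ _
    rw [h3, h4, h1, h2, List.length_map]
    exact and_iff_right rfl
  | retreat q p => simp [isFinal, state, CompData.IsFinal]
  | search q g => simp [isFinal, state, CompData.IsFinal]
  | back q s₁ s₂ => simp [isFinal, state, CompData.IsFinal]

theorem mem_words {v k : ℕ} {l : List ℕ} :
    l ∈ words v k ↔ l.length = k ∧ ∀ x ∈ l, x < v := by
  induction k generalizing l with
  | zero =>
    change l ∈ [[]] ↔ _
    cases l <;> simp
  | succ k ih =>
    change l ∈ (words v k).flatMap (fun l => (List.range v).map fun a => a :: l) ↔ _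
    cases l with
    | nil => simp
    | cons x l => simp [ih]; tauto

theorem nodup_states (P : Input) : (states P).Nodup := by
  unfold states
  induction allStates P with
  | nil => exact List.nodup_nil
  | cons x l ih => exact ih.insert

theorem mem_states_iff_mem_allStates (P : Input) (x : State) : x ∈ states P ↔ x ∈ allStates P := by
  unfold states
  induction allStates P with
  | nil => rfl
  | cons y l ih => simp [ih]

theorem mem_states {x : State} : x ∈ states (𝒜.code, ℬ.code) ↔
    ∃ c : CompState (Option (Fin n)) (Fin m) (data 𝒜 ℬ).K, state c = x := by
  rw [mem_states_iff_mem_allStates]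
  simp only [allStates, List.mem_flatMap, List.mem_range, List.mem_append, List.mem_cons,
    List.mem_map, mem_words]
  constructor
  · rintro ⟨q, hq, ⟨p, hp, rfl | ⟨i, hi, rfl⟩ | ⟨s₂, hs, rfl⟩⟩ | ⟨G, ⟨hl, hG⟩, rfl⟩⟩
    · obtain ⟨p, rfl⟩ := exists_num hp
      exact ⟨.retreat ⟨q, hq⟩ p, rfl⟩
    · obtain ⟨p, rfl⟩ := exists_num hp
      exact ⟨.simulate ⟨q, hq⟩ p ⟨i, hi⟩, rfl⟩
    · obtain ⟨p, rfl⟩ := exists_num hp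
      obtain ⟨s₂, rfl⟩ := exists_num hs
      exact ⟨.back ⟨q, hq⟩ p s₂, rfl⟩
    · have h : ∀ s : Option (Fin n), ∃ v : Option (Option (Fin n)),
          optNum v = G.getD (num s) 0 := by
        intro s
        have hs : num s < G.length := by rw [hl]; exact num_lt s
        refine exists_optNum (hG _ ?_)
        rw [List.getD_eq_getElem _ _ hs]
        exact List.getElem_mem hs
      choose g hg using h
      refine ⟨.search ⟨q, hq⟩ g, ?_⟩
      have : values g = G := by
        refine List.ext_getElem (by rw [length_values, hl]; rfl) fun i h1 h2 => ?_
        obtain ⟨s, rfl⟩ := exists_num (n := n) (i := i) (by rwa [length_values] at h1)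
        rw [← List.getD_eq_getElem _ 0 h1, ← List.getD_eq_getElem _ 0 h2, getD_values, hg]
      simp [state, this]
  · rintro ⟨c, rfl⟩
    cases c with
    | simulate q p i => exact ⟨q.val, q.2, .inl ⟨num p, num_lt p, .inr (.inl ⟨i.val, i.2, rfl⟩)⟩⟩
    | retreat q p => exact ⟨q.val, q.2, .inl ⟨num p, num_lt p, .inl rfl⟩⟩
    | search q g =>
      refine ⟨q.val, q.2, .inr ⟨values g, ⟨length_values g, fun x hx => ?_⟩, rfl⟩⟩
      obtain ⟨s, -, rfl⟩ := List.mem_map.1 hx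
      exact optNum_lt _
    | back q s₁ s₂ =>
      exact ⟨q.val, q.2, .inl ⟨num s₁, num_lt s₁, .inr (.inr ⟨num s₂, num_lt s₂, rfl⟩)⟩⟩

/-- The numbering of the states of the composite machine. -/
noncomputable def stateEquiv : CompState (Option (Fin n)) (Fin m) (data 𝒜 ℬ).K ≃
    Fin (states (𝒜.code, ℬ.code)).length :=
  .ofBijective (fun c => ⟨(states (𝒜.code, ℬ.code)).idxOf (state c),
    List.idxOf_lt_length_iff.2 ((mem_states 𝒜 ℬ).2 ⟨c, rfl⟩)⟩) <| by
    constructor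
    · intro c d h
      refine state_injective ((List.idxOf_inj ((mem_states 𝒜 ℬ).2 ⟨c, rfl⟩)).1 (Fin.mk.inj h))
    · intro i
      obtain ⟨c, hc⟩ := (mem_states 𝒜 ℬ).1 (List.getElem_mem i.2)
      exact ⟨c, Fin.ext (by simp only [hc]; exact (nodup_states _).idxOf_getElem _ i.2)⟩

theorem stateEquiv_val (x : CompState (Option (Fin n)) (Fin m) (data 𝒜 ℬ).K) :
    (stateEquiv 𝒜 ℬ x).val = (states (𝒜.code, ℬ.code)).idxOf (state x) := rfl

theorem getElem_states (i : Fin (states (𝒜.code, ℬ.code)).length) :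
    (states (𝒜.code, ℬ.code))[i.val] = state ((stateEquiv 𝒜 ℬ).symm i) := by
  obtain ⟨x, rfl⟩ := (stateEquiv 𝒜 ℬ).surjective i
  simp only [stateEquiv_val, Equiv.symm_apply_apply]
  exact List.getElem_idxOf _

/-- The initial state: the simulated head is on `⊢`, which is the first symbol of the first
block. -/
def initial : CompState (Option (Fin n)) (Fin m) (data 𝒜 ℬ).K :=
  .simulate ℬ.start 𝒜.complete.start ⟨1, by change 1 < bound _; unfold bound; omega⟩

/-- The composite machine with numbered states. -/
noncomputable def composite :
    TwoWayTransducer (Fin (states (𝒜.code, ℬ.code)).length) (Fin a) (Fin c) :=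
  ((data 𝒜 ℬ).machine (initial 𝒜 ℬ)).relabel (stateEquiv 𝒜 ℬ)

theorem code_composite : (composite 𝒜 ℬ).code = build (𝒜.code, ℬ.code) := by
  refine Prod.ext rfl (Prod.ext ?_ (Prod.ext rfl ?_))
  · change (List.finRange _).map (fun p => (markedWord (List.finRange a)).map fun s =>
      (((composite 𝒜 ℬ).δ p s).map (fun t => (t.1.val, t.2.code)),
        ((composite 𝒜 ℬ).γ p s).map Fin.val)) =
      (states (𝒜.code, ℬ.code)).map (row (𝒜.code, ℬ.code))
    refine List.ext_getElem (by simp) fun i h1 h2 => ?_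
    simp only [List.length_map] at h2
    simp only [List.getElem_map, List.getElem_finRange]
    rw [show (states (𝒜.code, ℬ.code))[i] = _ from getElem_states 𝒜 ℬ ⟨i, h2⟩, row]
    change _ = List.map _ (List.range (a + 2))
    rw [← map_symbol, List.map_map]
    refine List.map_congr_left fun s _ => ?_
    simp only [Function.comp, step_eq, prod_eq]
    refine Prod.ext ?_ rfl
    simp only [composite, TwoWayTransducer.relabel, CompData.machine, Option.map_map]
    rfl
  · change ((List.finRange _).filter (fun p => p ∈ (composite 𝒜 ℬ).accept)).map Fin.val =
      finals (𝒜.code, ℬ.code)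
    rw [← filterMap_ite, finals, ← List.map_coe_finRange_eq_range, List.filterMap_map]
    refine List.filterMap_congr fun i _ => ?_
    have h1 : (states (𝒜.code, ℬ.code)).getD i.val (0, 0, []) =
        state ((stateEquiv 𝒜 ℬ).symm i) := by
      rw [List.getD_eq_getElem _ _ i.2, getElem_states]
    have h2 : i ∈ (composite 𝒜 ℬ).accept ↔ (data 𝒜 ℬ).IsFinal ((stateEquiv 𝒜 ℬ).symm i) := by
      simp only [composite, TwoWayTransducer.relabel, Finset.mem_map_equiv, CompData.mem_accept]
    exact if_congr (by rw [h1, isFinal_iff, h2]) rfl rfl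

theorem composite_isAperiodic (hA : 𝒜.IsAperiodic) (hB : ℬ.IsAperiodic) :
    (composite 𝒜 ℬ).IsAperiodic :=
  TwoWayTransducer.relabel_isAperiodic _ _ <| TwoWayAutomaton.isAperiodic_of_crossing _ <|
    CompData.machine_crossing mem_enum (𝒜.complete_runWord_wordPow hA) hB

theorem fn_composite : (composite 𝒜 ℬ).fn = ℬ.fn.comp 𝒜.fn := by
  refine PFun.ext fun u v => ?_
  have h : (stateEquiv 𝒜 ℬ).symm (composite 𝒜 ℬ).start = initial 𝒜 ℬ :=
    (stateEquiv 𝒜 ℬ).symm_apply_apply _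
  have h' : (composite 𝒜 ℬ).Produces u (composite 𝒜 ℬ).start 0 v ↔
      𝒜.complete.run 𝒜.complete.start (markedWord u) ∈ 𝒜.complete.accept ∧
        ℬ.Produces (𝒜.complete.output u) ℬ.start 0 v := by
    rw [composite, TwoWayTransducer.relabel_produces, ← composite, h]
    exact CompData.produces_iff mem_enum (length_block_lt 𝒜 ℬ) rfl
  rw [TwoWayTransducer.mem_fn, h', PFun.comp_apply]
  refine Iff.trans ?_ Part.mem_bind_iff.symm
  simp only [SequentialTransducer.mem_fn, SequentialTransducer.produces_iff_complete,
    TwoWayTransducer.mem_fn]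
  constructor
  · rintro ⟨h₁, h₂⟩
    exact ⟨_, ⟨h₁, rfl⟩, h₂⟩
  · rintro ⟨_, ⟨h₁, rfl⟩, h₂⟩
    exact ⟨h₁, h₂⟩

end CompCode

theorem mainTheorem2 :
    ∃ build : SequentialCode × TwoWayCode → TwoWayCode, Computable build ∧
      ∀ (n m a b c : ℕ)
        (𝒜 : SequentialTransducer (Fin n) (Fin a) (Fin b))
        (ℬ : TwoWayTransducer (Fin m) (Fin b) (Fin c)),
        𝒜.IsAperiodic → ℬ.IsAperiodic →
          ∃ (N : ℕ) (𝒞 : TwoWayTransducer (Fin N) (Fin a) (Fin c)),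
            𝒞.code = build (𝒜.code, ℬ.code) ∧ 𝒞.IsAperiodic ∧ 𝒞.fn = ℬ.fn.comp 𝒜.fn := by
  refine ⟨CompCode.build, CompCode.primrec_build.to_comp, fun n m a b c 𝒜 ℬ hA hB => ?_⟩
  exact ⟨_, CompCode.composite 𝒜 ℬ, CompCode.code_composite 𝒜 ℬ,
    CompCode.composite_isAperiodic 𝒜 ℬ hA hB, CompCode.fn_composite 𝒜 ℬ⟩
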